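/- Setting. For points $x_1,\dots,x_N\in\mathbb{R}^D$ (all of weight $1$), $K\ge 1$ and a fuzzifier $m\in\mathbb{N}$, $m\ge 2$, the cost of means $\mu_1,\dots,\mu_K\in\mathbb{R}^D$ and memberships $r_{nk}\in[0,1]$ with $\sum_{k=1}^K r_{nk}=1$ for every $n$ is $\phi_X^{(m)}(\{\mu_k\},\{r_{nk}\})=\sum_{n=1}^N\sum_{k=1}^K r_{nk}^m\,\|x_n-\mu_k\|^2$. Let $\phi^{(m)}_X(\{\mu_k\})$ be the minimum of this cost over all memberships (the cost of the solution induced by the means), and let $\phi^{OPT}_{(X,K,m)}$ be the minimum over all means and memberships. Computation is on a real RAM: each arithmetic operation ($+,-,\cdot$ on natural numbers; $+,-,\cdot,/,\sqrt{\phantom{x}}$ on reals), conversion of a natural number to a real, comparison, copy or indirect memory access costs one time unit, and there is no rounding from reals to integers. Theorem (Candidate Set). There are one deterministic real-RAM algorithm, constants $C_D$ depending only on $D$, and constants $C_{K,D}$ depending only on $K$ and $D$, such that the following holds for all $D\ge 1$, $K\ge 1$, $m\ge 2$, $N\ge 2$, $\epsilon\in(0,1]$ and all $X=(x_1,\dots,x_N)$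 in $\mathbb{R}^D$. Given $X,K,m,\epsilon$, the algorithm computes (a list of the points of) a finite set $\mathcal{G}\subset\mathbb{R}^D$ of size $$|\mathcal{G}|\le C_D\cdot K^{mD+1}\,\epsilon^{-D}\,m\,\log\!\left(\frac{mK}{\epsilon}\right)\log N$$ that contains means $\mu_1,\dots,\mu_K\in\mathcal{G}$ (not necessarily distinct) with $$\phi_X^{(m)}(\{\mu_k\}_{k=1}^K)\le(1+\epsilon)\,\phi^{OPT}_{(X,K,m)},$$ and its running time is at most $$C_{K,D}\cdot\left(N(\log N)^K\epsilon^{-2K^2D}+NKD\,|\mathcal{G}|\right).$$ -/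

import Mathlib

noncomputable section

/-! ### A real RAM with unit costs

The machine has two unbounded memories: one whose cells hold natural numbers (counters, addresses)
and one whose cells hold real numbers. Every arithmetic operation, every copy, every indirect access
and every comparison costs one time unit. There is no rounding operation from the reals to the
natural numbers. Programs are finite and contain no real constants. -/

namespace RealRAM

/-- Contents of the two memories. -/
@[ext]
structure State where
  nat : ℕ → ℕ
  real : ℕ → ℝ

/-- Elementary instructions. `d` is the address of the destination cell, `a` and `b` are addresses of
operands. -/
inductive Instr where
  | natConst (d c : ℕ)
  | natCopy (d a : ℕ)
  | natAdd (d a b : ℕ)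
  | natSub (d a b : ℕ)
  | natMul (d a b : ℕ)
  | natLoad (d a : ℕ)
  | natStore (a b : ℕ)
  | realOfNat (d a : ℕ)
  | realCopy (d a : ℕ)
  | realAdd (d a b : ℕ)
  | realSub (d a b : ℕ)
  | realMul (d a b : ℕ)
  | realDiv (d a b : ℕ)
  | realSqrt (d a : ℕ)
  | realLoad (d a : ℕ)
  | realStore (a b : ℕ)

/-- Write a value into a cell of the natural-number memory. -/
def State.setNat (s : State) (d v : ℕ) : State :=
  { s with nat := Function.update s.nat d v }

/-- Write a value into a cell of the real memory. -/
def State.setReal (s : State) (d : ℕ) (v : ℝ) : State :=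
  { s with real := Function.update s.real d v }

/-- Effect of an elementary instruction. Subtraction of natural numbers is truncated; `natLoad`,
`natStore`, `realLoad`, `realStore` use the natural number in cell `a` as an address. -/
def Instr.run : Instr → State → State
  | .natConst d c, s => s.setNat d c
  | .natCopy d a, s => s.setNat d (s.nat a)
  | .natAdd d a b, s => s.setNat d (s.nat a + s.nat b)
  | .natSub d a b, s => s.setNat d (s.nat a - s.nat b)
  | .natMul d a b, s => s.setNat d (s.nat a * s.nat b)
  | .natLoad d a, s => s.setNat d (s.nat (s.nat a))
  | .natStore a b, s => s.setNat (s.nat a) (s.nat b)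
  | .realOfNat d a, s => s.setReal d (s.nat a : ℝ)
  | .realCopy d a, s => s.setReal d (s.real a)
  | .realAdd d a b, s => s.setReal d (s.real a + s.real b)
  | .realSub d a b, s => s.setReal d (s.real a - s.real b)
  | .realMul d a b, s => s.setReal d (s.real a * s.real b)
  | .realDiv d a b, s => s.setReal d (s.real a / s.real b)
  | .realSqrt d a, s => s.setReal d (Real.sqrt (s.real a))
  | .realLoad d a, s => s.setReal d (s.real (s.nat a))
  | .realStore a b, s => s.setReal (s.nat a) (s.real b)

/-- Comparisons of two memory cells. -/
inductive Test where
  | natLt (a b : ℕ)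
  | natEq (a b : ℕ)
  | realLt (a b : ℕ)
  | realEq (a b : ℕ)

/-- Outcome of a comparison. -/
def Test.Holds : Test → State → Prop
  | .natLt a b, s => s.nat a < s.nat b
  | .natEq a b, s => s.nat a = s.nat b
  | .realLt a b, s => s.real a < s.real b
  | .realEq a b, s => s.real a = s.real b

/-- Programs: finite combinations of instructions by sequencing, branching and while-loops. -/
inductive Prog where
  | skip
  | instr (i : Instr)
  | seq (p q : Prog)
  | branch (c : Test) (p q : Prog)
  | loop (c : Test) (p : Prog)

/-- `Exec p s s' t`: started in state `s`, the program `p` terminates in state `s'` after exactly `t`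
time units. -/
inductive Exec : Prog → State → State → ℕ → Prop where
  | skip (s : State) : Exec .skip s s 0
  | instr (i : Instr) (s : State) : Exec (.instr i) s (i.run s) 1
  | seq {p q : Prog} {s s' s'' : State} {t u : ℕ} :
      Exec p s s' t → Exec q s' s'' u → Exec (.seq p q) s s'' (t + u)
  | branch_true {c : Test} {p q : Prog} {s s' : State} {t : ℕ} :
      c.Holds s → Exec p s s' t → Exec (.branch c p q) s s' (t + 1)
  | branch_false {c : Test} {p q : Prog} {s s' : State} {t : ℕ} :
      ¬ c.Holds s → Exec q s s' t → Exec (.branch c p q) s s' (t + 1)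
  | loop_true {c : Test} {p : Prog} {s s' s'' : State} {t u : ℕ} :
      c.Holds s → Exec p s s' t → Exec (.loop c p) s' s'' u →
        Exec (.loop c p) s s'' (t + u + 1)
  | loop_false {c : Test} {p : Prog} {s : State} :
      ¬ c.Holds s → Exec (.loop c p) s s 1

end RealRAM

/-! ### The fuzzy `K`-means problem (unit weights) -/

namespace FuzzyKMeans

/-- Membership values: `r n k ∈ [0,1]` and `∑ k, r n k = 1` for every data point `n`. -/
def IsMembership {N K : ℕ} (r : Fin N → Fin K → ℝ) : Prop :=
  (∀ n k, r n k ∈ Set.Icc (0 : ℝ) 1) ∧ ∀ n, ∑ k, r n k = 1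

/-- Cost of means `μ` and memberships `r`, with fuzzifier `m`. -/
def cost {D N K : ℕ} (X : Fin N → EuclideanSpace ℝ (Fin D)) (m : ℕ)
    (μ : Fin K → EuclideanSpace ℝ (Fin D)) (r : Fin N → Fin K → ℝ) : ℝ :=
  ∑ n, ∑ k, r n k ^ m * ‖X n - μ k‖ ^ 2

/-- Cost of the solution induced by the means `μ`, i.e. with optimal memberships for `μ`. -/
def inducedCost {D N K : ℕ} (X : Fin N → EuclideanSpace ℝ (Fin D)) (m : ℕ)
    (μ : Fin K → EuclideanSpace ℝ (Fin D)) : ℝ :=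
  sInf {c : ℝ | ∃ r : Fin N → Fin K → ℝ, IsMembership r ∧ c = cost X m μ r}

/-- Optimal cost over all means and memberships. -/
def optCost {D N : ℕ} (X : Fin N → EuclideanSpace ℝ (Fin D)) (K m : ℕ) : ℝ :=
  sInf {c : ℝ | ∃ (μ : Fin K → EuclideanSpace ℝ (Fin D)) (r : Fin N → Fin K → ℝ),
    IsMembership r ∧ c = cost X m μ r}

/-- Initial memory for the instance `(X, K, m, ε)`: the natural-number cells `0, 1, 2, 3` hold
`N, D, K, m`; real cell `0` holds `ε`, and real cell `1 + n * D + i` holds coordinate `i` of point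
`n`; every other cell holds `0`. -/
def input {D N : ℕ} (X : Fin N → EuclideanSpace ℝ (Fin D)) (K m : ℕ) (ε : ℝ) :
    RealRAM.State where
  nat a := if a = 0 then N else if a = 1 then D else if a = 2 then K else if a = 3 then m else 0
  real a :=
    if a = 0 then ε
    else if h : (a - 1) / D < N ∧ (a - 1) % D < D then X ⟨(a - 1) / D, h.1⟩ ⟨(a - 1) % D, h.2⟩
    else 0

/-- The final memory lists exactly the points of `G` (possibly with repetitions): natural-number
cell `0` holds the length of the list, and coordinate `i` of entry `g` is in real cell `b + g * D + i`,
where `b` is the content of natural-number cell `1`. -/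
def Outputs {D : ℕ} (s : RealRAM.State) (G : Finset (EuclideanSpace ℝ (Fin D))) : Prop :=
  (G : Set (EuclideanSpace ℝ (Fin D))) =
    Set.range fun g : Fin (s.nat 0) =>
      (WithLp.toLp 2 fun i : Fin D => s.real (s.nat 1 + g.val * D + i.val) :
        EuclideanSpace ℝ (Fin D))

end FuzzyKMeans

end

set_option linter.unusedSimpArgs false

/-! The candidate set consists of fine grids around a few data points, one family of grids for each
length scale, where the data points are found by a deterministic heavy-hitters algorithm.

Scales. Farthest-point traversal with `K` rounds yields centers and the squared covering radius `R`.
The centers together with the farthest remaining point are `K + 1` points at mutual squared distance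
at least `R`. Two of them give membership at least `1/K` to the same mean, so `R ≤ 2 K^m OPT`; the
centers themselves show `OPT ≤ N R`. Hence `OPT` is known up to the factor `2 N K^m`, and it
suffices to double a scale `σ` from `√R / (N K^m)` up to `4 N √R / δ^m` with `δ = ε / (8 m K)`.
These are `O(m log(mK/ε) log N)` scales. If `R = 0`, the centers already have cost zero.

Which means matter. Fix means and memberships of cost `c < (1 + ε/10) OPT`. A mean whose memberships
are all at most `δ` can be dropped: the other memberships at a point still sum to at least `1 -
ε/(8m)`, and by Bernoulli's inequality renormalizing them costs at most a factor `1/(1 - ε/8)`.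
Every other mean has weight `w = ∑ r^m` with `δ^m ≤ w ≤ N`. At a scale `σ` between `√(2c/w)` and
twice that value, Markov's inequality puts at least half of the weight, hence at least `w/2` points,
into the `σ`-ball of the mean. On the other hand a point farther than `σ` from all means costs at
least `σ²/K^m`, so the number of such points is at most `K^m` times the number in the ball
(`heavy_ball`).

Heavy hitters. A metric version of the Misra–Gries algorithm keeps `T = 3·5^D·K^m` counters with
pairwise `σ`-separated representatives. A point increments a counter whose representative is within
`σ`, else opens a free slot, else decrements all counters. By packing, at most `5^D` representatives
lie within `2σ` of any given location. So a decrement removes at most `5^D` units near a given mean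
and at least `T - K·5^D` units far from all means, and the latter were paid for by points farther
than `σ` from all means. Therefore the ball of every relevant mean leaves a representative within
`2σ` of the mean (`Heavy.exists_decrements`, `Heavy.exists_near`).

Grids. A grid of side `4σ` and `⌈128 D K / ε⌉ + 1` points per axis around each representative has a
point within `ε σ / (32 K)` of the mean. Moving the means there costs a relative error of order `ε`
(`exists_good_means`). The count is scales times `T` times grid size.

Running time. The program takes time `O(N K D)` times the length of the list, but repeated points
could make the set smaller than the list. Padding the list with pairwise distinct diagonal points
forces the set to be large enough to pay for the time. The remaining work is a Hoare-style
verification, with time bounds, of an explicit program. -/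

namespace RealRAM

/-! ### Hoare logic with time bounds. -/

/-- Started in `s`, the program `p` terminates within `b` time units in a state satisfying `Q`. -/
def WP (p : Prog) (b : ℕ) (s : State) (Q : State → Prop) : Prop :=
  ∃ s' t, Exec p s s' t ∧ t ≤ b ∧ Q s'

theorem WP.mono {p : Prog} {b b' : ℕ} {s : State} {Q Q' : State → Prop}
    (h : WP p b s Q) (hb : b ≤ b') (hQ : ∀ s', Q s' → Q' s') : WP p b' s Q' := by
  obtain ⟨s', t, he, ht, hq⟩ := h
  exact ⟨s', t, he, ht.trans hb, hQ _ hq⟩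

theorem WP.seq {p q : Prog} {b b' : ℕ} {s : State} {Q R : State → Prop}
    (h : WP p b s Q) (h' : ∀ s', Q s' → WP q b' s' R) : WP (.seq p q) (b + b') s R := by
  obtain ⟨s', t, he, ht, hq⟩ := h
  obtain ⟨s'', t', he', ht', hq'⟩ := h' s' hq
  exact ⟨s'', t + t', .seq he he', add_le_add ht ht', hq'⟩

/-- Sequencing with an explicit intermediate assertion and explicit time bounds. -/
theorem WP.cut {p q : Prog} {B : ℕ} {s : State} {R : State → Prop} (Q : State → Prop) (b b' : ℕ)
    (hB : b + b' ≤ B) (h : WP p b s Q) (h' : ∀ s', Q s' → WP q b' s' R) : WP (.seq p q) B s R :=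
  (WP.seq h h').mono hB fun _ h => h

theorem WP.skip {s : State} {Q : State → Prop} (h : Q s) : WP .skip 0 s Q :=
  ⟨s, 0, .skip s, le_rfl, h⟩

theorem WP.branch {c : Test} {p q : Prog} {b : ℕ} {s : State} {Q : State → Prop}
    (h₁ : c.Holds s → WP p b s Q) (h₂ : ¬ c.Holds s → WP q b s Q) :
    WP (.branch c p q) (b + 1) s Q := by
  by_cases hc : c.Holds s
  · obtain ⟨s', t, he, ht, hq⟩ := h₁ hc
    exact ⟨s', t + 1, .branch_true hc he, by omega, hq⟩
  · obtain ⟨s', t, he, ht, hq⟩ := h₂ hc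
    exact ⟨s', t + 1, .branch_false hc he, by omega, hq⟩

/-- A loop whose body is run exactly `n` times, with an invariant indexed by the iteration. -/
theorem WP.loop {c : Test} {p : Prog} {Q : State → Prop} (n b : ℕ)
    (I : ℕ → State → Prop)
    (hstep : ∀ i < n, ∀ s, I i s → c.Holds s ∧ WP p b s (I (i + 1)))
    (hend : ∀ s, I n s → ¬ c.Holds s ∧ Q s) {s : State} (h0 : I 0 s) :
    WP (.loop c p) (n * (b + 1) + 1) s Q := by
  suffices H : ∀ k, k ≤ n → ∀ s, I (n - k) s → WP (.loop c p) (k * (b + 1) + 1) s Q by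
    exact H n le_rfl s (by simpa using h0)
  intro k
  induction k with
  | zero =>
    intro _ s hs
    obtain ⟨h1, h2⟩ := hend s (by simpa using hs)
    exact ⟨s, 1, .loop_false h1, by omega, h2⟩
  | succ k ih =>
    intro hk s hs
    obtain ⟨hc, s', t, he, ht, hi⟩ := hstep (n - (k + 1)) (by omega) s hs
    rw [show n - (k + 1) + 1 = n - k by omega] at hi
    obtain ⟨s'', t', he', ht', hq⟩ := ih (by omega) s' hi
    refine ⟨s'', t + t' + 1, .loop_true hc he he', ?_, hq⟩
    rw [add_mul]; omega

/-- Straight-line code. -/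
def block : List Instr → Prog
  | [] => .skip
  | i :: l => .seq (.instr i) (block l)

noncomputable def runs : List Instr → State → State
  | [], s => s
  | i :: l, s => runs l (i.run s)

@[simp] theorem runs_nil (s : State) : runs [] s = s := rfl
@[simp] theorem runs_cons (i : Instr) (l : List Instr) (s : State) :
    runs (i :: l) s = runs l (i.run s) := rfl

theorem WP.block {s : State} {Q : State → Prop} {l : List Instr} {b : ℕ} (h : Q (runs l s))
    (hb : l.length ≤ b := by simp only [List.length_cons, List.length_nil]; omega) : WP (block l) b s Q := by
  refine ⟨_, l.length, ?_, hb, h⟩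
  clear h hb
  induction l generalizing s with
  | nil => exact .skip s
  | cons i l ih =>
    have := Exec.seq (Exec.instr i s) (ih (s := i.run s))
    rw [add_comm] at this
    exact this

/-- Straight-line code followed by a loop whose body is run exactly `n` times. -/
theorem WP.for {l : List Instr} {c : Test} {p : Prog} {B : ℕ} {s : State} {Q : State → Prop}
    (n b : ℕ) (I : ℕ → State → Prop) (h0 : I 0 (runs l s))
    (hstep : ∀ i < n, ∀ s, I i s → c.Holds s ∧ WP p b s (I (i + 1)))
    (hend : ∀ s, I n s → ¬ c.Holds s ∧ Q s) (hB : l.length + (n * (b + 1) + 1) ≤ B) :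
    WP (.seq (RealRAM.block l) (.loop c p)) B s Q :=
  (WP.seq (WP.block h0 le_rfl) fun _ h => WP.loop n b I hstep hend h).mono hB fun _ h => h

theorem WP.blockThen {q : Prog} {l : List Instr} {B : ℕ} {s : State} {R : State → Prop} (b : ℕ)
    (h : WP q b (runs l s) R) (hB : l.length + b ≤ B := by simp only [List.length_cons, List.length_nil]; omega) :
    WP (.seq (RealRAM.block l) q) B s R :=
  WP.cut (fun s' => s' = runs l s) _ b hB (WP.block rfl le_rfl) (by rintro _ rfl; exact h)

/-- The continuation is pushed into both branches, so that no common assertion has to be formulated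
at the point where they join. -/
theorem WP.branchThen {c : Test} {p q r : Prog} {B : ℕ} {s : State} {R : State → Prop} (b : ℕ)
    (h₁ : c.Holds s → WP (.seq p r) b s R) (h₂ : ¬ c.Holds s → WP (.seq q r) b s R)
    (hB : b + 1 ≤ B := by omega) : WP (.seq (.branch c p q) r) B s R := by
  by_cases hc : c.Holds s
  · obtain ⟨s', t, he, ht, hq⟩ := h₁ hc
    cases he with
    | seq h h' => exact ⟨s', _, .seq (.branch_true hc h) h', by omega, hq⟩
  · obtain ⟨s', t, he, ht, hq⟩ := h₂ hc
    cases he with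
    | seq h h' => exact ⟨s', _, .seq (.branch_false hc h) h', by omega, hq⟩

theorem WP.skipThen {q : Prog} {b : ℕ} {s : State} {R : State → Prop} (h : WP q b s R) :
    WP (.seq .skip q) b s R :=
  (WP.seq (WP.skip (Q := fun s' => s' = s) rfl) (by rintro _ rfl; exact h)).mono (by omega)
    fun _ h => h

theorem WP.assoc {p q r : Prog} {b : ℕ} {s : State} {R : State → Prop}
    (h : WP (.seq p (.seq q r)) b s R) : WP (.seq (.seq p q) r) b s R := by
  obtain ⟨s', t, he, ht, hq⟩ := h
  cases he with
  | seq h h' => cases h' with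
    | seq h' h'' => exact ⟨s', _, .seq (.seq h h') h'', by omega, hq⟩

@[simp] theorem State.setNat_nat (s : State) (d v a : ℕ) :
    (s.setNat d v).nat a = if a = d then v else s.nat a := by
  simp [State.setNat, Function.update_apply]
@[simp] theorem State.setNat_real (s : State) (d v : ℕ) : (s.setNat d v).real = s.real := rfl
@[simp] theorem State.setReal_real (s : State) (d : ℕ) (v : ℝ) (a : ℕ) :
    (s.setReal d v).real a = if a = d then v else s.real a := by
  simp [State.setReal, Function.update_apply]
@[simp] theorem State.setReal_nat (s : State) (d : ℕ) (v : ℝ) : (s.setReal d v).nat = s.nat := rfl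

attribute [simp] Instr.run Test.Holds

/-- `s'` differs from `s` at most in the natural-number cells `A` and the real cells `B`. -/
def Frame (A B : Set ℕ) (s s' : State) : Prop :=
  (∀ a, a ∉ A → s'.nat a = s.nat a) ∧ ∀ a, a ∉ B → s'.real a = s.real a

theorem Frame.refl (A B : Set ℕ) (s : State) : Frame A B s s := ⟨fun _ _ => rfl, fun _ _ => rfl⟩

/-- Frames are upper bounds for the modified cells. The inclusions default to tactic proofs, so that
invariants only have to name the sets of cells. -/
theorem Frame.trans {A B A' B' A'' B'' : Set ℕ} {s s' s'' : State} (h : Frame A B s s')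
    (h' : Frame A' B' s' s'') (hA : A ⊆ A'' := by intro a ha; first | (simp at ha ⊢; done) | (simp at ha ⊢; omega))
    (hB : B ⊆ B'' := by intro a ha; first | (simp at ha ⊢; done) | (simp at ha ⊢; omega))
    (hA' : A' ⊆ A'' := by intro a ha; first | (simp at ha ⊢; done) | (simp at ha ⊢; omega))
    (hB' : B' ⊆ B'' := by intro a ha; first | (simp at ha ⊢; done) | (simp at ha ⊢; omega)) : Frame A'' B'' s s'' :=
  ⟨fun a ha => (h'.1 a fun h => ha (hA' h)).trans (h.1 a fun h => ha (hA h)),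
   fun a ha => (h'.2 a fun h => ha (hB' h)).trans (h.2 a fun h => ha (hB h))⟩

theorem Frame.mono {A B A'' B'' : Set ℕ} {s s' : State} (h : Frame A B s s')
    (hA : A ⊆ A'' := by intro a ha; first | (simp at ha ⊢; done) | (simp at ha ⊢; omega))
    (hB : B ⊆ B'' := by intro a ha; first | (simp at ha ⊢; done) | (simp at ha ⊢; omega)) : Frame A'' B'' s s' :=
  ⟨fun a ha => h.1 a fun h => ha (hA h), fun a ha => h.2 a fun h => ha (hB h)⟩

/-! ### Memory layout, distances and copying of points. -/

/-- Squared distance of the `D`-dimensional points stored at the addresses in cells `20`, `21`. -/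
def distProg : Prog :=
  .seq (block [.natConst 22 0, .realOfNat 1 22])
    (.loop (.natLt 22 1) (block [.natAdd 23 20 22, .realLoad 0 23, .natAdd 23 21 22, .realLoad 2 23,
      .realSub 0 0 2, .realMul 0 0 0, .realAdd 1 1 0, .natAdd 22 22 5]))

theorem distProg_spec (s : State) (D : ℕ) (h5 : s.nat 5 = 1) (h1 : s.nat 1 = D)
    (h20 : 3 ≤ s.nat 20) (h21 : 3 ≤ s.nat 21) :
    WP distProg (9 * D + 3) s fun s' => Frame {22, 23} {0, 1, 2} s s' ∧
      s'.real 1 = ∑ i ∈ Finset.range D,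
        (s.real (s.nat 20 + i) - s.real (s.nat 21 + i)) ^ 2 := by
  refine WP.for D 8 (fun i s' =>
    (Frame {22, 23} {0, 1, 2} s s' ∧ s'.nat 22 = i ∧ s'.real 1 = ∑ i ∈ Finset.range i,
        (s.real (s.nat 20 + i) - s.real (s.nat 21 + i)) ^ 2)) ?_ ?_ ?_ (by simp; omega)
  · refine ⟨⟨?_, ?_⟩, ?_, ?_⟩ <;> simp <;> grind
  · rintro i hi s' ⟨hF, h22, hr⟩
    refine ⟨by simp [h22, hF.1, h1, hi], WP.block ?_⟩
    refine ⟨⟨?_, ?_⟩, ?_, ?_⟩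
    · intro a ha; have := hF.1 a ha; simp at ha; simp [ha, this]
    · intro a ha; have := hF.2 a ha; simp at ha; simp [ha, this]
    · simp [h22, hF.1, h5]
    · simp (disch := first | (simp; done) | (simp; omega)) [h22, hF.1, hF.2, hr, Finset.sum_range_succ, if_neg]
      ring
  · rintro s' ⟨hF, h22, hr⟩
    exact ⟨by simp [h22, hF.1, h1], hF, hr⟩

theorem mul_add_lt_mul {n N i D : ℕ} (hn : n < N) (hi : i < D) : n * D + i < N * D := by
  calc n * D + i < n * D + D := by omega
    _ = (n + 1) * D := by ring
    _ ≤ N * D := Nat.mul_le_mul_right _ hn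

/-- The parameters and the points (relocated to the address `b`) are in their places. -/
structure Env (N D K m b : ℕ) (x : ℕ → ℕ → ℝ) (s : State) : Prop where
  n0 : s.nat 0 = N
  n1 : s.nat 1 = D
  n2 : s.nat 2 = K
  n3 : s.nat 3 = m
  n4 : s.nat 4 = 0
  n5 : s.nat 5 = 1
  n6 : s.nat 6 = b
  n7 : s.nat 7 = b + N * D
  n9 : s.nat 9 = b + N * D + N
  hb : 16 ≤ b
  pts : ∀ n < N, ∀ i < D, s.real (b + n * D + i) = x n i

theorem Env.mono {N D K m b : ℕ} {x : ℕ → ℕ → ℝ} {s s' : State} {A B : Set ℕ}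
    (h : Env N D K m b x s) (hF : Frame A B s s')
    (hA : ∀ a < 10, a ≠ 8 → a ∉ A := by intro a _ _; first | (simp; done) | (simp; omega))
    (hB : ∀ a, 16 ≤ a → a < b + N * D → a ∉ B := by intro a _ _; first | (simp; done) | (simp; omega)) :
    Env N D K m b x s' := by
  have := h.hb
  have e := fun a h₁ h₂ => hF.1 a (hA a h₁ h₂)
  refine ⟨?_, ?_, ?_, ?_, ?_, ?_, ?_, ?_, ?_, h.hb, ?_⟩
  · rw [e _ (by simp) (by simp), h.n0]
  · rw [e _ (by simp) (by simp), h.n1]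
  · rw [e _ (by simp) (by simp), h.n2]
  · rw [e _ (by simp) (by simp), h.n3]
  · rw [e _ (by simp) (by simp), h.n4]
  · rw [e _ (by simp) (by simp), h.n5]
  · rw [e _ (by simp) (by simp), h.n6]
  · rw [e _ (by simp) (by simp), h.n7]
  · rw [e _ (by simp) (by simp), h.n9]
  · intro n hn i hi
    have := mul_add_lt_mul hn hi
    rw [hF.2 _ (hB _ (by omega) (by omega)), h.pts n hn i hi]

/-- The list of length `l` at the address `o` has the point `v` as an entry. -/
def Lists (D o : ℕ) (s : State) (l : ℕ) (v : ℕ → ℝ) : Prop :=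
  ∃ g < l, ∀ i < D, s.real (o + g * D + i) = v i

theorem Lists.mono {D o l l' : ℕ} {s s' : State} {v : ℕ → ℝ} {A B : Set ℕ} (h : Lists D o s l v)
    (hF : Frame A B s s') (hl : l ≤ l') (hB : ∀ a, o ≤ a → a < o + l * D → a ∉ B) :
    Lists D o s' l' v := by
  obtain ⟨g, hg, H⟩ := h
  refine ⟨g, hg.trans_le hl, fun i hi => ?_⟩
  have := mul_add_lt_mul hg hi
  rw [hF.2 _ (hB _ (by omega) (by omega)), H i hi]

/-- Append the point at the address in cell `20` to the output. -/
def copyProg : Prog :=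
  .seq (.seq (block [.natConst 22 0])
    (.loop (.natLt 22 1) (block [.natAdd 23 20 22, .realLoad 0 23, .natAdd 23 8 22,
      .realStore 23 0, .natAdd 22 22 5])))
    (block [.natAdd 8 8 1, .natAdd 10 10 5])

theorem copyProg_spec (s : State) (D : ℕ) (h5 : s.nat 5 = 1) (h1 : s.nat 1 = D)
    (h20 : 1 ≤ s.nat 20) (h8 : s.nat 20 + D ≤ s.nat 8) :
    WP copyProg (6 * D + 4) s fun s' =>
      Frame {8, 10, 22, 23} ({0} ∪ Set.Ico (s.nat 8) (s.nat 8 + D)) s s' ∧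
      s'.nat 8 = s.nat 8 + D ∧ s'.nat 10 = s.nat 10 + 1 ∧
      ∀ i < D, s'.real (s.nat 8 + i) = s.real (s.nat 20 + i) := by
  refine WP.cut (fun s' => Frame {22, 23} ({0} ∪ Set.Ico (s.nat 8) (s.nat 8 + D)) s s' ∧
      ∀ j < D, s'.real (s.nat 8 + j) = s.real (s.nat 20 + j)) (6 * D + 2) 2 (by omega) ?_ ?_
  · refine WP.for D 5 (fun i s' =>
      Frame {22, 23} ({0} ∪ Set.Ico (s.nat 8) (s.nat 8 + D)) s s' ∧ s'.nat 22 = i ∧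
      ∀ j < i, s'.real (s.nat 8 + j) = s.real (s.nat 20 + j)) ?_ ?_ ?_ (by simp; omega)
    · refine ⟨⟨?_, ?_⟩, ?_, ?_⟩ <;> simp
      grind
    · rintro i hi s' ⟨hF, h22, hr⟩
      refine ⟨by simp [h22, hF.1, h1, hi], WP.block ?_⟩
      have e8 := hF.1 8 (by simp)
      have e20 := hF.1 20 (by simp)
      refine ⟨⟨?_, ?_⟩, ?_, ?_⟩
      · intro a ha; have := hF.1 a ha; simp at ha; simp [ha, this]
      · intro a ha; have := hF.2 a ha; simp at ha; simp [ha, this, e8, h22]; omega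
      · simp [h22, hF.1, h5]
      · intro j hj
        have e := hF.2 (s.nat 20 + i) (by simp; omega)
        rcases Nat.lt_succ_iff_lt_or_eq.mp hj with hj | rfl
        · simp [e8, h22, hr j hj, hj.ne]; omega
        · simp [e8, e20, h22, e]
    · rintro s' ⟨hF, h22, hr⟩
      exact ⟨by simp [h22, hF.1, h1], hF, hr⟩
  · rintro s' ⟨hF, hr⟩
    refine WP.block ⟨⟨?_, ?_⟩, ?_, ?_, ?_⟩
    · intro a ha; simp at ha; have := hF.1 a (by simp; omega); simp [ha, this]
    · intro a ha; have := hF.2 a ha; simp at ha; simp [this]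
    · simp [hF.1, h1]
    · simp [hF.1, h5]
    · simpa using hr

/-- Squared distance of two points given by their coordinates. -/
def sqDist (D : ℕ) (x : ℕ → ℕ → ℝ) (n p : ℕ) : ℝ := ∑ i ∈ Finset.range D, (x n i - x p i) ^ 2

theorem sqDist_nonneg (D : ℕ) (x : ℕ → ℕ → ℝ) (n p : ℕ) : 0 ≤ sqDist D x n p :=
  Finset.sum_nonneg fun _ _ => sq_nonneg _

theorem distProg_env {N D K m b : ℕ} {x : ℕ → ℕ → ℝ} {s : State} (hE : Env N D K m b x s)
    {n p : ℕ} (hn : n < N) (hp : p < N) (h20 : s.nat 20 = b + n * D)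
    (h21 : s.nat 21 = b + p * D) :
    WP distProg (9 * D + 3) s fun s' => Frame {22, 23} {0, 1, 2} s s' ∧
      s'.real 1 = sqDist D x n p := by
  have := hE.hb
  refine (distProg_spec s D hE.n5 hE.n1 (by omega) (by omega)).mono le_rfl ?_
  rintro s' ⟨hF, h⟩
  refine ⟨hF, h.trans (Finset.sum_congr rfl fun i hi => ?_)⟩
  have hi := Finset.mem_range.mp hi
  rw [h20, h21, hE.pts n hn i hi, hE.pts p hp i hi]

/-! ### Farthest-point traversal. -/

/-- After `k` rounds of farthest-point traversal: `c` are the chosen points, `d n` is the squared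
distance of point `n` to them, and `p` is a farthest point. -/
structure Farthest (N : ℕ) (dd : ℕ → ℕ → ℝ) (k : ℕ) (c : ℕ → ℕ) (d : ℕ → ℝ) (M : ℝ) (p : ℕ) :
    Prop where
  hp : p < N
  hc : ∀ i < k, c i < N
  hM : 0 < k → 0 ≤ M ∧ M ≤ d p ∧ ∀ n < N, d n ≤ M
  near : 0 < k → ∀ n < N, ∃ i < k, d n = dd (c i) n
  le : ∀ n < N, ∀ i < k, d n ≤ dd (c i) n
  sep : ∀ i < k, ∀ j < i, ∀ n < N, d n ≤ dd (c j) (c i)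

/-- Before the first center is chosen, the distance array and the maximum are meaningless, which is
why the fields about them are guarded; the traversal starts at point `0`. -/
theorem Farthest.zero {N : ℕ} (dd : ℕ → ℕ → ℝ) (hN : 0 < N) (c : ℕ → ℕ) (d : ℕ → ℝ) (M : ℝ) :
    Farthest N dd 0 c d M 0 where
  hp := hN
  hc := by simp
  hM := by simp
  near := by simp
  le := by simp
  sep := by simp

/-- Distances to the centers only decrease, so the old separation inequalities persist. The new
center maximizes the old distances, so its distance to every old center is at least the old, hence
the new, distance of any point. -/
theorem Farthest.succ {N k p p' : ℕ} {dd : ℕ → ℕ → ℝ} {c : ℕ → ℕ} {d d' : ℕ → ℝ} {M M' : ℝ}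
    (h : Farthest N dd k c d M p)
    (hd : ∀ n < N, d' n = if 0 < k ∧ d n < dd p n then d n else dd p n)
    (hp' : p' < N) (hM' : 0 ≤ M' ∧ M' ≤ d' p' ∧ ∀ n < N, d' n ≤ M') :
    Farthest N dd (k + 1) (Function.update c k p) d' M' p' where
  hp := hp'
  hc i hi := by
    rcases Nat.lt_succ_iff_lt_or_eq.mp hi with hi | rfl
    · simpa [hi.ne] using h.hc i hi
    · simpa using h.hp
  hM _ := hM'
  near _ n hn := by
    by_cases hk : 0 < k ∧ d n < dd p n
    · obtain ⟨i, hi, e⟩ := h.near hk.1 n hn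
      exact ⟨i, by omega, by rw [hd n hn, if_pos hk, e]; simp [hi.ne]⟩
    · exact ⟨k, by omega, by rw [hd n hn, if_neg hk]; simp⟩
  le n hn i hi := by
    have hle : d' n ≤ dd p n := by rw [hd n hn]; split_ifs with H <;> grind
    rcases Nat.lt_succ_iff_lt_or_eq.mp hi with hi | rfl
    · have := h.le n hn i hi
      rw [hd n hn]; simp only [ne_eq, hi.ne, not_false_eq_true, Function.update_of_ne]
      split_ifs with H
      · exact this
      · have : dd p n ≤ d n := by by_contra hh; exact H ⟨by omega, not_le.mp hh⟩
        linarith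
    · simpa using hle
  sep i hi j hj n hn := by
    have hk : 0 < k := by omega
    have hle : d' n ≤ d n := by
      rw [hd n hn]; split_ifs with H
      · exact le_rfl
      · by_contra hh; exact H ⟨hk, not_le.mp hh⟩
    have hjk : j < k := by omega
    rcases Nat.lt_succ_iff_lt_or_eq.mp hi with hi | rfl
    · simpa [hi.ne, hjk.ne] using hle.trans (h.sep i hi j hj n hn)
    · obtain ⟨_, h1, h2⟩ := h.hM hk
      have := h.le p h.hp j hj
      simp only [ne_eq, hjk.ne, not_false_eq_true, Function.update_of_ne, Function.update_self]
      linarith [h2 n hn]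

/-- Update the distance of point `n` (cell `27`) to the chosen points, of which the one at the
address in cell `20` is the latest, and the farthest point so far. -/
def updateProg : Prog :=
  .seq (block [.natMul 21 27 1, .natAdd 21 21 6]) <| .seq distProg <|
  .seq (block [.natAdd 29 7 27]) <|
  .seq (.branch (.natLt 4 26)
    (.seq (block [.realLoad 0 29]) (.branch (.realLt 0 1) (block [.realCopy 1 0]) .skip)) .skip) <|
  .seq (block [.realStore 29 1]) <|
  .seq (.branch (.realLt 4 1) (block [.realCopy 4 1, .natCopy 28 27]) .skip)
    (block [.natAdd 27 27 5])

theorem updateProg_spec {N D K m b : ℕ} {x : ℕ → ℕ → ℝ} {s : State} (hE : Env N D K m b x s)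
    {n p k : ℕ} (hn : n < N) (hp : p < N) (h20 : s.nat 20 = b + p * D) (h27 : s.nat 27 = n)
    (h26 : s.nat 26 = k) :
    WP updateProg (9 * D + 15) s fun s' =>
      Frame {21, 22, 23, 27, 28, 29} {0, 1, 2, 4, b + N * D + n} s s' ∧ s'.nat 27 = n + 1 ∧
      ∃ v, v = (if 0 < k ∧ s.real (b + N * D + n) < sqDist D x p n then s.real (b + N * D + n)
        else sqDist D x p n) ∧ s'.real (b + N * D + n) = v ∧
      ((s.real 4 < v ∧ s'.real 4 = v ∧ s'.nat 28 = n) ∨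
        (v ≤ s.real 4 ∧ s'.real 4 = s.real 4 ∧ s'.nat 28 = s.nat 28)) := by
  have hb := hE.hb
  refine WP.blockThen (9 * D + 13) ?_
  set s₁ := runs _ s with hs₁
  have hF₁ : Frame {21} ∅ s s₁ := by
    refine ⟨?_, ?_⟩ <;> intro a ha <;> simp at ha <;> simp [hs₁, ha]
  have h21 : s₁.nat 21 = b + n * D := by
    simp [hs₁, h27, hE.n1, hE.n6, add_comm]
  clear_value s₁
  have hE₁ := hE.mono hF₁
  refine WP.cut _ _ 10 (by omega)
    (distProg_env hE₁ hp hn ((hF₁.1 20 (by simp)).trans h20) h21) ?_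
  rintro s₂ ⟨hF₂, hr₂⟩
  have hF : Frame {21, 22, 23} {0, 1, 2} s s₂ := hF₁.trans hF₂
  clear hE₁ hF₁ hF₂ h21 hs₁ s₁
  have hE₂ := hE.mono hF
  have e4 : s₂.nat 4 = 0 := hE₂.n4
  have e7 : s₂.nat 7 = b + N * D := hE₂.n7
  have e26 : s₂.nat 26 = k := by rw [hF.1 26 (by simp), h26]
  have e27 : s₂.nat 27 = n := by rw [hF.1 27 (by simp), h27]
  have eD : s₂.real (b + N * D + n) = s.real (b + N * D + n) := hF.2 _ (by simp; omega)
  have eM : s₂.real 4 = s.real 4 := hF.2 _ (by simp)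
  have e5 : s₂.nat 5 = 1 := hE₂.n5
  have n4 : b + N * D + n ≠ 4 := by omega
  refine WP.blockThen 9 ?_
  -- The three paths differ only in how the minimum reached real cell `1`; `H` is the common tail of
  -- the computation.
  suffices H : ∀ s₃ v, Frame {21, 22, 23, 29} {0, 1, 2} s s₃ → s₃.nat 29 = b + N * D + n →
      s₃.real 1 = v → (v = if 0 < k ∧ s.real (b + N * D + n) < sqDist D x p n then
        s.real (b + N * D + n) else sqDist D x p n) → WP (.seq (block [.realStore 29 1]) <|
        .seq (.branch (.realLt 4 1) (block [.realCopy 4 1, .natCopy 28 27]) .skip)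
        (block [.natAdd 27 27 5])) 5 s₃ fun s' =>
      Frame {21, 22, 23, 27, 28, 29} {0, 1, 2, 4, b + N * D + n} s s' ∧ s'.nat 27 = n + 1 ∧
      ∃ v, v = (if 0 < k ∧ s.real (b + N * D + n) < sqDist D x p n then s.real (b + N * D + n)
        else sqDist D x p n) ∧ s'.real (b + N * D + n) = v ∧
      ((s.real 4 < v ∧ s'.real 4 = v ∧ s'.nat 28 = n) ∨
        (v ≤ s.real 4 ∧ s'.real 4 = s.real 4 ∧ s'.nat 28 = s.nat 28)) by
    refine WP.branchThen 8 (fun hc => WP.assoc (WP.blockThen 7 (WP.branchThen 6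
      (fun hc' => WP.blockThen 5 ?_) fun hc' => WP.skipThen ?_)))
      (fun hc => WP.skipThen ?_)
    · refine H _ _ ?_ ?_ rfl ?_
      · refine hF.trans (A' := {29}) (B' := {0, 1}) ⟨?_, ?_⟩ <;> intro a ha <;> simp at ha <;> simp [ha]
      · simp [e7, e27]
      · simp [e4, e26, e7, e27, eD, hr₂] at hc hc' ⊢
        intro h; linarith [h hc]
    · refine (H _ _ ?_ ?_ rfl ?_).mono (by simp) fun _ h => h
      · refine hF.trans (A' := {29}) (B' := {0, 1}) ⟨?_, ?_⟩ <;> intro a ha <;> simp at ha <;> simp [ha]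
      · simp [e7, e27]
      · simp [e4, e26, e7, e27, eD, hr₂] at hc hc' ⊢
        intro _ h; linarith
    · refine (H _ _ ?_ ?_ rfl ?_).mono (by simp) fun _ h => h
      · refine hF.trans (A' := {29}) (B' := {0, 1}) ⟨?_, ?_⟩ <;> intro a ha <;> simp at ha <;> simp [ha]
      · simp [e7, e27]
      · simp [e4, e26, e7, e27, eD, hr₂] at hc ⊢
        omega
  clear hF hE₂ e4 e7 e26 e27 eD eM e5 hr₂
  intro s₃ v hF h29 hv hv'
  have e27 : s₃.nat 27 = n := by rw [hF.1 27 (by simp), h27]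
  have e28 : s₃.nat 28 = s.nat 28 := by rw [hF.1 28 (by simp)]
  have eM : s₃.real 4 = s.real 4 := hF.2 _ (by simp)
  have e5 : s₃.nat 5 = 1 := by rw [hF.1 5 (by simp), hE.n5]
  refine WP.blockThen 4 (WP.branchThen 3 (fun hc => WP.blockThen 1 (WP.block ?_))
      fun hc => WP.skipThen (WP.block ?_))
  · simp [h29, hv, eM, n4.symm, show b + N * D + n ≠ 1 by omega] at hc
    refine ⟨hF.trans (A' := {27, 28}) (B' := {4, b + N * D + n}) ⟨?_, ?_⟩, ?_, v, hv', ?_, Or.inl ⟨hc, ?_, ?_⟩⟩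
    · intro a ha; simp at ha; simp [ha]
    · intro a ha; simp at ha; simp [ha, h29]
    · simp [e27, e5]
    · simp [h29, hv, n4]
    · simp [hv]
    · simp [e27]
  · simp [h29, hv, eM, n4.symm, show b + N * D + n ≠ 1 by omega] at hc
    refine ⟨hF.trans (A' := {27, 28}) (B' := {4, b + N * D + n}) ⟨?_, ?_⟩, ?_, v, hv', ?_, Or.inr ⟨hc, ?_, ?_⟩⟩
    · intro a ha; simp at ha; simp [ha]
    · intro a ha; simp at ha; simp [ha, h29]
    · simp [e27, e5]
    · simp [h29, hv]
    · simp [eM, h29, n4.symm]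
    · simp [e28]

/-- One round of farthest-point traversal: output the current point and find the next one. -/
def roundProg : Prog :=
  .seq (block [.natMul 20 25 1, .natAdd 20 20 6]) <| .seq copyProg <|
  .seq (.seq (block [.natConst 27 0, .natConst 28 0, .realOfNat 4 27])
    (.loop (.natLt 27 0) updateProg)) (block [.natCopy 25 28, .natAdd 26 26 5])

/-- The running maximum starts at `0` and changes only on strict improvement. If no distance is
positive, the index keeps its default `0`; this is the alternative in the fifth clause. -/
theorem updateLoop_spec {N D K m b : ℕ} {x : ℕ → ℕ → ℝ} {s : State} (hE : Env N D K m b x s)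
    {p k : ℕ} (hp : p < N) (h20 : s.nat 20 = b + p * D) (h26 : s.nat 26 = k) :
    WP (.seq (block [.natConst 27 0, .natConst 28 0, .realOfNat 4 27])
      (.loop (.natLt 27 0) updateProg)) (N * (9 * D + 16) + 4) s fun s' =>
      Frame {21, 22, 23, 27, 28, 29} ({0, 1, 2, 4} ∪ Set.Ico (b + N * D) (b + N * D + N)) s s' ∧
      (∀ n < N, s'.real (b + N * D + n) =
        if 0 < k ∧ s.real (b + N * D + n) < sqDist D x p n then s.real (b + N * D + n)
        else sqDist D x p n) ∧
      s'.nat 28 < N ∧ 0 ≤ s'.real 4 ∧ (s'.real 4 = 0 ∨ s'.real 4 = s'.real (b + N * D + s'.nat 28)) ∧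
      ∀ n < N, s'.real (b + N * D + n) ≤ s'.real 4 := by
  have hb := hE.hb
  set v : ℕ → ℝ := fun n => if 0 < k ∧ s.real (b + N * D + n) < sqDist D x p n then
    s.real (b + N * D + n) else sqDist D x p n with hv
  refine WP.for N (9 * D + 15) (fun i s' =>
    Frame {21, 22, 23, 27, 28, 29} ({0, 1, 2, 4} ∪ Set.Ico (b + N * D) (b + N * D + i)) s s' ∧
    s'.nat 27 = i ∧ (∀ n < i, s'.real (b + N * D + n) = v n) ∧ s'.nat 28 < N ∧ 0 ≤ s'.real 4 ∧
    (s'.real 4 = 0 ∨ s'.nat 28 < i ∧ s'.real 4 = v (s'.nat 28)) ∧ ∀ n < i, v n ≤ s'.real 4)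
    ?_ ?_ ?_ (by simp only [List.length_cons, List.length_nil]; ring_nf; omega)
  · refine ⟨⟨?_, ?_⟩, ?_, ?_, ?_, ?_, ?_, ?_⟩
    · intro a ha; simp at ha; simp [ha]
    · intro a ha; simp at ha; simp [ha]
    · simp
    · simp
    · simp; omega
    · simp
    · simp
    · simp
  · rintro i hi s' ⟨hF, h27, hd, hlt, h0, hM, hle⟩
    refine ⟨by simp [h27, hF.1, hE.n0, hi], ?_⟩
    refine (updateProg_spec (hE.mono hF) hi hp ((hF.1 20 (by simp)).trans h20) h27
      ((hF.1 26 (by simp)).trans h26)).mono le_rfl ?_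
    rintro s'' ⟨hF', h27', w, hw, hwd, hcase⟩
    have hwv : w = v i := by
      rw [hw, hF.2 (b + N * D + i) (by simp; omega)]
    have hd' : ∀ n < i + 1, s''.real (b + N * D + n) = v n := by
      intro n hn
      rcases Nat.lt_succ_iff_lt_or_eq.mp hn with hn | rfl
      · rw [hF'.2 _ (by simp; omega), hd n hn]
      · rw [hwd, hwv]
    refine ⟨hF.trans hF', h27', hd', ?_⟩
    rcases hcase with ⟨h1, h2, h3⟩ | ⟨h1, h2, h3⟩
    · rw [h2, h3, hwv]
      rw [hwv] at h1
      refine ⟨hi, by linarith, Or.inr ⟨by omega, rfl⟩, fun n hn => ?_⟩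
      rcases Nat.lt_succ_iff_lt_or_eq.mp hn with hn | rfl
      · linarith [hle n hn]
      · exact le_rfl
    · rw [h2, h3]
      refine ⟨hlt, h0, hM.imp_right fun h => ⟨by omega, h.2⟩, fun n hn => ?_⟩
      rcases Nat.lt_succ_iff_lt_or_eq.mp hn with hn | rfl
      · exact hle n hn
      · rw [← hwv]; exact h1
  · rintro s' ⟨hF, h27, hd, hlt, h0, hM, hle⟩
    refine ⟨by simp [h27, hF.1, hE.n0], hF, hd, hlt, h0, hM.imp_right fun h => ?_, fun n hn => ?_⟩
    · rw [h.2, hd _ hlt]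
    · rw [hd n hn]; exact hle n hn

/-- State of the output: `l` points have been written. -/
def OutLen (D o : ℕ) (s : State) (l : ℕ) : Prop := s.nat 10 = l ∧ s.nat 8 = o + l * D

theorem roundProg_spec {N D K m b : ℕ} {x : ℕ → ℕ → ℝ} {s : State} (hE : Env N D K m b x s)
    {p k : ℕ} {c : ℕ → ℕ} (h25 : s.nat 25 = p) (h26 : s.nat 26 = k)
    (hf : Farthest N (sqDist D x) k c (fun n => s.real (b + N * D + n)) (s.real 4) p)
    (ho : OutLen D (b + N * D + N) s k)
    (hc : ∀ i < k, Lists D (b + N * D + N) s k (x (c i))) :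
    WP roundProg (N * (9 * D + 16) + 6 * D + 12) s fun s' =>
      Frame {8, 10, 20, 21, 22, 23, 25, 26, 27, 28, 29} ({0, 1, 2, 4} ∪ Set.Ici (b + N * D)) s s' ∧
      ∃ c' p', s'.nat 25 = p' ∧ s'.nat 26 = k + 1 ∧
        Farthest N (sqDist D x) (k + 1) c' (fun n => s'.real (b + N * D + n)) (s'.real 4) p' ∧
        OutLen D (b + N * D + N) s' (k + 1) ∧
        ∀ i < k + 1, Lists D (b + N * D + N) s' (k + 1) (x (c' i)) := by
  have hb := hE.hb
  have hpi : ∀ i < D, p * D + i < N * D := fun i hi => mul_add_lt_mul hf.hp hi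
  have hpD : (p + 1) * D ≤ N * D := Nat.mul_le_mul_right _ hf.hp
  rw [add_mul] at hpD
  refine WP.blockThen (N * (9 * D + 16) + 6 * D + 10) ?_
   
  set s₁ := runs _ s with hs₁
  have hF₁ : Frame {20} ∅ s s₁ := by
    refine ⟨?_, ?_⟩ <;> intro a ha <;> simp at ha <;> simp [hs₁, ha]
  have h20 : s₁.nat 20 = b + p * D := by simp [hs₁, h25, hE.n1, hE.n6, add_comm]
  clear_value s₁
  have hE₁ := hE.mono hF₁
  have h8 : s₁.nat 8 = b + N * D + N + k * D := by rw [hF₁.1 8 (by simp), ho.2]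
  refine WP.cut _ _ (N * (9 * D + 16) + 6) (by omega)
    (copyProg_spec s₁ D hE₁.n5 hE₁.n1 (by omega) (by omega)) ?_
  rintro s₂ ⟨hF₂, h8', h10, hcopy⟩
  rw [h8] at hF₂ hcopy
  have hF : Frame {8, 10, 20, 22, 23} ({0} ∪ Set.Ico (b + N * D + N + k * D)
    (b + N * D + N + k * D + D)) s s₂ := hF₁.trans hF₂
  have hE₂ := hE.mono hF
  refine WP.cut _ _ 2 (by omega) (updateLoop_spec hE₂ hf.hp
    ((hF₂.1 20 (by simp)).trans h20) ((hF.1 26 (by simp)).trans h26)) ?_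
  rintro s₃ ⟨hF₃, hd, hlt, h0, hM, hle⟩
  refine WP.block ?_
  set s₄ := runs _ s₃ with hs₄
  have hF₄ : Frame {25, 26} ∅ s₃ s₄ := by
    refine ⟨?_, ?_⟩ <;> intro a ha <;> simp at ha <;> simp [hs₄, ha]
  have h25' : s₄.nat 25 = s₃.nat 28 := by simp [hs₄]
  have h26' : s₄.nat 26 = k + 1 := by
    simp [hs₄, hF₃.1, hF.1, h26, hE.n5]
  clear_value s₄
  have hF₂₃ : Frame {8, 10, 20, 21, 22, 23, 27, 28, 29} ({0, 1, 2, 4} ∪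
    Set.Ico (b + N * D) (b + N * D + N) ∪ Set.Ico (b + N * D + N + k * D)
    (b + N * D + N + k * D + D)) s s₃ := hF.trans hF₃
  have hF' : Frame {8, 10, 20, 21, 22, 23, 25, 26, 27, 28, 29} ({0, 1, 2, 4} ∪
    Set.Ico (b + N * D) (b + N * D + N) ∪ Set.Ico (b + N * D + N + k * D)
    (b + N * D + N + k * D + D)) s s₄ := hF₂₃.trans hF₄
  have hFD : Frame {21, 22, 23, 25, 26, 27, 28, 29} ({0, 1, 2, 4} ∪
    Set.Ico (b + N * D) (b + N * D + N)) s₂ s₄ := hF₃.trans hF₄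
  have eD : ∀ n < N, s₂.real (b + N * D + n) = s.real (b + N * D + n) := fun n hn =>
    hF.2 _ (by simp; omega)
  have er : ∀ a, s₄.real a = s₃.real a := fun a => hF₄.2 a (by simp)
  refine ⟨hF'.mono, Function.update c k p, _, rfl, h26', hf.succ ?_ ?_ ?_, ⟨?_, ?_⟩, ?_⟩
  · intro n hn; rw [er, hd n hn, eD n hn]
  · rw [h25']; exact hlt
  · simp only [er, h25']
    refine ⟨h0, ?_, hle⟩
    -- If the maximum kept its initial value `0`, it is still below the distance of the selected
    -- point, since that distance is a sum of squares.
    rcases hM with hM | hM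
    · rw [hM, hd _ hlt, eD _ hlt]
      split_ifs with H
      · obtain ⟨i, hi, e⟩ := hf.near H.1 _ hlt
        rw [e]; exact sqDist_nonneg _ _ _ _
      · exact sqDist_nonneg _ _ _ _
    · exact hM.le
  · rw [hFD.1 10 (by simp), h10, hF₁.1 10 (by simp), ho.1]
  · rw [hFD.1 8 (by simp), h8', h8]; ring
  · intro i hi
    rcases Nat.lt_succ_iff_lt_or_eq.mp hi with hi | rfl
    · simp only [ne_eq, hi.ne, not_false_eq_true, Function.update_of_ne]
      exact (hc i hi).mono hF' (by omega) fun a _ _ => by simp; omega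
    · refine ⟨i, by omega, fun j hj => ?_⟩
      rw [hFD.2 _ (by simp; omega), hcopy j hj, h20, hE₁.pts p hf.hp j hj]
      simp

/-- Farthest-point traversal with `K` rounds. -/
def farthestProg : Prog :=
  .seq (block [.natConst 25 0, .natConst 26 0]) (.loop (.natLt 26 2) roundProg)

theorem farthestProg_spec {N D K m b : ℕ} {x : ℕ → ℕ → ℝ} {s : State} (hE : Env N D K m b x s)
    (hN : 0 < N) (ho : OutLen D (b + N * D + N) s 0) :
    WP farthestProg (K * (N * (9 * D + 16) + 6 * D + 13) + 3) s fun s' =>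
      Frame {8, 10, 20, 21, 22, 23, 25, 26, 27, 28, 29} ({0, 1, 2, 4} ∪ Set.Ici (b + N * D)) s s' ∧
      ∃ c d p, Farthest N (sqDist D x) K c d (s'.real 4) p ∧
        OutLen D (b + N * D + N) s' K ∧ ∀ i < K, Lists D (b + N * D + N) s' K (x (c i)) := by
  have hb := hE.hb
  refine WP.for K (N * (9 * D + 16) + 6 * D + 12) (fun k s' =>
      Frame {8, 10, 20, 21, 22, 23, 25, 26, 27, 28, 29} ({0, 1, 2, 4} ∪ Set.Ici (b + N * D)) s s' ∧
      ∃ c p, s'.nat 25 = p ∧ s'.nat 26 = k ∧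
        Farthest N (sqDist D x) k c (fun n => s'.real (b + N * D + n)) (s'.real 4) p ∧
        OutLen D (b + N * D + N) s' k ∧ ∀ i < k, Lists D (b + N * D + N) s' k (x (c i)))
    ?_ ?_ ?_ (by simp only [List.length_cons, List.length_nil]; ring_nf; omega)
  · refine ⟨⟨?_, ?_⟩, fun _ => 0, 0, ?_, ?_, Farthest.zero _ hN _ _ _, ⟨?_, ?_⟩, by simp⟩
    · intro a ha; simp at ha; simp [ha]
    · intro a ha; simp
    · simp
    · simp
    · simp [ho.1]
    · simp [ho.2]
  · rintro k hk s' ⟨hF, c, p, h25, h26, hf, ho, hc⟩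
    have hE' := hE.mono hF
    refine ⟨by simp [h26, hE'.n2, hk], (roundProg_spec hE' h25 h26 hf ho hc).mono le_rfl ?_⟩
    rintro s'' ⟨hF', h⟩
    exact ⟨hF.trans hF', h⟩
  · rintro s' ⟨hF, c, p, h25, h26, hf, ho, hc⟩
    have hE' := hE.mono hF
    exact ⟨by simp [h26, hE'.n2], hF, c, _, p, hf, ho, hc⟩

/-! ### Metric heavy hitters. -/

/-- One step of the metric heavy-hitters algorithm with `T` counters `c` and representatives `r`:
the point `n` increments the counter of a close representative, or occupies a free slot, or
decrements all counters. -/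
def HeavyStep (dd : ℕ → ℕ → ℝ) (σ : ℝ) (T n : ℕ) (c r c' r' : ℕ → ℕ) : Prop :=
  (∃ f < T, c f ≠ 0 ∧ dd n (r f) ≤ σ ∧ (∀ j < T, c' j = if j = f then c j + 1 else c j) ∧
    ∀ j < T, r' j = r j) ∨
  ((∀ j < T, c j ≠ 0 → σ < dd n (r j)) ∧
    ((∃ e < T, c e = 0 ∧ (∀ j < T, c' j = if j = e then 1 else c j) ∧
      ∀ j < T, r' j = if j = e then n else r j) ∨
    ∀ j < T, c j ≠ 0 ∧ c' j = c j - 1 ∧ r' j = r j))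

/-- `c`, `r` are counters and representatives after the first `n` points. -/
inductive Heavy (dd : ℕ → ℕ → ℝ) (σ : ℝ) (T : ℕ) : ℕ → (ℕ → ℕ) → (ℕ → ℕ) → Prop
  | zero {c r : ℕ → ℕ} : (∀ j < T, c j = 0) → (∀ j < T, r j = 0) → Heavy dd σ T 0 c r
  | succ {n : ℕ} {c r c' r' : ℕ → ℕ} : Heavy dd σ T n c r → HeavyStep dd σ T n c r c' r' →
      Heavy dd σ T (n + 1) c' r'

/-- A slot that was never filled has representative `0`. For `N > 0` this is a valid index, so
distances and grids may be computed for all slots without asking whether they are occupied. -/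
theorem Heavy.rep_lt {dd : ℕ → ℕ → ℝ} {σ : ℝ} {T n : ℕ} {c r : ℕ → ℕ} (h : Heavy dd σ T n c r) :
    ∀ j < T, r j = 0 ∨ r j < n := by
  induction h with
  | zero _ h => exact fun j hj => Or.inl (h j hj)
  | succ _ hs ih =>
    intro j hj
    have := ih j hj
    rcases hs with ⟨f, _, _, _, _, h⟩ | ⟨_, ⟨e, _, _, _, h⟩ | h⟩
    · rw [h j hj]; omega
    · rw [h j hj]; split_ifs <;> omega
    · rw [(h j hj).2.2]; omega

/-- The cells describing the two arrays of slots. -/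
structure Slots (T : ℕ) (s : State) : Prop where
  n11 : s.nat 11 = T
  n14 : s.nat 14 = 64
  n15 : s.nat 15 = 64 + T

theorem Slots.mono {T : ℕ} {s s' : State} {A B : Set ℕ} (h : Slots T s) (hF : Frame A B s s')
    (hA : ∀ a < 16, 10 < a → a ∉ A := by
      intro a _ _; first | (simp; done) | (simp; omega)) : Slots T s' :=
  ⟨by rw [hF.1 _ (hA _ (by simp) (by simp)), h.n11],
   by rw [hF.1 _ (hA _ (by simp) (by simp)), h.n14],
   by rw [hF.1 _ (hA _ (by simp) (by simp)), h.n15]⟩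

def scanBody : Prog :=
  .seq (block [.natAdd 34 14 31, .natLoad 35 34]) <|
  .seq (.branch (.natEq 35 4) (block [.natCopy 33 31])
    (.seq (block [.natAdd 34 15 31, .natLoad 36 34, .natMul 21 36 1, .natAdd 21 21 6]) <|
     .seq distProg (.branch (.realLt 9 1) .skip (block [.natCopy 32 31]))))
  (block [.natAdd 31 31 5])

/-- Look for a slot close to the point at the address in cell `20` and for a free slot. -/
def scanProg : Prog :=
  .seq (block [.natConst 31 0, .natCopy 32 11, .natCopy 33 11]) (.loop (.natLt 31 11) scanBody)

theorem scanBody_spec {N D K m b T : ℕ} {x : ℕ → ℕ → ℝ} {s : State} (hE : Env N D K m b x s)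
    (hS : Slots T s) {n j : ℕ} (hn : n < N) (h20 : s.nat 20 = b + n * D) (h31 : s.nat 31 = j)
    (hr : s.nat (64 + T + j) < N) :
    WP scanBody (9 * D + 13) s fun s' =>
      Frame {21, 22, 23, 31, 32, 33, 34, 35, 36} {0, 1, 2} s s' ∧ s'.nat 31 = j + 1 ∧
      ((s.nat (64 + j) = 0 ∧ s'.nat 33 = j ∧ s'.nat 32 = s.nat 32) ∨
       (s.nat (64 + j) ≠ 0 ∧ s'.nat 33 = s.nat 33 ∧
        ((s.real 9 < sqDist D x n (s.nat (64 + T + j)) ∧ s'.nat 32 = s.nat 32) ∨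
          (sqDist D x n (s.nat (64 + T + j)) ≤ s.real 9 ∧ s'.nat 32 = j)))) := by
  have hb := hE.hb
  have m1 : 64 + j ≠ 34 := by omega
  have m2 : 64 + T + j ≠ 34 := by omega
  have m3 : 64 + T + j ≠ 35 := by omega
  refine WP.blockThen (9 * D + 11) ?_
  refine WP.branchThen (9 * D + 10) (fun hc => ?_) (fun hc => ?_) (by omega)
  · simp [hS.n14, h31, hE.n4, m1] at hc
    refine WP.blockThen 1 (WP.block ⟨⟨?_, ?_⟩, ?_, ?_⟩)
    · intro a ha; simp at ha; simp [ha]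
    · intro a ha; simp
    · simp [h31, hE.n5]
    · simp [h31, hc]
  · simp [hS.n14, h31, hE.n4, m1] at hc
    refine WP.assoc (WP.blockThen (9 * D + 6) (WP.assoc ?_))
    set s₁ := runs _ (runs _ s) with hs₁
    have hF₁ : Frame {21, 34, 35, 36} ∅ s s₁ := by
      refine ⟨?_, ?_⟩ <;> intro a ha <;> simp at ha <;> simp [hs₁, ha]
    have h21 : s₁.nat 21 = b + s.nat (64 + T + j) * D := by
      simp [hs₁, m2, m3, h31, hE.n1, hE.n6, hS.n15, add_comm b]
    clear_value s₁
    have hE₁ := hE.mono hF₁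
    refine WP.cut _ _ 3 (by omega)
      (distProg_env hE₁ hn hr ((hF₁.1 20 (by simp)).trans h20) h21) ?_
    rintro s₂ ⟨hF₂, hr₂⟩
    have hF : Frame {21, 22, 23, 34, 35, 36} {0, 1, 2} s s₂ := hF₁.trans hF₂
    have hE₂ := hE.mono hF
    have e9 := hF.2 9 (by simp)
    have e31 := hF.1 31 (by simp)
    have e32 := hF.1 32 (by simp)
    have e33 := hF.1 33 (by simp)
    refine WP.branchThen 2 (fun hc' => ?_) (fun hc' => ?_)
    · simp [e9, hr₂] at hc'
      refine WP.skipThen (WP.block ⟨?_, ?_, ?_⟩)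
      · refine hF.trans (A' := {31}) (B' := ∅) ⟨?_, ?_⟩ <;> intro a ha <;> simp at ha <;> simp [ha]
      · simp [e31, h31, hE₂.n5]
      · simp [hc, e32, e33, hc', not_le.mpr hc']
    · simp [e9, hr₂] at hc'
      refine WP.blockThen 1 (WP.block ⟨?_, ?_, ?_⟩)
      · refine hF.trans (A' := {31, 32}) (B' := ∅) ⟨?_, ?_⟩ <;> intro a ha <;> simp at ha <;>
          simp [ha]
      · simp [e31, h31, hE₂.n5]
      · simp [hc, e31, h31, e33, hc', not_lt.mpr hc']

theorem scanProg_spec {N D K m b T : ℕ} {x : ℕ → ℕ → ℝ} {s : State} (hE : Env N D K m b x s)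
    (hS : Slots T s) {n : ℕ} (hn : n < N) (h20 : s.nat 20 = b + n * D)
    (hr : ∀ j < T, s.nat (64 + T + j) < N) :
    WP scanProg (T * (9 * D + 14) + 4) s fun s' =>
      Frame {21, 22, 23, 31, 32, 33, 34, 35, 36} {0, 1, 2} s s' ∧
      ((s'.nat 32 = T ∧ ∀ j < T, s.nat (64 + j) ≠ 0 →
          s.real 9 < sqDist D x n (s.nat (64 + T + j))) ∨
        (s'.nat 32 < T ∧ s.nat (64 + s'.nat 32) ≠ 0 ∧
          sqDist D x n (s.nat (64 + T + s'.nat 32)) ≤ s.real 9)) ∧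
      ((s'.nat 33 = T ∧ ∀ j < T, s.nat (64 + j) ≠ 0) ∨
        (s'.nat 33 < T ∧ s.nat (64 + s'.nat 33) = 0)) := by
  -- The value `T` in cells `32` and `33` means that no close, respectively no free, slot has been
  -- found so far.
  refine WP.for T (9 * D + 13) (fun i s' =>
    Frame {21, 22, 23, 31, 32, 33, 34, 35, 36} {0, 1, 2} s s' ∧ s'.nat 31 = i ∧
      ((s'.nat 32 = T ∧ ∀ j < i, s.nat (64 + j) ≠ 0 →
          s.real 9 < sqDist D x n (s.nat (64 + T + j))) ∨
        (s'.nat 32 < T ∧ s.nat (64 + s'.nat 32) ≠ 0 ∧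
          sqDist D x n (s.nat (64 + T + s'.nat 32)) ≤ s.real 9)) ∧
      ((s'.nat 33 = T ∧ ∀ j < i, s.nat (64 + j) ≠ 0) ∨
        (s'.nat 33 < T ∧ s.nat (64 + s'.nat 33) = 0)))
    ?_ ?_ ?_ (by simp only [List.length_cons, List.length_nil]; ring_nf; omega)
  · refine ⟨⟨?_, ?_⟩, ?_, ?_, ?_⟩
    · intro a ha; simp at ha; simp [ha]
    · intro a ha; simp
    · simp
    · simp [hS.n11]
    · simp [hS.n11]
  · rintro i hi s' ⟨hF, h31, hf, he⟩
    have hE' := hE.mono hF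
    have hS' := hS.mono hF
    refine ⟨by simp [h31, hS'.n11, hi], ?_⟩
    have ec : s'.nat (64 + i) = s.nat (64 + i) := hF.1 _ (by simp; omega)
    have er : s'.nat (64 + T + i) = s.nat (64 + T + i) := hF.1 _ (by simp; omega)
    refine (scanBody_spec hE' hS' hn ((hF.1 20 (by simp)).trans h20) h31
      (by rw [er]; exact hr i hi)).mono le_rfl ?_
    rintro s'' ⟨hF', h31', H⟩
    rw [ec, er, hF.2 9 (by simp)] at H
    refine ⟨hF.trans hF', h31', ?_, ?_⟩
    · rcases H with ⟨h0, h33, h32⟩ | ⟨h0, h33, ⟨hlt, h32⟩ | ⟨hle, h32⟩⟩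
      · rw [h32]; refine hf.imp_left fun h => ⟨h.1, fun j hj hj0 => ?_⟩
        rcases Nat.lt_succ_iff_lt_or_eq.mp hj with hj | rfl
        · exact h.2 j hj hj0
        · exact absurd h0 hj0
      · rw [h32]; refine hf.imp_left fun h => ⟨h.1, fun j hj hj0 => ?_⟩
        rcases Nat.lt_succ_iff_lt_or_eq.mp hj with hj | rfl
        · exact h.2 j hj hj0
        · exact hlt
      · rw [h32]; exact Or.inr ⟨hi, h0, hle⟩
    · rcases H with ⟨h0, h33, h32⟩ | ⟨h0, h33, -⟩
      · rw [h33]; exact Or.inr ⟨hi, h0⟩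
      · rw [h33]; refine he.imp_left fun h => ⟨h.1, fun j hj => ?_⟩
        rcases Nat.lt_succ_iff_lt_or_eq.mp hj with hj | rfl
        · exact h.2 j hj
        · exact h0
  · rintro s' ⟨hF, h31, hf, he⟩
    exact ⟨by simp [h31, (hS.mono hF).n11], hF, hf, he⟩

/-- Decrement all counters. -/
def decrementProg : Prog :=
  .seq (block [.natConst 31 0]) (.loop (.natLt 31 11)
    (block [.natAdd 34 14 31, .natLoad 35 34, .natSub 35 35 5, .natStore 34 35, .natAdd 31 31 5]))

theorem decrementProg_spec {T : ℕ} {s : State} (hS : Slots T s) (h5 : s.nat 5 = 1) :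
    WP decrementProg (6 * T + 2) s fun s' =>
      Frame ({31, 34, 35} ∪ Set.Ico 64 (64 + T)) ∅ s s' ∧
      ∀ j < T, s'.nat (64 + j) = s.nat (64 + j) - 1 := by
  refine WP.for T 5 (fun i s' =>
    Frame ({31, 34, 35} ∪ Set.Ico 64 (64 + T)) ∅ s s' ∧ s'.nat 31 = i ∧
      (∀ j < i, s'.nat (64 + j) = s.nat (64 + j) - 1) ∧
      ∀ j, i ≤ j → s'.nat (64 + j) = s.nat (64 + j))
    ?_ ?_ ?_ (by simp only [List.length_cons, List.length_nil]; ring_nf; omega)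
  · refine ⟨⟨?_, ?_⟩, ?_, ?_, ?_⟩
    · intro a ha; simp at ha; simp [ha]
    · intro a ha; simp
    · simp
    · simp
    · intro j _; simp; omega
  · rintro i hi s' ⟨hF, h31, hlt, hge⟩
    have hS' := hS.mono hF
    have e5 : s'.nat 5 = 1 := by rw [hF.1 5 (by simp), h5]
    have n1 : 64 + i ≠ 31 := by omega
    have n2 : 64 + i ≠ 34 := by omega
    have n3 : 64 + i ≠ 35 := by omega
    have n4 : 64 + i ≠ 5 := by omega
    refine ⟨by simp [h31, hS'.n11, hi], WP.block ⟨⟨?_, ?_⟩, ?_, ?_, ?_⟩⟩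
    · intro a ha; have := hF.1 a ha; simp at ha; simp [ha, this, hS'.n14, h31]; omega
    · intro a ha; simp [hF.2 a (by simp)]
    · simp [hS'.n14, h31, e5, n1.symm, n4.symm]
    · intro j hj
      have m1 : 64 + j ≠ 31 := by omega
      have m2 : 64 + j ≠ 34 := by omega
      have m3 : 64 + j ≠ 35 := by omega
      rcases Nat.lt_succ_iff_lt_or_eq.mp hj with hj | rfl
      · simp [hS'.n14, h31, e5, n1.symm, n4.symm, m1, m2, m3, hj.ne, hlt j hj]
      · simp [hS'.n14, h31, e5, n1.symm, n4.symm, m1, m2, m3, hge j le_rfl]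
    · intro j hj
      have m1 : 64 + j ≠ 31 := by omega
      have m2 : 64 + j ≠ 34 := by omega
      have m3 : 64 + j ≠ 35 := by omega
      have m4 : j ≠ i := by omega
      simp [hS'.n14, h31, e5, n1.symm, n4.symm, m1, m2, m3, m4, hge j (by omega)]
  · rintro s' ⟨hF, h31, hlt, hge⟩
    exact ⟨by simp [h31, (hS.mono hF).n11], hF, hlt⟩

/-- Process point number `n` (cell `27`). -/
def insertProg : Prog :=
  .seq (block [.natMul 20 27 1, .natAdd 20 20 6]) <| .seq scanProg <|
  .seq (.branch (.natLt 32 11)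
    (block [.natAdd 34 14 32, .natLoad 35 34, .natAdd 35 35 5, .natStore 34 35])
    (.branch (.natLt 33 11)
      (block [.natAdd 34 14 33, .natStore 34 5, .natAdd 34 15 33, .natStore 34 27])
      decrementProg)) (block [.natAdd 27 27 5])

theorem insertProg_spec {N D K m b T : ℕ} {x : ℕ → ℕ → ℝ} {s : State} (hE : Env N D K m b x s)
    (hS : Slots T s) {n : ℕ} (hn : n < N) (h27 : s.nat 27 = n)
    (hr : ∀ j < T, s.nat (64 + T + j) < N) :
    WP insertProg (T * (9 * D + 20) + 15) s fun s' =>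
      Frame ({20, 21, 22, 23, 27, 31, 32, 33, 34, 35, 36} ∪ Set.Ico 64 (64 + T + T)) {0, 1, 2} s s' ∧
      s'.nat 27 = n + 1 ∧
      HeavyStep (sqDist D x) (s.real 9) T n (fun j => s.nat (64 + j)) (fun j => s.nat (64 + T + j))
        (fun j => s'.nat (64 + j)) (fun j => s'.nat (64 + T + j)) := by
  have hb := hE.hb
  refine WP.blockThen (T * (9 * D + 20) + 13) ?_
  set s₁ := runs _ s with hs₁
  have hF₁ : Frame {20} ∅ s s₁ := by
    refine ⟨?_, ?_⟩ <;> intro a ha <;> simp at ha <;> simp [hs₁, ha]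
  have h20 : s₁.nat 20 = b + n * D := by simp [hs₁, h27, hE.n1, hE.n6, add_comm]
  clear_value s₁
  have hE₁ := hE.mono hF₁
  have ec₁ : ∀ j, s₁.nat (64 + j) = s.nat (64 + j) := fun j => hF₁.1 _ (by simp; omega)
  have er₁ : ∀ j, s₁.nat (64 + T + j) = s.nat (64 + T + j) := fun j => hF₁.1 _ (by simp; omega)
  refine WP.cut _ _ (6 * T + 9) (by ring_nf; omega) (scanProg_spec hE₁ (hS.mono hF₁) hn h20
    (by simpa only [er₁] using hr)) ?_
  simp only [ec₁, er₁, hF₁.2 9 (by simp)]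
  rintro s₂ ⟨hF₂, hf, he⟩
  have hF : Frame {20, 21, 22, 23, 31, 32, 33, 34, 35, 36} {0, 1, 2} s s₂ := hF₁.trans hF₂
  have hE₂ := hE.mono hF
  have hS₂ := hS.mono hF
  have ec : ∀ j, s₂.nat (64 + j) = s.nat (64 + j) := fun j => hF.1 _ (by simp; omega)
  have er : ∀ j, s₂.nat (64 + T + j) = s.nat (64 + T + j) := fun j => hF.1 _ (by simp; omega)
  have e27 : s₂.nat 27 = n := by rw [hF.1 27 (by simp), h27]
  -- The three alternatives of `HeavyStep`: a close slot was found, a free slot was found, or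
  -- neither. Which of several suitable slots is used is irrelevant for the later analysis.
  refine WP.branchThen (6 * T + 8) (fun hc => ?_) (fun hc => ?_) (by omega)
  · simp [hS₂.n11] at hc
    obtain ⟨-, h0, hle⟩ : s₂.nat 32 < T ∧ s.nat (64 + s₂.nat 32) ≠ 0 ∧
          sqDist D x n (s.nat (64 + T + s₂.nat 32)) ≤ s.real 9 := by
      rcases hf with hf | hf
      · omega
      · exact hf
    set f := s₂.nat 32 with hfdef
    have n1 : 64 + f ≠ 27 := by omega
    have n4 : 64 + f ≠ 5 := by omega
    have n5 : 64 + f ≠ 34 := by omega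
    refine WP.blockThen 1 (WP.block ⟨?_, ?_, Or.inl ⟨f, hc, h0, hle, ?_, ?_⟩⟩)
    · refine hF.trans (A' := {27, 34, 35, 64 + f}) (B' := ∅) ⟨?_, ?_⟩ <;> intro a ha <;>
        simp at ha <;> simp [ha, hS₂.n14, ← hfdef]
    · simp [hS₂.n14, e27, hE₂.n5, n1.symm, n4.symm, ← hfdef]
    · intro j hj
      have m1 : 64 + j ≠ 27 := by omega
      have m2 : 64 + j ≠ 34 := by omega
      have m3 : 64 + j ≠ 35 := by omega
      simp [hS₂.n14, hE₂.n5, m1, m2, m3, n5, ← hfdef, ec]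
      split_ifs with h
      · rw [h]
      · rfl
    · intro j hj
      have m1 : 64 + T + j ≠ 27 := by omega
      have m2 : 64 + T + j ≠ 34 := by omega
      have m3 : 64 + T + j ≠ 35 := by omega
      have m4 : 64 + T + j ≠ 64 + f := by omega
      simp [hS₂.n14, m1, m2, m3, m4, ← hfdef, er]
  simp [hS₂.n11] at hc
  have hfar : ∀ j < T, s.nat (64 + j) ≠ 0 → s.real 9 < sqDist D x n (s.nat (64 + T + j)) := by
    rcases hf with hf | hf
    · exact hf.2
    · omega
  refine WP.branchThen (6 * T + 7) (fun hc' => ?_) (fun hc' => ?_) (by omega)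
  · simp [hS₂.n11] at hc'
    have h0 : s.nat (64 + s₂.nat 33) = 0 := by
      rcases he with he | he
      · omega
      · exact he.2
    set e := s₂.nat 33 with hedef
    have n1 : 64 + e ≠ 27 := by omega
    have n4 : 64 + e ≠ 5 := by omega
    have n2 : 64 + e ≠ 15 := by omega
    have n3 : 64 + e ≠ 33 := by omega
    have k1 : 64 + T + e ≠ 27 := by omega
    have k4 : 64 + T + e ≠ 5 := by omega
    refine WP.blockThen 1 (WP.block ⟨?_, ?_, Or.inr ⟨hfar, Or.inl ⟨e, hc', h0, ?_, ?_⟩⟩⟩)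
    · refine hF.trans (A' := {27, 34, 64 + e, 64 + T + e}) (B' := ∅) ⟨?_, ?_⟩ <;> intro a ha <;>
        simp at ha <;> simp [ha, hS₂.n14, hS₂.n15, ← hedef, n2.symm, n3.symm]
    · simp [hS₂.n14, hS₂.n15, e27, hE₂.n5, n1.symm, n4.symm, ← hedef, n2.symm, n3.symm, k1.symm,
        k4.symm]
    · intro j hj
      have m1 : 64 + j ≠ 27 := by omega
      have m2 : 64 + j ≠ 34 := by omega
      have m3 : 64 + j ≠ 64 + T + e := by omega
      simp [hS₂.n14, hS₂.n15, hE₂.n5, m1, m2, m3, ← hedef, n2.symm, n3.symm, ec]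
    · intro j hj
      have m1 : 64 + T + j ≠ 27 := by omega
      have m2 : 64 + T + j ≠ 34 := by omega
      have m3 : 64 + T + j ≠ 64 + e := by omega
      simp [hS₂.n14, hS₂.n15, hE₂.n5, m1, m2, m3, ← hedef, n1.symm, n2.symm, n3.symm, er, e27]
  · simp [hS₂.n11] at hc'
    have h0 : ∀ j < T, s.nat (64 + j) ≠ 0 := by
      rcases he with he | he
      · exact he.2
      · omega
    refine WP.cut _ _ 1 (by omega) (decrementProg_spec hS₂ hE₂.n5) ?_
    rintro s₃ ⟨hF₃, hd⟩
    refine WP.block ⟨?_, ?_, Or.inr ⟨hfar, Or.inr fun j hj => ⟨h0 j hj, ?_, ?_⟩⟩⟩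
    · refine (hF.trans (A'' := {20, 21, 22, 23, 31, 32, 33, 34, 35, 36} ∪ Set.Ico 64 (64 + T))
        (B'' := {0, 1, 2}) hF₃).trans (A' := {27}) (B' := ∅) ⟨?_, ?_⟩ <;> intro a ha <;>
        simp at ha <;> simp [ha]
    · simp [hF₃.1, e27, hE₂.n5]
    · have m1 : 64 + j ≠ 27 := by omega
      simp [m1, hd j hj, ec]
    · have m1 : 64 + T + j ≠ 27 := by omega
      simp only [runs_cons, runs_nil, Instr.run, State.setNat_nat, m1, if_false]
      rw [hF₃.1 _ (by simp; omega), er]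

/-- Heavy hitters among the `N` points at squared distance threshold given by real cell `9`. -/
def heavyProg : Prog :=
  .seq (.seq (block [.natConst 31 0, .natAdd 37 11 11]) (.loop (.natLt 31 37)
    (block [.natAdd 34 14 31, .natStore 34 4, .natAdd 31 31 5])))
  (.seq (block [.natConst 27 0]) (.loop (.natLt 27 0) insertProg))

theorem heavyProg_spec {N D K m b T : ℕ} {x : ℕ → ℕ → ℝ} {s : State} (hE : Env N D K m b x s)
    (hS : Slots T s) (hN : 0 < N) :
    WP heavyProg (N * (T * (9 * D + 20) + 16) + 8 * T + 5) s fun s' =>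
      Frame ({20, 21, 22, 23, 27, 31, 32, 33, 34, 35, 36, 37} ∪ Set.Ico 64 (64 + T + T))
        {0, 1, 2} s s' ∧
      Heavy (sqDist D x) (s.real 9) T N (fun j => s'.nat (64 + j))
        (fun j => s'.nat (64 + T + j)) := by
  have hb := hE.hb
  refine WP.cut (fun s' => Frame ({31, 34, 37} ∪ Set.Ico 64 (64 + T + T)) ∅ s s' ∧
    ∀ j < T + T, s'.nat (64 + j) = 0) (8 * T + 3) (N * (T * (9 * D + 20) + 16) + 2) (by omega) ?_ ?_
  · refine WP.for (T + T) 3 (fun i s' =>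
      Frame ({31, 34, 37} ∪ Set.Ico 64 (64 + T + T)) ∅ s s' ∧ s'.nat 31 = i ∧ s'.nat 37 = T + T ∧
      ∀ j < i, s'.nat (64 + j) = 0) ?_ ?_ ?_
      (by simp only [List.length_cons, List.length_nil]; omega)
    · refine ⟨⟨?_, ?_⟩, ?_, ?_, ?_⟩
      · intro a ha; simp at ha; simp [ha]
      · intro a ha; simp
      · simp
      · simp [hS.n11]
      · simp
    · rintro i hi s' ⟨hF, h31, h37, hz⟩
      have hE' := hE.mono hF
      have hS' := hS.mono hF
      have n1 : 64 + i ≠ 31 := by omega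
      have n2 : 64 + i ≠ 37 := by omega
      have n4 : 64 + i ≠ 5 := by omega
      refine ⟨by simp [h31, h37, hi], WP.block ⟨⟨?_, ?_⟩, ?_, ?_, ?_⟩⟩
      · intro a ha; have := hF.1 a ha; simp at ha; simp [ha, this, hS'.n14, h31]; omega
      · intro a ha; simp [hF.2 a (by simp)]
      · simp [hS'.n14, h31, hE'.n5, n1.symm, n4.symm]
      · simp [hS'.n14, h31, h37, n2.symm]
      · intro j hj
        have m1 : 64 + j ≠ 31 := by omega
        have m2 : 64 + j ≠ 34 := by omega
        rcases Nat.lt_succ_iff_lt_or_eq.mp hj with hj | rfl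
        · simp [hS'.n14, h31, hE'.n4, m1, m2, hz j hj]
        · simp [hS'.n14, h31, hE'.n4, m1]
    · rintro s' ⟨hF, h31, h37, hz⟩
      exact ⟨by simp [h31, h37], hF, hz⟩
  rintro s₁ ⟨hF₁, hz⟩
  have hE₁ := hE.mono hF₁
  have hS₁ := hS.mono hF₁
  refine WP.for N (T * (9 * D + 20) + 15) (fun i s' =>
    Frame ({20, 21, 22, 23, 27, 31, 32, 33, 34, 35, 36, 37} ∪ Set.Ico 64 (64 + T + T))
        {0, 1, 2} s s' ∧ s'.nat 27 = i ∧
      Heavy (sqDist D x) (s.real 9) T i (fun j => s'.nat (64 + j))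
        (fun j => s'.nat (64 + T + j))) ?_ ?_ ?_
    (by simp only [List.length_cons, List.length_nil]; ring_nf; omega)
  · refine ⟨hF₁.trans (A' := {27}) (B' := ∅) ⟨?_, ?_⟩, ?_, .zero ?_ ?_⟩
    · intro a ha; simp at ha; simp [ha]
    · intro a ha; simp
    · simp
    · intro j hj; have := hz j (by omega); simp [this]
    · intro j hj; have := hz (T + j) (by omega); rw [← add_assoc] at this; simp [this]
  · rintro i hi s' ⟨hF, h27, hH⟩
    have hE' := hE.mono hF
    have hS' := hS.mono hF
    refine ⟨by simp [h27, hE'.n0, hi], ?_⟩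
    refine (insertProg_spec hE' hS' hi h27 fun j hj => ?_).mono le_rfl ?_
    · have := hH.rep_lt j hj; omega
    · rintro s'' ⟨hF', h27', hst⟩
      rw [hF.2 9 (by simp)] at hst
      exact ⟨hF.trans hF', h27', hH.succ hst⟩
  · rintro s' ⟨hF, h27, hH⟩
    exact ⟨by simp [h27, (hE.mono hF).n0], hF, hH⟩

/-! ### Enumeration of grid points. -/

/-- The machine has no integer division. The digit `g / P % Q` is therefore maintained by two
counters with carries while `g` runs through the grid. -/
theorem succ_div_mod {g P : ℕ} (hP : 0 < P) :
    (g % P + 1 = P → (g + 1) % P = 0 ∧ (g + 1) / P = g / P + 1) ∧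
    (g % P + 1 ≠ P → (g + 1) % P = g % P + 1 ∧ (g + 1) / P = g / P) := by
  have h := Nat.div_add_mod g P
  have hlt := Nat.mod_lt g hP
  constructor
  · intro e
    have : g + 1 = P * (g / P + 1) := by rw [mul_add, mul_one]; omega
    rw [this]
    exact ⟨Nat.mul_mod_right _ _, Nat.mul_div_cancel_left _ hP⟩
  · intro e
    have h1 : g + 1 = g % P + 1 + P * (g / P) := by omega
    constructor
    · rw [h1, Nat.add_mul_mod_self_left, Nat.mod_eq_of_lt (by omega)]
    · conv_lhs => rw [h1]
      rw [Nat.add_mul_div_left _ _ hP, Nat.div_eq_of_lt (by omega), zero_add]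

/-- The grid is written one coordinate at a time; distinct coordinates occupy disjoint cells because
their addresses differ modulo `D`. -/
theorem mul_add_ne_mul_add {D g g' l l' : ℕ} (hl : l < D) (hl' : l' < D) (h : l' ≠ l) :
    g' * D + l' ≠ g * D + l := by
  intro e
  have := congrArg (· % D) e
  simp [Nat.mul_add_mod, mul_comm _ D, Nat.mod_eq_of_lt hl,
    Nat.mod_eq_of_lt hl'] at this
  exact h this

/-- Write one coordinate of one grid point and advance the digit counters. -/
def cellProg : Prog :=
  .seq (block [.realOfNat 0 40, .realMul 0 0 8, .realAdd 0 0 10, .realStore 41 0, .natAdd 41 41 1,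
    .natAdd 39 39 5, .natAdd 38 38 5])
  (.branch (.natEq 39 37) (.seq (block [.natConst 39 0, .natAdd 40 40 5])
    (.branch (.natEq 40 12) (block [.natConst 40 0]) .skip)) .skip)

/-- Write one coordinate (cell `36`) of all grid points. -/
def coordProg : Prog :=
  .seq (block [.natAdd 23 20 36, .realLoad 10 23, .realSub 10 10 11, .natConst 38 0,
    .natConst 39 0, .natConst 40 0, .natAdd 41 8 36]) (.loop (.natLt 38 13) cellProg)

theorem cellProg_spec {P Q D : ℕ} {s : State} (hP : 0 < P) (hQ : 0 < Q) {g : ℕ} (h38 : s.nat 38 = g)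
    (h39 : s.nat 39 = g % P) (h40 : s.nat 40 = g / P % Q) (h37 : s.nat 37 = P) (h12 : s.nat 12 = Q)
    (h5 : s.nat 5 = 1) (h1 : s.nat 1 = D) (h41 : 16 ≤ s.nat 41) :
    WP cellProg 12 s fun s' => Frame {38, 39, 40, 41} {0, s.nat 41} s s' ∧ s'.nat 38 = g + 1 ∧
      s'.nat 39 = (g + 1) % P ∧ s'.nat 40 = (g + 1) / P % Q ∧ s'.nat 41 = s.nat 41 + D ∧
      s'.real (s.nat 41) = s.real 10 + ((g / P % Q : ℕ) : ℝ) * s.real 8 := by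
  have n0 : s.nat 41 ≠ 0 := by omega
  have n8 : s.nat 41 ≠ 8 := by omega
  have n10 : s.nat 41 ≠ 10 := by omega
  obtain ⟨d1, d2⟩ := succ_div_mod (g := g) hP
  obtain ⟨d3, d4⟩ := succ_div_mod (g := g / P) hQ
  refine WP.blockThen 5 (WP.branch (b := 4) (fun hc => WP.blockThen 2
    (WP.branch (b := 1) (fun hc' => WP.block ?_) fun hc' => (WP.skip ?_).mono (by omega)
      fun _ h => h)) fun hc => (WP.skip ?_).mono (by omega) fun _ h => h)
  · simp [h39, h37, h5] at hc
    simp [h40, h12, h5] at hc'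
    obtain ⟨d1, d2⟩ := d1 hc
    obtain ⟨d3, d4⟩ := d3 hc'
    refine ⟨⟨?_, ?_⟩, ?_, ?_, ?_, ?_, ?_⟩
    · intro a ha; simp at ha; simp [ha]
    · intro a ha; simp at ha; simp [ha]
    · simp [h38, h5]
    · simp [d1]
    · simp [d2, d3]
    · simp [h1]
    · simp [h40, n8.symm, n10.symm, add_comm]
  · simp [h39, h37, h5] at hc
    simp [h40, h12, h5] at hc'
    obtain ⟨d1, d2⟩ := d1 hc
    obtain ⟨d3, d4⟩ := d4 hc'
    refine ⟨⟨?_, ?_⟩, ?_, ?_, ?_, ?_, ?_⟩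
    · intro a ha; simp at ha; simp [ha]
    · intro a ha; simp at ha; simp [ha]
    · simp [h38, h5]
    · simp [d1]
    · simp [d2, d3, h40, h5]
    · simp [h1]
    · simp [h40, n8.symm, n10.symm, add_comm]
  · simp [h39, h37, h5] at hc
    obtain ⟨d1, d2⟩ := d2 hc
    refine ⟨⟨?_, ?_⟩, ?_, ?_, ?_, ?_, ?_⟩
    · intro a ha; simp at ha; simp [ha]
    · intro a ha; simp at ha; simp [ha]
    · simp [h38, h5]
    · simp [d1, h39, h5]
    · simp [d2, h40]
    · simp [h1]
    · simp [h40, n8.symm, n10.symm, add_comm]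

/-- The cells describing the grid: `Q` points per side, `M` points. -/
structure GridCells (Q M : ℕ) (s : State) : Prop where
  n12 : s.nat 12 = Q
  n13 : s.nat 13 = M

theorem GridCells.mono {Q M : ℕ} {s s' : State} {A B : Set ℕ} (h : GridCells Q M s)
    (hF : Frame A B s s') (hA : ∀ a < 14, 11 < a → a ∉ A := by
      intro a _ _; first | (simp; done) | (simp; omega)) : GridCells Q M s' :=
  ⟨by rw [hF.1 _ (hA _ (by simp) (by simp)), h.n12],
   by rw [hF.1 _ (hA _ (by simp) (by simp)), h.n13]⟩

theorem coordProg_spec {N D K m b Q M : ℕ} {x : ℕ → ℕ → ℝ} {s : State} (hE : Env N D K m b x s)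
    (hG : GridCells Q M s) {P l n o : ℕ} (hP : 0 < P) (hQ : 0 < Q) (hl : l < D) (hn : n < N)
    (h20 : s.nat 20 = b + n * D) (h36 : s.nat 36 = l) (h37 : s.nat 37 = P) (h8 : s.nat 8 = o)
    (ho : 16 ≤ o) :
    WP coordProg (13 * M + 8) s fun s' =>
      Frame {23, 38, 39, 40, 41} ({0, 10} ∪ {a | ∃ g < M, a = o + (g * D + l)}) s s' ∧
      ∀ g < M, s'.real (o + (g * D + l)) =
        x n l - s.real 11 + ((g / P % Q : ℕ) : ℝ) * s.real 8 := by
  have hb := hE.hb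
  refine WP.for M 12 (fun i s' =>
    Frame {23, 38, 39, 40, 41} ({0, 10} ∪ {a | ∃ g < i, a = o + (g * D + l)}) s s' ∧
      s'.nat 38 = i ∧ s'.nat 39 = i % P ∧ s'.nat 40 = i / P % Q ∧ s'.nat 41 = o + (i * D + l) ∧
      s'.real 10 = x n l - s.real 11 ∧
      ∀ g < i, s'.real (o + (g * D + l)) =
        x n l - s.real 11 + ((g / P % Q : ℕ) : ℝ) * s.real 8) ?_ ?_ ?_
    (by simp only [List.length_cons, List.length_nil]; omega)
  · refine ⟨⟨?_, ?_⟩, ?_, ?_, ?_, ?_, ?_, ?_⟩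
    · intro a ha; simp at ha; simp [ha]
    · intro a ha; simp at ha; simp [ha]
    · simp
    · simp
    · simp
    · simp [h8, h36]
    · simp [h20, h36, hE.pts n hn l hl]
    · simp
  · rintro i hi s' ⟨hF, h38, h39, h40, h41, h10, hw⟩
    refine ⟨by simp [h38, hF.1, hG.n13, hi], ?_⟩
    refine (cellProg_spec (P := P) (Q := Q) (D := D) hP hQ h38 h39 h40 (by simp [hF.1, h37])
      (by simp [hF.1, hG.n12]) (by simp [hF.1, hE.n5]) (by simp [hF.1, hE.n1]) (by omega)).mono
      le_rfl ?_
    rw [h41, h10]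
    rintro s'' ⟨hF', h38', h39', h40', h41', hw'⟩
    have e8 : s'.real 8 = s.real 8 := hF.2 8 (by simp; omega)
    rw [e8] at hw'
    refine ⟨hF.trans hF' (by simp) ?_ (by simp) ?_, h38', h39', h40', ?_, ?_, ?_⟩
    · rintro a (ha | ⟨g, hg, rfl⟩)
      · exact Or.inl ha
      · exact Or.inr ⟨g, by omega, rfl⟩
    · rintro a (rfl | rfl)
      · simp
      · exact Or.inr ⟨i, by omega, rfl⟩
    · rw [h41', add_mul]; omega
    · rw [hF'.2 10 (by simp; omega), h10]
    · intro g hg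
      rcases Nat.lt_succ_iff_lt_or_eq.mp hg with hg | rfl
      · rw [hF'.2 _ ?_, hw g hg]
        have : g * D < i * D := Nat.mul_lt_mul_of_pos_right hg (by omega)
        simp; omega
      · exact hw'
  · rintro s' ⟨hF, h38, h39, h40, h41, h10, hw⟩
    exact ⟨by simp [h38, hF.1, hG.n13], hF, hw⟩

/-- Output the grid whose lowest corner is the point at the address in cell `20` shifted by real cell
`11`, with mesh size given by real cell `8`. -/
def gridProg : Prog :=
  .seq (.seq (block [.natConst 36 0, .natCopy 37 5]) (.loop (.natLt 36 1)
    (.seq coordProg (block [.natMul 37 37 12, .natAdd 36 36 5]))))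
  (block [.natMul 34 13 1, .natAdd 8 8 34, .natAdd 10 10 13])

theorem gridProg_spec {N D K m b Q M : ℕ} {x : ℕ → ℕ → ℝ} {s : State} (hE : Env N D K m b x s)
    (hG : GridCells Q M s) {n o k : ℕ} (hQ : 0 < Q) (hn : n < N)
    (h20 : s.nat 20 = b + n * D) (ho : OutLen D o s k) (hob : b + N * D ≤ o) :
    WP gridProg (D * (13 * M + 11) + 6) s fun s' =>
      Frame {8, 10, 23, 34, 36, 37, 38, 39, 40, 41} ({0, 10} ∪ Set.Ici (o + k * D)) s s' ∧
      OutLen D o s' (k + M) ∧ ∀ g < M, ∀ l < D, s'.real (o + (k + g) * D + l) =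
        x n l - s.real 11 + ((g / Q ^ l % Q : ℕ) : ℝ) * s.real 8 := by
  have hb := hE.hb
  refine WP.cut (fun s' =>
    Frame {23, 36, 37, 38, 39, 40, 41} ({0, 10} ∪ Set.Ici (o + k * D)) s s' ∧
      ∀ g < M, ∀ l < D, s'.real (o + k * D + (g * D + l)) =
        x n l - s.real 11 + ((g / Q ^ l % Q : ℕ) : ℝ) * s.real 8)
    (D * (13 * M + 11) + 3) 3 (by omega) ?_ ?_
  · refine WP.for D (13 * M + 10) (fun i s' =>
      Frame {23, 36, 37, 38, 39, 40, 41} ({0, 10} ∪ Set.Ici (o + k * D)) s s' ∧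
      s'.nat 36 = i ∧ s'.nat 37 = Q ^ i ∧ ∀ g < M, ∀ l < i, s'.real (o + k * D + (g * D + l)) =
        x n l - s.real 11 + ((g / Q ^ l % Q : ℕ) : ℝ) * s.real 8) ?_ ?_ ?_
      (by simp only [List.length_cons, List.length_nil]; ring_nf; omega)
    · refine ⟨⟨?_, ?_⟩, ?_, ?_, ?_⟩
      · intro a ha; simp at ha; simp [ha]
      · intro a ha; simp
      · simp
      · simp [hE.n5]
      · simp
    · rintro i hi s' ⟨hF, h36, h37, hw⟩
      have hE' := hE.mono hF
      have hG' := hG.mono hF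
      refine ⟨by simp [h36, hE'.n1, hi], ?_⟩
      refine WP.cut _ _ 2 (by omega) (coordProg_spec hE' hG' (pow_pos hQ i) hQ hi hn
        ((hF.1 20 (by simp)).trans h20) h36 h37 ((hF.1 8 (by simp)).trans ho.2) (by omega)) ?_
      rintro s₁ ⟨hF₁, hw₁⟩
      have hF' : Frame {23, 36, 37, 38, 39, 40, 41} ({0, 10} ∪ Set.Ici (o + k * D)) s s₁ :=
        hF.trans hF₁ (hB' := by
          rintro a (ha | ⟨g, hg, rfl⟩)
          · exact Or.inl ha
          · right; simp)
      have e11 : s'.real 11 = s.real 11 := hF.2 11 (by simp; omega)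
      have e8 : s'.real 8 = s.real 8 := hF.2 8 (by simp; omega)
      rw [e11, e8] at hw₁
      refine WP.block ⟨⟨?_, ?_⟩, ?_, ?_, ?_⟩
      · intro a ha; have := hF'.1 a ha; simp at ha; simp [ha, this]
      · intro a ha; simp [hF'.2 a ha]
      · simp [hF₁.1, h36, hE'.n5]
      · simp [hF₁.1, h37, hG'.n12, pow_succ]
      · intro g hg l hl
        simp only [runs_cons, runs_nil, Instr.run, State.setNat_real]
        rcases Nat.lt_succ_iff_lt_or_eq.mp hl with hl | rfl
        · rw [hF₁.2 _ ?_, hw g hg l hl]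
          simp only [Set.mem_union, Set.mem_insert_iff, Set.mem_singleton_iff, Set.mem_ofPred_eq,
            not_or, not_exists, not_and]
          refine ⟨by omega, fun g' _ e => ?_⟩
          exact mul_add_ne_mul_add (g := g') (g' := g) hi (by omega) hl.ne (by omega)
        · exact hw₁ g hg
    · rintro s' ⟨hF, h36, h37, hw⟩
      exact ⟨by simp [h36, hF.1, hE.n1], hF, hw⟩
  · rintro s' ⟨hF, hw⟩
    refine WP.block ⟨⟨?_, ?_⟩, ⟨?_, ?_⟩, ?_⟩
    · intro a ha; simp at ha; have := hF.1 a (by simp; omega); simp [ha, this]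
    · intro a ha; simp [hF.2 a ha]
    · simp [hF.1, ho.1, hG.n13]
    · simp [hF.1, ho.2, hG.n13, hE.n1]; ring
    · intro g hg l hl
      rw [← hw g hg l hl]
      simp [add_mul, add_assoc]

/-- The point of the grid with lowest corner `p - a`, mesh size `h` and index `v`. -/
def gridPoint (p : ℕ → ℝ) (a h : ℝ) (v : ℕ → ℕ) (l : ℕ) : ℝ := p l - a + v l * h

/-- Every index vector is the base-`Q` expansion of some `g < Q ^ D`, so running through all `g`
reaches the whole grid. -/
theorem exists_digits {Q D : ℕ} {v : ℕ → ℕ} (hv : ∀ l < D, v l < Q) :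
    ∃ g < Q ^ D, ∀ l < D, g / Q ^ l % Q = v l := by
  refine ⟨finFunctionFinEquiv fun l : Fin D => ⟨v l, hv l l.2⟩, Fin.is_lt _, fun l hl => ?_⟩
  have := finFunctionFinEquiv_symm_apply_val
    (finFunctionFinEquiv fun l : Fin D => (⟨v l, hv l l.2⟩ : Fin Q)) ⟨l, hl⟩
  rw [Equiv.symm_apply_apply] at this
  exact this.symm

/-- Output the grids around the representatives of all `T` slots. -/
def gridsProg : Prog :=
  .seq (block [.natConst 31 0]) (.loop (.natLt 31 11)
    (.seq (block [.natAdd 34 15 31, .natLoad 20 34, .natMul 20 20 1, .natAdd 20 20 6])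
    (.seq gridProg (block [.natAdd 31 31 5]))))

theorem gridsProg_spec {N D K m b Q T : ℕ} {x : ℕ → ℕ → ℝ} {s : State} (hE : Env N D K m b x s)
    (hS : Slots T s) (hG : GridCells Q (Q ^ D) s) {o k : ℕ} (hQ : 0 < Q)
    (hr : ∀ j < T, s.nat (64 + T + j) < N) (ho : OutLen D o s k) (hob : b + N * D ≤ o) :
    WP gridsProg (T * (D * (13 * Q ^ D + 11) + 12) + 2) s fun s' =>
      Frame {8, 10, 20, 23, 31, 34, 36, 37, 38, 39, 40, 41} ({0, 10} ∪ Set.Ici (o + k * D)) s s' ∧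
      OutLen D o s' (k + T * Q ^ D) ∧ ∀ j < T, ∀ v : ℕ → ℕ, (∀ l < D, v l < Q) →
        Lists D o s' (k + T * Q ^ D)
          (gridPoint (x (s.nat (64 + T + j))) (s.real 11) (s.real 8) v) := by
  have hb := hE.hb
  refine WP.for T (D * (13 * Q ^ D + 11) + 11) (fun i s' =>
      Frame {8, 10, 20, 23, 31, 34, 36, 37, 38, 39, 40, 41} ({0, 10} ∪ Set.Ici (o + k * D)) s s' ∧
      s'.nat 31 = i ∧
      OutLen D o s' (k + i * Q ^ D) ∧ ∀ j < i, ∀ v : ℕ → ℕ, (∀ l < D, v l < Q) →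
        Lists D o s' (k + i * Q ^ D)
          (gridPoint (x (s.nat (64 + T + j))) (s.real 11) (s.real 8) v)) ?_ ?_ ?_
      (by simp only [List.length_cons, List.length_nil]; ring_nf; omega)
  · refine ⟨⟨?_, ?_⟩, ?_, ⟨?_, ?_⟩, ?_⟩
    · intro a ha; simp at ha; simp [ha]
    · intro a ha; simp
    · simp
    · simp [ho.1]
    · simp [ho.2]
    · simp
  · rintro i hi s' ⟨hF, h31, ho', hw⟩
    have hS' := hS.mono hF
    have er : s'.nat (64 + T + i) = s.nat (64 + T + i) := hF.1 _ (by simp; omega)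
    refine ⟨by simp [h31, hS'.n11, hi], ?_⟩
    refine WP.blockThen (D * (13 * Q ^ D + 11) + 7) ?_
    set s₁ := runs _ s' with hs₁
    have hF₁ : Frame {20, 34} ∅ s' s₁ := by
      refine ⟨?_, ?_⟩ <;> intro a ha <;> simp at ha <;> simp [hs₁, ha]
    have h20 : s₁.nat 20 = b + s.nat (64 + T + i) * D := by
      have m2 : 64 + T + i ≠ 34 := by omega
      have hE' := hE.mono hF
      simp [hs₁, h31, hE'.n1, hE'.n6, hS'.n15, m2, er, add_comm b]
    clear_value s₁
    have hF' : Frame {8, 10, 20, 23, 31, 34, 36, 37, 38, 39, 40, 41}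
      ({0, 10} ∪ Set.Ici (o + k * D)) s s₁ := hF.trans hF₁
    refine WP.cut _ _ 1 (by omega) (gridProg_spec (hE.mono hF') (hG.mono hF') hQ (hr i hi) h20
      (k := k + i * Q ^ D) (o := o) ⟨?_, ?_⟩ hob) ?_
    · rw [hF₁.1 _ (by simp), ho'.1]
    · rw [hF₁.1 _ (by simp), ho'.2]
    rintro s₂ ⟨hF₂, ho₂, hw₂⟩
    rw [hF'.2 11 (by simp; omega), hF'.2 8 (by simp; omega)] at hw₂
    have hle : k * D ≤ (k + i * Q ^ D) * D := Nat.mul_le_mul_right _ (by omega)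
    have hF'' : Frame {8, 10, 20, 23, 31, 34, 36, 37, 38, 39, 40, 41}
      ({0, 10} ∪ Set.Ici (o + k * D)) s s₂ := hF'.trans hF₂
    have e : k + (i + 1) * Q ^ D = k + i * Q ^ D + Q ^ D := by ring
    rw [e]
    refine WP.block ⟨⟨?_, ?_⟩, ?_, ⟨?_, ?_⟩, ?_⟩
    · intro a ha; have := hF''.1 a ha; simp at ha; simp [ha, this]
    · intro a ha; simp [hF''.2 a ha]
    · simp [hF₂.1, hF₁.1, h31, (hE.mono hF).n5]
    · simp [ho₂.1]
    · simp [ho₂.2]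
    · intro j hj v hv
      rcases Nat.lt_succ_iff_lt_or_eq.mp hj with hj | rfl
      · have := ((hw j hj v hv).mono (l' := k + i * Q ^ D) hF₁ le_rfl
          (by simp)).mono (l' := k + i * Q ^ D + Q ^ D) hF₂ (by omega) (by intro a _ _; simp; omega)
        exact this
      · obtain ⟨g, hg, hd⟩ := exists_digits hv
        refine ⟨k + j * Q ^ D + g, by omega, fun l hl => ?_⟩
        simp only [runs_cons, runs_nil, Instr.run, State.setNat_real]
        rw [hw₂ g hg l hl, hd l hl, gridPoint]
  · rintro s' ⟨hF, h31, ho', hw⟩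
    exact ⟨by simp [h31, (hS.mono hF).n11], hF, ho', hw⟩

/-! ### Preparation of the memory and of the parameters. -/

/-- Move the input up, so that the first cells of the real memory become available. -/
def relocateProg : Prog :=
  .seq (.seq (block [.natConst 5 1, .natMul 20 0 1, .natConst 6 32, .natAdd 6 6 20, .realStore 6 0,
    .natAdd 21 20 5, .natConst 22 1])
    (.loop (.natLt 22 21) (block [.realLoad 0 22, .natAdd 23 6 22, .realStore 23 0,
      .natAdd 22 22 5])))
  (block [.realLoad 3 6, .natAdd 6 6 5, .natAdd 7 6 20, .natAdd 9 7 0, .natCopy 8 9])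

/-- The target begins beyond cell `N * D`, the last source cell, so no coordinate is overwritten
before it is read. `ε` is moved first, since its cell then serves as scratch space. -/
theorem relocateProg_spec {N D K m : ℕ} {ε : ℝ} {x : ℕ → ℕ → ℝ} {s : State} (h0 : s.nat 0 = N)
    (h1 : s.nat 1 = D) (h2 : s.nat 2 = K) (h3 : s.nat 3 = m) (h4 : s.nat 4 = 0)
    (h10 : s.nat 10 = 0) (hε : s.real 0 = ε)
    (hx : ∀ n < N, ∀ i < D, s.real (1 + (n * D + i)) = x n i) :
    WP relocateProg (5 * (N * D) + 13) s fun s' => Env N D K m (N * D + 33) x s' ∧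
      s'.real 3 = ε ∧ OutLen D (N * D + 33 + N * D + N) s' 0 := by
  refine WP.cut (fun s' => Frame {5, 6, 20, 21, 22, 23} ({0} ∪ Set.Ici (N * D + 32)) s s' ∧
    s'.nat 5 = 1 ∧ s'.nat 6 = N * D + 32 ∧ s'.nat 20 = N * D ∧ s'.real (N * D + 32) = ε ∧
    ∀ j < N * D, s'.real (N * D + 33 + j) = s.real (1 + j)) (5 * (N * D) + 8) 5 (by omega) ?_ ?_
  · refine WP.for (N * D) 4 (fun i s' =>
      Frame {5, 6, 20, 21, 22, 23} ({0} ∪ Set.Ici (N * D + 32)) s s' ∧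
      s'.nat 5 = 1 ∧ s'.nat 6 = N * D + 32 ∧ s'.nat 20 = N * D ∧ s'.nat 21 = N * D + 1 ∧
      s'.nat 22 = i + 1 ∧ s'.real (N * D + 32) = ε ∧
      ∀ j < i, s'.real (N * D + 33 + j) = s.real (1 + j)) ?_ ?_ ?_
      (by simp only [List.length_cons, List.length_nil]; omega)
    · refine ⟨⟨?_, ?_⟩, ?_, ?_, ?_, ?_, ?_, ?_, ?_⟩
      · intro a ha; simp at ha; simp [ha]
      · intro a ha; simp at ha; simp [h0, h1]; omega
      · simp
      · simp [h0, h1, add_comm]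
      · simp [h0, h1]
      · simp [h0, h1]
      · simp
      · simp [h0, h1, hε, add_comm]
      · simp
    · rintro i hi s' ⟨hF, h5, h6, h20, h21, h22, he, hw⟩
      have e0 := hF.2 (i + 1) (by simp; omega)
      refine ⟨by simp [h21, h22, hi], WP.block ⟨⟨?_, ?_⟩, ?_, ?_, ?_, ?_, ?_, ?_, ?_⟩⟩
      · intro a ha; have := hF.1 a ha; simp at ha; simp [ha, this]
      · intro a ha; have := hF.2 a ha; simp at ha; simp [ha, this, h6, h22]; omega
      · simp [h5]
      · simp [h6]
      · simp [h20]
      · simp [h21]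
      · simp [h22, h5]
      · simp [h6, h22, he]
      · intro j hj
        rcases Nat.lt_succ_iff_lt_or_eq.mp hj with hj | rfl
        · have : N * D + 33 + j ≠ N * D + 32 + (i + 1) := by omega
          simp [h6, h22, this, hw j hj]
        · have : N * D + 33 + j = N * D + 32 + (j + 1) := by omega
          rw [this]; simp [h6, h22, e0, add_comm]
    · rintro s' ⟨hF, h5, h6, h20, h21, h22, he, hw⟩
      exact ⟨by simp [h21, h22], hF, h5, h6, h20, he, hw⟩
  · rintro s' ⟨hF, h5, h6, h20, he, hw⟩
    have e := hF.1
    refine WP.block ⟨⟨?_, ?_, ?_, ?_, ?_, ?_, ?_, ?_, ?_, by omega, ?_⟩, ?_, ?_, ?_⟩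
    · simp [e, h0]
    · simp [e, h1]
    · simp [e, h2]
    · simp [e, h3]
    · simp [e, h4]
    · simp [h5]
    · simp [h6, h5]
    · simp [h6, h5, h20]
    · simp [h6, h5, h20, e, h0]
    · intro n hn i hi
      have := mul_add_lt_mul hn hi
      have h := hw _ this
      rw [hx n hn i hi, ← add_assoc] at h
      have n3 : N * D + 33 + n * D + i ≠ 3 := by omega
      simp [h, n3]
    · simp [h6, he]
    · simp [e, h10]
    · simp [h6, h5, h20, e, h0]

/-- The mesh parameter. -/
noncomputable def meshNum (D K : ℕ) (ε : ℝ) : ℕ := ⌈(128 * D * K : ℕ) / ε⌉₊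

/-- The number of slots. -/
def slotNum (D K m : ℕ) : ℕ := 3 * 5 ^ D * K ^ m

/-- Compute the parameters of the main loop. -/
def paramProg : Prog :=
  .seq (.seq (block [.natConst 29 128, .natMul 29 29 1, .natMul 29 29 2, .realOfNat 12 29,
      .realDiv 12 12 3, .natConst 16 0, .realOfNat 0 16])
    (.loop (.realLt 0 12) (block [.natAdd 16 16 5, .realOfNat 0 16]))) <|
  .seq (.seq (block [.natAdd 12 16 5, .natConst 29 5, .natConst 11 3, .natConst 13 1,
      .natConst 22 0])
    (.loop (.natLt 22 1) (block [.natMul 11 11 29, .natMul 13 13 12, .natAdd 22 22 5]))) <|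
  .seq (.seq (block [.natConst 29 8, .natMul 29 29 3, .natMul 29 29 2, .realOfNat 12 29,
      .realDiv 12 3 12, .natConst 30 1, .realOfNat 5 30, .natConst 22 0])
    (.loop (.natLt 22 3) (block [.natMul 30 30 2, .realMul 5 5 12, .natAdd 22 22 5])))
  (block [.natMul 11 11 30, .natConst 14 64, .natAdd 15 14 11, .realSqrt 4 4, .natMul 29 0 30,
    .realOfNat 0 29, .realDiv 6 4 0, .natConst 29 4, .natMul 29 29 0, .realOfNat 0 29,
    .realMul 0 0 4, .realDiv 7 0 5])

theorem paramProg_spec {N D K m b : ℕ} {ε R : ℝ} {x : ℕ → ℕ → ℝ} {s : State}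
    (hE : Env N D K m b x s) (hε : s.real 3 = ε) (hR : s.real 4 = R) :
    WP paramProg (3 * meshNum D K ε + 4 * D + 4 * m + 35) s fun s' =>
      Frame {11, 12, 13, 14, 15, 16, 22, 29, 30} {0, 4, 5, 6, 7, 12} s s' ∧
      Slots (slotNum D K m) s' ∧ GridCells (meshNum D K ε + 1) ((meshNum D K ε + 1) ^ D) s' ∧
      s'.nat 16 = meshNum D K ε ∧ s'.real 6 = √R / (N * K ^ m : ℕ) ∧
      s'.real 7 = (4 * N : ℕ) * √R / (ε / (8 * m * K : ℕ)) ^ m := by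
  set q := meshNum D K ε with hq
  refine WP.cut (fun s' => Frame {16, 29} {0, 12} s s' ∧ s'.nat 16 = q) (3 * q + 8)
    (4 * D + 4 * m + 27) (by omega) ?_ ?_
  -- Reals cannot be rounded, so the ceiling is found by counting upwards. This takes time
  -- proportional to the mesh parameter, one of the reasons why `padSize` contains it.
  · refine WP.for q 2 (fun i s' => Frame {16, 29} {0, 12} s s' ∧ s'.nat 16 = i ∧
      s'.real 0 = i ∧ s'.real 12 = (128 * D * K : ℕ) / ε) ?_ ?_ ?_
      (by simp only [List.length_cons, List.length_nil]; omega)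
    · refine ⟨⟨?_, ?_⟩, ?_, ?_, ?_⟩
      · intro a ha; simp at ha; simp [ha]
      · intro a ha; simp at ha; simp [ha]
      · simp
      · simp
      · simp [hE.n1, hE.n2, hε]
    · rintro i hi s' ⟨hF, h16, h0, h12⟩
      refine ⟨by simpa [h0, h12, hq, meshNum, Nat.lt_ceil] using hi, WP.block ⟨⟨?_, ?_⟩, ?_, ?_, ?_⟩⟩
      · intro a ha; have := hF.1 a ha; simp at ha; simp [ha, this]
      · intro a ha; have := hF.2 a ha; simp at ha; simp [ha, this]
      · simp [h16, hF.1, hE.n5]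
      · simp [h16, hF.1, hE.n5]
      · simp [h12]
    · rintro s' ⟨hF, h16, h0, h12⟩
      refine ⟨?_, hF, h16⟩
      simp only [Test.Holds, h0, h12, not_lt, hq, meshNum]
      exact Nat.le_ceil _
  rintro s₁ ⟨hF₁, h16⟩
  have hE₁ := hE.mono hF₁
  refine WP.cut (fun s' => Frame {11, 12, 13, 16, 22, 29} {0, 12} s s' ∧ s'.nat 16 = q ∧
    s'.nat 12 = q + 1 ∧ s'.nat 11 = 3 * 5 ^ D ∧ s'.nat 13 = (q + 1) ^ D) (4 * D + 6)
    (4 * m + 21) (by omega) ?_ ?_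
  · refine WP.for D 3 (fun i s' => Frame {11, 12, 13, 16, 22, 29} {0, 12} s s' ∧ s'.nat 16 = q ∧
      s'.nat 12 = q + 1 ∧ s'.nat 11 = 3 * 5 ^ i ∧ s'.nat 13 = (q + 1) ^ i ∧ s'.nat 29 = 5 ∧
      s'.nat 22 = i) ?_ ?_ ?_ (by simp only [List.length_cons, List.length_nil]; omega)
    · refine ⟨⟨?_, ?_⟩, ?_, ?_, ?_, ?_, ?_, ?_⟩
      · intro a ha; simp at ha; simp [ha, hF₁.1]
      · intro a ha; simp [hF₁.2 a ha]
      · simp [h16]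
      · simp [h16, hE₁.n5]
      · simp
      · simp
      · simp
      · simp
    · rintro i hi s' ⟨hF, h16, h12, h11, h13, h29, h22⟩
      refine ⟨by simp [h22, hF.1, hE.n1, hi], WP.block ⟨⟨?_, ?_⟩, ?_, ?_, ?_, ?_, ?_, ?_⟩⟩
      · intro a ha; have := hF.1 a ha; simp at ha; simp [ha, this]
      · intro a ha; simp [hF.2 a ha]
      · simp [h16]
      · simp [h12]
      · simp [h11, h29, pow_succ, mul_assoc]
      · simp [h13, h12, pow_succ]
      · simp [h29]
      · simp [h22, hF.1, hE.n5]
    · rintro s' ⟨hF, h16, h12, h11, h13, h29, h22⟩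
      exact ⟨by simp [h22, hF.1, hE.n1], hF, h16, h12, h11, h13⟩
  rintro s₂ ⟨hF₂, h16₂, h12₂, h11₂, h13₂⟩
  have hE₂ := hE.mono hF₂
  refine WP.cut (fun s' => Frame {11, 12, 13, 16, 22, 29, 30} {0, 5, 12} s s' ∧ s'.nat 16 = q ∧
    s'.nat 12 = q + 1 ∧ s'.nat 11 = 3 * 5 ^ D ∧ s'.nat 13 = (q + 1) ^ D ∧ s'.nat 30 = K ^ m ∧
    s'.real 5 = (ε / (8 * m * K : ℕ)) ^ m) (4 * m + 9) 12 (by omega) ?_ ?_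
  -- The powers with exponent `m` are computed by `m` multiplications; `padSize` contains `m` to pay
  -- for them.
  · refine WP.for m 3 (fun i s' => Frame {11, 12, 13, 16, 22, 29, 30} {0, 5, 12} s s' ∧
      s'.nat 16 = q ∧ s'.nat 12 = q + 1 ∧ s'.nat 11 = 3 * 5 ^ D ∧ s'.nat 13 = (q + 1) ^ D ∧
      s'.nat 30 = K ^ i ∧ s'.real 5 = (ε / (8 * m * K : ℕ)) ^ i ∧
      s'.real 12 = ε / (8 * m * K : ℕ) ∧ s'.nat 22 = i) ?_ ?_ ?_
      (by simp only [List.length_cons, List.length_nil]; omega)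
    · refine ⟨⟨?_, ?_⟩, ?_, ?_, ?_, ?_, ?_, ?_, ?_, ?_⟩
      · intro a ha; simp at ha; simp [ha, hF₂.1]
      · intro a ha; simp at ha; simp [hF₂.2 a, ha]
      · simp [h16₂]
      · simp [h12₂]
      · simp [h11₂]
      · simp [h13₂]
      · simp
      · simp
      · simp [hF₂.2, hε, hE₂.n3, hE₂.n2]
      · simp
    · rintro i hi s' ⟨hF, h16, h12, h11, h13, h30, h5, h12', h22⟩
      have hE' := hE.mono hF
      refine ⟨by simp [h22, hF.1, hE.n3, hi],
        WP.block ⟨⟨?_, ?_⟩, ?_, ?_, ?_, ?_, ?_, ?_, ?_, ?_⟩⟩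
      · intro a ha; have := hF.1 a ha; simp at ha; simp [ha, this]
      · intro a ha; have := hF.2 a ha; simp at ha; simp [ha, this]
      · simp [h16]
      · simp [h12]
      · simp [h11]
      · simp [h13]
      · simp [h30, hE'.n2, pow_succ]
      · simp only [runs_cons, runs_nil, Instr.run, State.setNat_real, State.setReal_real, if_true,
          h5, State.setNat_nat, h12', pow_succ]
      · simpa using h12'
      · simp [h22, hE'.n5]
    · rintro s' ⟨hF, h16, h12, h11, h13, h30, h5, h12', h22⟩
      exact ⟨by simp [h22, hF.1, hE.n3], hF, h16, h12, h11, h13, h30, h5⟩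
  rintro s₃ ⟨hF, h16, h12, h11, h13, h30, h5⟩
  have hE' := hE.mono hF
  refine WP.block ⟨⟨?_, ?_⟩, ⟨?_, ?_, ?_⟩, ⟨?_, ?_⟩, ?_, ?_, ?_⟩
  · intro a ha; simp at ha; have := hF.1 a (by simp; omega); simp [ha, this]
  · intro a ha; simp at ha; have := hF.2 a (by simp; omega); simp [ha, this]
  · simp [h11, h30, slotNum]
  · simp
  · simp [h11, h30, slotNum]
  · simp [h12]
  · simp [h13]
  · simp [h16]
  · simp [hF.2, hR, hE'.n0, h30]
  · simp only [runs_cons, runs_nil, Instr.run]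
    simp only [State.setNat_nat, State.setNat_real, State.setReal_real, State.setReal_nat]
    simp [hF.2, hR, hE'.n0, h5]

/-! ### The loop over the scales. -/

/-- Heavy hitters and grids at the scale given by real cell `6`, which is doubled afterwards. -/
def levelProg : Prog :=
  .seq (block [.realMul 9 6 6, .realAdd 11 6 6, .realAdd 8 11 11, .realOfNat 0 16, .realDiv 8 8 0]) <|
  .seq heavyProg <| .seq gridsProg (block [.realAdd 6 6 6])

/-- The list contains the grids around the representatives of the heavy hitters at scale `σ`. -/
def CoversScale (N D T q o : ℕ) (x : ℕ → ℕ → ℝ) (s : State) (l : ℕ) (σ : ℝ) : Prop :=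
  ∃ c r : ℕ → ℕ, Heavy (sqDist D x) (σ * σ) T N c r ∧ ∀ j < T, ∀ v : ℕ → ℕ,
    (∀ l < D, v l < q + 1) →
      Lists D o s l (gridPoint (x (r j)) (σ + σ) ((σ + σ + (σ + σ)) / q) v)

theorem CoversScale.mono {N D T q o l l' : ℕ} {x : ℕ → ℕ → ℝ} {s s' : State} {σ : ℝ} {A B : Set ℕ}
    (h : CoversScale N D T q o x s l σ) (hF : Frame A B s s') (hl : l ≤ l')
    (hB : ∀ a, o ≤ a → a < o + l * D → a ∉ B) : CoversScale N D T q o x s' l' σ := by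
  obtain ⟨c, r, hH, H⟩ := h
  exact ⟨c, r, hH, fun j hj v hv => (H j hj v hv).mono hF hl hB⟩

/-- Time for one scale. -/
def levelTime (N D T M : ℕ) : ℕ :=
  N * (T * (9 * D + 20) + 16) + 8 * T + T * (D * (13 * M + 11) + 12) + 13

theorem levelProg_spec {N D K m b T q o k : ℕ} {x : ℕ → ℕ → ℝ} {s : State} {σ : ℝ}
    (hE : Env N D K m b x s) (hS : Slots T s) (hG : GridCells (q + 1) ((q + 1) ^ D) s)
    (hq : s.nat 16 = q) (hσ : s.real 6 = σ) (hN : 0 < N) (ho : OutLen D o s k)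
    (hob : b + N * D ≤ o) :
    WP levelProg (levelTime N D T ((q + 1) ^ D)) s fun s' =>
      Frame ({8, 10, 20, 21, 22, 23, 27} ∪ Set.Ico 31 42 ∪ Set.Ici 64)
        ({0, 1, 2, 6, 8, 9, 10, 11} ∪ Set.Ici (o + k * D)) s s' ∧ s'.real 6 = σ + σ ∧
      OutLen D o s' (k + T * (q + 1) ^ D) ∧
      CoversScale N D T q o x s' (k + T * (q + 1) ^ D) σ := by
  have hb := hE.hb
  rw [levelTime]
  refine WP.blockThen (N * (T * (9 * D + 20) + 16) + 8 * T + T * (D * (13 * (q + 1) ^ D + 11) + 12) + 8) ?_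
  set s₁ := runs _ s with hs₁
  have hF₁ : Frame ∅ {0, 8, 9, 11} s s₁ := by
    refine ⟨?_, ?_⟩ <;> intro a ha <;> simp at ha <;> simp [hs₁, ha]
  -- The heavy hitters compare squared distances with `σ²`. The grid reaches `2σ` from the
  -- representative in each coordinate direction, because this is the distance guaranteed by
  -- `Heavy.exists_near`; its side `4σ` is divided into `q` parts.
  have h9 : s₁.real 9 = σ * σ := by simp [hs₁, hσ]
  have h11 : s₁.real 11 = σ + σ := by simp [hs₁, hσ]
  have h8 : s₁.real 8 = (σ + σ + (σ + σ)) / q := by simp [hs₁, hσ, hq]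
  have h6 : s₁.real 6 = σ := by simp [hs₁, hσ]
  clear_value s₁
  refine WP.cut _ _ (T * (D * (13 * (q + 1) ^ D + 11) + 12) + 3) (by omega)
    (heavyProg_spec (hE.mono hF₁) (hS.mono hF₁) hN) ?_
  rintro s₂ ⟨hF₂, hH⟩
  have hF : Frame ({20, 21, 22, 23, 27, 31, 32, 33, 34, 35, 36, 37} ∪ Set.Ico 64 (64 + T + T))
    {0, 1, 2, 8, 9, 11} s s₂ := hF₁.trans hF₂
  rw [h9] at hH
  refine WP.cut _ _ 1 (by omega) (gridsProg_spec (hE.mono hF) (hS.mono hF) (hG.mono hF)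
    (o := o) (k := k) (by omega) (fun j hj => ?_) ⟨?_, ?_⟩ hob) ?_
  · have := hH.rep_lt j hj; omega
  · rw [hF.1 _ (by simp), ho.1]
  · rw [hF.1 _ (by simp), ho.2]
  rw [hF₂.2 8 (by simp), hF₂.2 11 (by simp), h8, h11]
  rintro s₃ ⟨hF₃, ho₃, hw⟩
  have h6' : s₃.real 6 = σ := by rw [hF₃.2 6 (by simp; omega), hF₂.2 6 (by simp), h6]
  have hF' : Frame ({8, 10, 20, 21, 22, 23, 27} ∪ Set.Ico 31 42 ∪ Set.Ici 64)
        ({0, 1, 2, 6, 8, 9, 10, 11} ∪ Set.Ici (o + k * D)) s s₃ := hF.trans hF₃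
  refine WP.block ⟨⟨?_, ?_⟩, ?_, ⟨?_, ?_⟩, _, _, hH, fun j hj v hv => ?_⟩
  · intro a ha; simp [hF'.1 a ha]
  · intro a ha; have := hF'.2 a ha; simp at ha; simp [ha, this]
  · simp [h6']
  · simp [ho₃.1]
  · simp [ho₃.2]
  · obtain ⟨g, hg, h⟩ := hw j hj v hv
    refine ⟨g, hg, fun i hi => ?_⟩
    have : o + g * D + i ≠ 6 := by omega
    simp [this, h i hi]

/-- The main loop over the scales. -/
def scalesProg : Prog := .seq (block []) (.loop (.realLt 6 7) levelProg)

theorem scalesProg_spec {N D K m b T q o k : ℕ} {x : ℕ → ℕ → ℝ} {s : State} {σ τ : ℝ}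
    (hE : Env N D K m b x s) (hS : Slots T s) (hG : GridCells (q + 1) ((q + 1) ^ D) s)
    (hq : s.nat 16 = q) (hσ : s.real 6 = σ) (hτ : s.real 7 = τ) (hN : 0 < N)
    (ho : OutLen D o s k) (hob : b + N * D ≤ o) (L : ℕ) (hL : ∀ i < L, 2 ^ i * σ < τ)
    (hL' : ¬ 2 ^ L * σ < τ) :
    WP scalesProg (L * (levelTime N D T ((q + 1) ^ D) + 1) + 1) s fun s' =>
      Frame ({8, 10, 20, 21, 22, 23, 27} ∪ Set.Ico 31 42 ∪ Set.Ici 64)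
        ({0, 1, 2, 6, 8, 9, 10, 11} ∪ Set.Ici (o + k * D)) s s' ∧
      OutLen D o s' (k + L * (T * (q + 1) ^ D)) ∧
      ∀ i < L, CoversScale N D T q o x s' (k + L * (T * (q + 1) ^ D)) (2 ^ i * σ) := by
  have hb := hE.hb
  refine WP.for L (levelTime N D T ((q + 1) ^ D)) (fun n s' =>
      Frame ({8, 10, 20, 21, 22, 23, 27} ∪ Set.Ico 31 42 ∪ Set.Ici 64)
        ({0, 1, 2, 6, 8, 9, 10, 11} ∪ Set.Ici (o + k * D)) s s' ∧
      s'.real 6 = 2 ^ n * σ ∧ OutLen D o s' (k + n * (T * (q + 1) ^ D)) ∧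
      ∀ i < n, CoversScale N D T q o x s' (k + n * (T * (q + 1) ^ D)) (2 ^ i * σ)) ?_ ?_ ?_
      (by simp only [List.length_nil]; omega)
  · refine ⟨Frame.refl _ _ _, ?_, ⟨?_, ?_⟩, ?_⟩
    · simp [hσ]
    · simp [ho.1]
    · simp [ho.2]
    · simp
  · rintro n hn s' ⟨hF, h6, ho', hC⟩
    have h7 : s'.real 7 = τ := by rw [hF.2 7 (by simp; omega), hτ]
    refine ⟨by simpa [h6, h7] using hL n hn, ?_⟩
    refine (levelProg_spec (hE.mono hF) (hS.mono hF) (hG.mono hF) ((hF.1 16 (by simp)).trans hq)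
      h6 hN ho' hob).mono le_rfl ?_
    rintro s'' ⟨hF', h6', ho'', hC'⟩
    have hle : k * D ≤ (k + n * (T * (q + 1) ^ D)) * D := Nat.mul_le_mul_right _ (by omega)
    have e : k + (n + 1) * (T * (q + 1) ^ D) = k + n * (T * (q + 1) ^ D) + T * (q + 1) ^ D := by
      ring
    rw [e]
    refine ⟨hF.trans hF', ?_, ho'', ?_⟩
    · rw [h6']; ring
    · intro i hi
      rcases Nat.lt_succ_iff_lt_or_eq.mp hi with hi | rfl
      · exact (hC i hi).mono hF' (by omega) (by intro a _ _; simp; omega)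
      · exact hC'
  · rintro s' ⟨hF, h6, ho', hC⟩
    have h7 : s'.real 7 = τ := by rw [hF.2 7 (by simp; omega), hτ]
    exact ⟨by simpa [h6, h7] using hL', hF, ho', hC⟩

/-! ### Padding and the complete program. -/

/-- Append the points of the diagonal with coordinates `0, 1, 2, …` to the output. -/
def diagonalProg : Prog :=
  .seq (block [.natAdd 34 10 3, .natAdd 34 34 16, .natConst 31 0]) (.loop (.natLt 31 34)
    (.seq (.seq (block [.realOfNat 0 31, .natConst 22 0]) (.loop (.natLt 22 1)
      (block [.natAdd 23 8 22, .realStore 23 0, .natAdd 22 22 5])))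
    (block [.natAdd 8 8 1, .natAdd 10 10 5, .natAdd 31 31 5])))

/-- The diagonal has as many points as everything written before, plus `m` and `q`. They are
pairwise distinct whatever the input is, so the output set has at least this size even if grids
overlap. -/
theorem diagonalProg_spec {D m q o k : ℕ} {s : State} (h5 : s.nat 5 = 1) (h1 : s.nat 1 = D)
    (h3 : s.nat 3 = m) (h16 : s.nat 16 = q) (ho : OutLen D o s k) (ho' : 1 ≤ o) :
    WP diagonalProg ((k + m + q) * (4 * D + 7) + 4) s fun s' =>
      Frame {8, 10, 22, 23, 31, 34} ({0} ∪ Set.Ici (o + k * D)) s s' ∧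
      OutLen D o s' (k + (k + m + q)) ∧
      ∀ w < k + m + q, Lists D o s' (k + (k + m + q)) fun _ => w := by
  refine WP.for (k + m + q) (4 * D + 6) (fun i s' =>
    Frame {8, 10, 22, 23, 31, 34} ({0} ∪ Set.Ici (o + k * D)) s s' ∧ s'.nat 31 = i ∧
      s'.nat 34 = k + m + q ∧ OutLen D o s' (k + i) ∧
      ∀ w < i, Lists D o s' (k + i) fun _ => w) ?_ ?_ ?_
      (by simp only [List.length_cons, List.length_nil]; ring_nf; omega)
  · refine ⟨⟨?_, ?_⟩, ?_, ?_, ⟨?_, ?_⟩, ?_⟩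
    · intro a ha; simp at ha; simp [ha]
    · intro a ha; simp
    · simp
    · simp [ho.1, h3, h16]
    · simp [ho.1]
    · simp [ho.2]
    · simp
  · rintro i hi s' ⟨hF, h31, h34, hl, hw⟩
    have e5 : s'.nat 5 = 1 := by rw [hF.1 5 (by simp), h5]
    have e1 : s'.nat 1 = D := by rw [hF.1 1 (by simp), h1]
    have h8 := hl.2
    have hle : k * D ≤ (k + i) * D := Nat.mul_le_mul_right _ (by omega)
    refine ⟨by simp [h31, h34, hi], ?_⟩
    refine WP.cut (fun s'' => Frame {22, 23} ({0} ∪ Set.Ici (o + (k + i) * D)) s' s'' ∧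
      ∀ j < D, s''.real (o + (k + i) * D + j) = i) (4 * D + 3) 3 (by omega) ?_ ?_
    · refine WP.for D 3 (fun n s'' => Frame {22, 23} ({0} ∪ Set.Ici (o + (k + i) * D)) s' s'' ∧
        s''.nat 22 = n ∧ s''.real 0 = i ∧ ∀ j < n, s''.real (o + (k + i) * D + j) = i) ?_ ?_ ?_
        (by simp only [List.length_cons, List.length_nil]; omega)
      · refine ⟨⟨?_, ?_⟩, ?_, ?_, ?_⟩
        · intro a ha; simp at ha; simp [ha]
        · intro a ha; simp at ha; simp [ha]
        · simp
        · simp [h31]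
        · simp
      · rintro n hn s'' ⟨hF', h22, h0, hj⟩
        have e8 : s''.nat 8 = o + (k + i) * D := by rw [hF'.1 8 (by simp), h8]
        refine ⟨by simp [h22, hF'.1, e1, hn], WP.block ⟨⟨?_, ?_⟩, ?_, ?_, ?_⟩⟩
        · intro a ha; have := hF'.1 a ha; simp at ha; simp [ha, this]
        · intro a ha; have := hF'.2 a ha; simp at ha; simp [this, e8, h22]; omega
        · simp [h22, hF'.1, e5]
        · simp [h0]
        · intro j hj'
          rcases Nat.lt_succ_iff_lt_or_eq.mp hj' with hj' | rfl
          · simp [e8, h22, h0, hj j hj']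
          · simp [e8, h22, h0]
      · rintro s'' ⟨hF', h22, h0, hj⟩
        exact ⟨by simp [h22, hF'.1, e1], hF', hj⟩
    · rintro s'' ⟨hF', hj⟩
      have hF'' : Frame {8, 10, 22, 23, 31, 34} ({0} ∪ Set.Ici (o + k * D)) s s'' := hF.trans hF'
      refine WP.block ⟨⟨?_, ?_⟩, ?_, ?_, ⟨?_, ?_⟩, ?_⟩
      · intro a ha; have := hF''.1 a ha; simp at ha; simp [ha, this]
      · intro a ha; simp [hF''.2 a ha]
      · simp [hF'.1, h31, e5]
      · simp [hF'.1, h34]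
      · simp [hF'.1, hl.1, e5, add_assoc]
      · simp [hF'.1, h8, e1]; ring
      · intro w hw'
        rcases Nat.lt_succ_iff_lt_or_eq.mp hw' with hw' | rfl
        · obtain ⟨g, hg, h⟩ : Lists D o s'' (k + (i + 1)) fun _ => w :=
            (hw w hw').mono hF' (by omega) (by intro a _ _; simp; omega)
          exact ⟨g, hg, h⟩
        · exact ⟨k + w, by omega, fun j hj' => hj j hj'⟩
  · rintro s' ⟨hF, h31, h34, hl, hw⟩
    exact ⟨by simp [h31, h34], hF, hl, hw⟩

/-- Everything up to the farthest-point traversal. -/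
def startProg : Prog := .seq relocateProg farthestProg

/-- Everything after the farthest-point traversal. -/
def finishProg : Prog :=
  .seq paramProg <| .seq scalesProg <| .seq diagonalProg (block [.natCopy 0 10, .natCopy 1 9])

/-- The smallest scale. -/
noncomputable def minScale (N K m : ℕ) (R : ℝ) : ℝ := √R / (N * K ^ m : ℕ)

/-- A bound for the scales. -/
noncomputable def maxScale (N K m : ℕ) (ε R : ℝ) : ℝ :=
  (4 * N : ℕ) * √R / (ε / (8 * m * K : ℕ)) ^ m

/-- Number of output points before padding with `L` scales. -/
noncomputable def coreSize (D K m : ℕ) (ε : ℝ) (L : ℕ) : ℕ :=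
  K + L * (slotNum D K m * (meshNum D K ε + 1) ^ D)

/-- Number of output points on the diagonal. -/
noncomputable def padSize (D K m : ℕ) (ε : ℝ) (L : ℕ) : ℕ :=
  coreSize D K m ε L + m + meshNum D K ε

theorem finishProg_spec {N D K m b : ℕ} {ε R : ℝ} {x : ℕ → ℕ → ℝ} {s : State} {c : ℕ → ℕ}
    (hE : Env N D K m b x s) (hε : s.real 3 = ε) (hR : s.real 4 = R) (hN : 0 < N)
    (ho : OutLen D (b + N * D + N) s K)
    (hc : ∀ i < K, Lists D (b + N * D + N) s K (x (c i))) (L : ℕ)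
    (hL : ∀ i < L, 2 ^ i * minScale N K m R < maxScale N K m ε R)
    (hL' : ¬ 2 ^ L * minScale N K m R < maxScale N K m ε R) :
    WP finishProg (3 * meshNum D K ε + 4 * D + 4 * m + 35 +
      (L * (levelTime N D (slotNum D K m) ((meshNum D K ε + 1) ^ D) + 1) + 1) +
      (padSize D K m ε L * (4 * D + 7) + 4) + 2) s fun s' =>
      s'.nat 0 = coreSize D K m ε L + padSize D K m ε L ∧ s'.nat 1 = b + N * D + N ∧
      (∀ i < K, Lists D (b + N * D + N) s' (coreSize D K m ε L + padSize D K m ε L) (x (c i))) ∧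
      (∀ i < L, CoversScale N D (slotNum D K m) (meshNum D K ε) (b + N * D + N) x s'
        (coreSize D K m ε L + padSize D K m ε L) (2 ^ i * minScale N K m R)) ∧
      ∀ w < padSize D K m ε L,
        Lists D (b + N * D + N) s' (coreSize D K m ε L + padSize D K m ε L) fun _ => w := by
  have hb := hE.hb
  refine WP.cut _ _ (L * (levelTime N D (slotNum D K m) ((meshNum D K ε + 1) ^ D) + 1) + 1 +
    (padSize D K m ε L * (4 * D + 7) + 4) + 2) (by omega) (paramProg_spec hE hε hR) ?_
  rintro s₁ ⟨hF₁, hS, hG, h16, h6, h7⟩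
  have hE₁ := hE.mono hF₁
  refine WP.cut _ _ (padSize D K m ε L * (4 * D + 7) + 4 + 2) (by omega)
    (scalesProg_spec hE₁ hS hG h16 h6 h7 hN (o := b + N * D + N) (k := K) ⟨?_, ?_⟩ (by omega) L
      hL hL') ?_
  · rw [hF₁.1 _ (by simp), ho.1]
  · rw [hF₁.1 _ (by simp), ho.2]
  rintro s₂ ⟨hF₂, ho₂, hC⟩
  have hF : Frame ({8, 10, 11, 12, 13, 14, 15, 16, 20, 21, 22, 23, 27, 29, 30} ∪ Set.Ico 31 42 ∪
    Set.Ici 64) ({0, 1, 2, 4, 5, 6, 7, 8, 9, 10, 11, 12} ∪ Set.Ici (b + N * D + N + K * D)) s s₂ :=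
    hF₁.trans hF₂
  have hE₂ := hE.mono hF
  refine WP.cut _ _ 2 (by rw [padSize, coreSize])
    (diagonalProg_spec hE₂.n5 hE₂.n1 hE₂.n3 ((hF₂.1 16 (by simp)).trans h16) ho₂ (by omega)) ?_
  rintro s₃ ⟨hF₃, ho₃, hw⟩
  have hle : K * D ≤ coreSize D K m ε L * D :=
    Nat.mul_le_mul_right _ (by rw [coreSize]; omega)
  have hFb : Frame {0, 1} ∅ s₃ (runs [.natCopy 0 10, .natCopy 1 9] s₃) := by
    refine ⟨?_, ?_⟩ <;> intro a ha <;> simp at ha <;> simp [ha]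
  change Frame _ ({0} ∪ Set.Ici (_ + coreSize D K m ε L * D)) _ _ at hF₃
  refine WP.block ⟨?_, ?_, ?_, ?_, ?_⟩
  · simp [ho₃.1, padSize, coreSize]
  · simp [hF₃.1, hE₂.n9]
  · intro i hi
    exact ((((hc i hi).mono hF le_rfl (by intro a _ _; simp; omega)).mono hF₃
      (l' := coreSize D K m ε L + padSize D K m ε L) (by rw [coreSize]; omega)
      (by intro a _ _; simp; omega))).mono hFb le_rfl (by simp)
  · intro i hi
    exact (((hC i hi).mono hF₃ (l' := coreSize D K m ε L + padSize D K m ε L)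
      (by rw [coreSize]; omega)
      (by intro a _ h; change a < _ + coreSize D K m ε L * D at h; simp; omega))).mono hFb le_rfl
      (by simp)
  · intro w hw'
    exact (hw w hw').mono hFb le_rfl (by simp)

/-- The candidate set algorithm. -/
def candidateProg : Prog := .seq startProg finishProg

/-- Running time of the candidate set algorithm with `L` scales. -/
noncomputable def candidateTime (N D K m : ℕ) (ε : ℝ) (L : ℕ) : ℕ :=
  (5 * (N * D) + 13 + (K * (N * (9 * D + 16) + 6 * D + 13) + 3)) +
    (3 * meshNum D K ε + 4 * D + 4 * m + 35 +
      (L * (levelTime N D (slotNum D K m) ((meshNum D K ε + 1) ^ D) + 1) + 1) +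
      (padSize D K m ε L * (4 * D + 7) + 4) + 2)

/-- The number `L` of scales depends on `R`, which is known only after the traversal. The traversal
data are therefore produced first and are the same for every admissible `L`. -/
theorem candidateProg_spec {N D K m : ℕ} {ε : ℝ} {x : ℕ → ℕ → ℝ} {s : State} (h0 : s.nat 0 = N)
    (h1 : s.nat 1 = D) (h2 : s.nat 2 = K) (h3 : s.nat 3 = m) (h4 : s.nat 4 = 0)
    (h10 : s.nat 10 = 0) (hε : s.real 0 = ε)
    (hx : ∀ n < N, ∀ i < D, s.real (1 + (n * D + i)) = x n i) (hN : 0 < N) :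
    ∃ c d R p, Farthest N (sqDist D x) K c d R p ∧ ∀ L : ℕ,
      (∀ i < L, 2 ^ i * minScale N K m R < maxScale N K m ε R) →
      ¬ 2 ^ L * minScale N K m R < maxScale N K m ε R →
      ∃ o, WP candidateProg (candidateTime N D K m ε L) s fun s' =>
        s'.nat 0 = coreSize D K m ε L + padSize D K m ε L ∧ s'.nat 1 = o ∧
        (∀ i < K, Lists D o s' (coreSize D K m ε L + padSize D K m ε L) (x (c i))) ∧
        (∀ i < L, CoversScale N D (slotNum D K m) (meshNum D K ε) o x s'
          (coreSize D K m ε L + padSize D K m ε L) (2 ^ i * minScale N K m R)) ∧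
        ∀ w < padSize D K m ε L,
          Lists D o s' (coreSize D K m ε L + padSize D K m ε L) fun _ => w := by
  have hstart : WP startProg (5 * (N * D) + 13 + (K * (N * (9 * D + 16) + 6 * D + 13) + 3)) s
      fun s' => Env N D K m (N * D + 33) x s' ∧ s'.real 3 = ε ∧
        ∃ c d p, Farthest N (sqDist D x) K c d (s'.real 4) p ∧
          OutLen D (N * D + 33 + N * D + N) s' K ∧
          ∀ i < K, Lists D (N * D + 33 + N * D + N) s' K (x (c i)) := by
    refine WP.cut _ _ _ le_rfl (relocateProg_spec h0 h1 h2 h3 h4 h10 hε hx) ?_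
    rintro s₁ ⟨hE, h3, ho⟩
    refine (farthestProg_spec hE hN ho).mono le_rfl ?_
    rintro s₂ ⟨hF, h⟩
    exact ⟨hE.mono hF, by rw [hF.2 3 (by simp; omega), h3], h⟩
  obtain ⟨s₁, t, he, ht, hE, h3, c, d, p, hf, ho, hc⟩ := hstart
  refine ⟨c, d, _, p, hf, fun L hL hL' =>
    ⟨N * D + 33 + N * D + N, ?_⟩⟩
  obtain ⟨s₂, t', he', ht', H⟩ := finishProg_spec hE h3 rfl hN ho hc L hL hL'
  exact ⟨s₂, _, .seq he he', add_le_add ht ht', H⟩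

/-! ### Packing and the analysis of the heavy hitters. -/

section Packing

variable {E : Type*} [NormedAddCommGroup E] [InnerProductSpace ℝ E] [FiniteDimensional ℝ E]

/-- Translating `y` to the origin and dividing by `σ` gives points of norm at most `2` at mutual
distance at least `1`, the situation of `Besicovitch.card_le_of_separated`. -/
theorem card_le_of_separated_of_near {ι : Type*} {J : Finset ι} {f : ι → E} {y : E} {σ : ℝ}
    (hσ : 0 < σ) (hy : ∀ j ∈ J, ‖f j - y‖ ≤ 2 * σ)
    (hs : ∀ i ∈ J, ∀ j ∈ J, i ≠ j → σ < ‖f i - f j‖) : J.card ≤ 5 ^ Module.finrank ℝ E := by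
  classical
  have hsub : ∀ i j, ‖σ⁻¹ • (f i - y) - σ⁻¹ • (f j - y)‖ = σ⁻¹ * ‖f i - f j‖ := by
    intro i j
    rw [← smul_sub, norm_smul, Real.norm_of_nonneg (by positivity)]
    congr 2; abel
  have hinj : Set.InjOn (fun j => σ⁻¹ • (f j - y)) J := by
    intro i hi j hj e
    by_contra hne
    have h := hsub i j
    simp only at e
    rw [e, sub_self, norm_zero] at h
    have := hs i hi j hj hne
    have : 0 < σ⁻¹ * ‖f i - f j‖ := mul_pos (by positivity) (hσ.trans this)
    linarith
  rw [← Finset.card_image_of_injOn hinj]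
  refine Besicovitch.card_le_of_separated _ ?_ ?_
  · simp only [Finset.mem_image, forall_exists_index, and_imp, forall_apply_eq_imp_iff₂]
    intro j hj
    rw [norm_smul, Real.norm_of_nonneg (by positivity), inv_mul_le_iff₀ hσ]
    linarith [hy j hj]
  · simp only [Finset.mem_image, forall_exists_index, and_imp, forall_apply_eq_imp_iff₂]
    intro i hi j hj hne
    have : i ≠ j := by rintro rfl; exact hne rfl
    rw [hsub, ← div_eq_inv_mul, one_le_div hσ]
    exact (hs i hi j hj this).le

end Packing

/-- The effect of changing one summand, in a form free of truncated subtraction. -/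
theorem sum_range_update {T f : ℕ} (hf : f < T) {F F' : ℕ → ℕ}
    (h : ∀ j < T, j ≠ f → F' j = F j) :
    ∑ j ∈ Finset.range T, F' j + F f = ∑ j ∈ Finset.range T, F j + F' f := by
  have hm := Finset.mem_range.mpr hf
  rw [← Finset.add_sum_erase _ _ hm, ← Finset.add_sum_erase (Finset.range T) F hm,
    Finset.sum_congr rfl fun j hj => h j (Finset.mem_range.mp (Finset.mem_of_mem_erase hj))
      (Finset.ne_of_mem_erase hj)]
  ring

section Invariant

variable {E : Type*} [NormedAddCommGroup E] [InnerProductSpace ℝ E] [FiniteDimensional ℝ E]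

open Classical in
/-- The counting invariants of the heavy-hitters algorithm: `a` counts the decrements. -/
theorem Heavy.exists_decrements {pt : ℕ → E} {dd : ℕ → ℕ → ℝ}
    (hdd : ∀ n p, dd n p = ‖pt n - pt p‖ ^ 2) {σ : ℝ} (hσ : 0 < σ) {T n : ℕ} {c r : ℕ → ℕ}
    (h : Heavy dd (σ * σ) T n c r) {K : ℕ} (μ : Fin K → E) : ∃ a : ℕ,
    (∀ i < T, ∀ j < T, i ≠ j → c i ≠ 0 → c j ≠ 0 → σ < ‖pt (r i) - pt (r j)‖) ∧
    (∀ y, ((Finset.range n).filter fun i => ‖pt i - y‖ ≤ σ).card ≤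
      5 ^ Module.finrank ℝ E * a +
        ∑ j ∈ Finset.range T, if ‖pt (r j) - y‖ ≤ 2 * σ then c j else 0) ∧
    a * T + (∑ j ∈ Finset.range T, if ∀ k, 2 * σ < ‖pt (r j) - μ k‖ then c j else 0) ≤
      ((Finset.range n).filter fun i => ∀ k, σ < ‖pt i - μ k‖).card +
        a * (K * 5 ^ Module.finrank ℝ E) := by
  have hle : ∀ n p, dd n p ≤ σ * σ ↔ ‖pt n - pt p‖ ≤ σ := fun n p => by
    rw [hdd, ← sq, sq_le_sq₀ (norm_nonneg _) hσ.le]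
  have hlt : ∀ n p, σ * σ < dd n p ↔ σ < ‖pt n - pt p‖ := fun n p => by
    rw [← not_le, hle, not_le]
  induction h with
  | @zero c r hc hr =>
    refine ⟨0, ?_, ?_, ?_⟩
    · intro i hi j _ _ h; exact absurd (hc i hi) h
    · simp
    · simp only [zero_mul, Finset.range_zero, Finset.filter_empty, Finset.card_empty, add_zero,
        nonpos_iff_eq_zero, zero_add, Finset.sum_eq_zero_iff]
      intro j hj
      simp [hc j (Finset.mem_range.mp hj)]
  | @succ n c r c' r' _ hst ih =>
    obtain ⟨a, hsep, hnear, hfar⟩ := ih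
    have hcard : ∀ (P : ℕ → Prop) [DecidablePred P], ((Finset.range (n + 1)).filter P).card =
        ((Finset.range n).filter P).card + if P n then 1 else 0 := by
      intro P _
      rw [Finset.range_add_one, Finset.filter_insert]
      split_ifs <;> simp
    rcases hst with ⟨f, hf, hcf, hcl, hc', hr'⟩ | ⟨hno, ⟨e, he, hce, hc', hr'⟩ | hall⟩
    · rw [hle] at hcl
      have hsum : ∀ (P : E → Prop) [DecidablePred P], (∑ j ∈ Finset.range T, if P (pt (r' j)) then c' j else 0) =
          (∑ j ∈ Finset.range T, if P (pt (r j)) then c j else 0) +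
            if P (pt (r f)) then 1 else 0 := by
        intro P _
        have := sum_range_update hf (F := fun j => if P (pt (r j)) then c j else 0)
          (F' := fun j => if P (pt (r' j)) then c' j else 0) (fun j hj hne => by
            simp only [hr' j hj, hc' j hj, if_neg hne])
        simp only [hr' f hf, hc' f hf, if_true] at this
        split_ifs at this ⊢ <;> omega
      have hc0 : ∀ j < T, c' j ≠ 0 → c j ≠ 0 := by
        intro j hj h
        rw [hc' j hj] at h
        split_ifs at h with hjf
        · rw [hjf]; exact hcf
        · exact h
      refine ⟨a, ?_, ?_, ?_⟩
      · intro i hi j hj hne hi0 hj0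
        rw [hr' i hi, hr' j hj]
        exact hsep i hi j hj hne (hc0 i hi hi0) (hc0 j hj hj0)
      · intro y
        rw [hcard, hsum fun z => ‖z - y‖ ≤ 2 * σ]
        have := hnear y
        -- The increment is booked on a representative within `σ` of the new point. Points within
        -- `σ` of `y` are thus counted by representatives within `2σ` of `y`.
        have h1 : ‖pt n - y‖ ≤ σ → ‖pt (r f) - y‖ ≤ 2 * σ := by
          intro h
          have := norm_sub_le_norm_sub_add_norm_sub (pt (r f)) (pt n) y
          rw [norm_sub_rev (pt (r f)) (pt n)] at this
          linarith
        split_ifs <;> first | omega | (exfalso; tauto)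
      · rw [hcard, hsum fun z => ∀ k, 2 * σ < ‖z - μ k‖]
        -- Conversely, a representative farther than `2σ` from all means is only incremented by
        -- points farther than `σ` from all means.
        have h1 : (∀ k, 2 * σ < ‖pt (r f) - μ k‖) → ∀ k, σ < ‖pt n - μ k‖ := by
          intro h k
          have := norm_sub_le_norm_sub_add_norm_sub (pt (r f)) (pt n) (μ k)
          rw [norm_sub_rev (pt (r f)) (pt n)] at this
          linarith [h k]
        split_ifs <;> first | omega | (exfalso; tauto)
    · simp only [hlt] at hno
      have hsum : ∀ (P : E → Prop) [DecidablePred P], (∑ j ∈ Finset.range T, if P (pt (r' j)) then c' j else 0) =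
          (∑ j ∈ Finset.range T, if P (pt (r j)) then c j else 0) +
            if P (pt n) then 1 else 0 := by
        intro P _
        have := sum_range_update he (F := fun j => if P (pt (r j)) then c j else 0)
          (F' := fun j => if P (pt (r' j)) then c' j else 0) (fun j hj hne => by
            simp only [hr' j hj, hc' j hj, if_neg hne])
        simp only [hr' e he, hc' e he, if_true, hce, ite_self, add_zero] at this
        exact this
      refine ⟨a, ?_, ?_, ?_⟩
      · intro i hi j hj hne hi0 hj0
        rw [hc' i hi] at hi0
        rw [hc' j hj] at hj0
        rw [hr' i hi, hr' j hj]
        split_ifs at hi0 hj0 ⊢ with h1 h2 h2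
        · omega
        · exact hno j hj hj0
        · rw [norm_sub_rev]; exact hno i hi hi0
        · exact hsep i hi j hj hne hi0 hj0
      · intro y
        rw [hcard, hsum fun z => ‖z - y‖ ≤ 2 * σ]
        have := hnear y
        have h1 : ‖pt n - y‖ ≤ σ → ‖pt n - y‖ ≤ 2 * σ := fun h => by linarith
        split_ifs <;> first | omega | (exfalso; tauto)
      · rw [hcard, hsum fun z => ∀ k, 2 * σ < ‖z - μ k‖]
        have h1 : (∀ k, 2 * σ < ‖pt n - μ k‖) → ∀ k, σ < ‖pt n - μ k‖ :=
          fun h k => by linarith [h k]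
        split_ifs <;> first | omega | (exfalso; tauto)
    · simp only [hlt] at hno
      -- In this case no counter is zero, so every slot loses exactly one unit and truncation does
      -- not occur.
      have hsum : ∀ (P : E → Prop) [DecidablePred P], (∑ j ∈ Finset.range T, if P (pt (r j)) then c j else 0) =
          (∑ j ∈ Finset.range T, if P (pt (r' j)) then c' j else 0) +
            ((Finset.range T).filter fun j => P (pt (r j))).card := by
        intro P _
        rw [Finset.card_filter, ← Finset.sum_add_distrib]
        refine Finset.sum_congr rfl fun j hj => ?_
        obtain ⟨h1, h2, h3⟩ := hall j (Finset.mem_range.mp hj)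
        rw [h3, h2]
        split_ifs <;> omega
      -- A decrement also discards the new point, which is more than `σ` away from all
      -- representatives. It can be added to the separated family, so the packing bound covers all
      -- units lost near `y`.
      have hpack : ∀ y, ((Finset.range T).filter fun j => ‖pt (r j) - y‖ ≤ 2 * σ).card +
          (if ‖pt n - y‖ ≤ σ then 1 else 0) ≤ 5 ^ Module.finrank ℝ E := by
        intro y
        set J := (Finset.range T).filter fun j => ‖pt (r j) - y‖ ≤ 2 * σ with hJ
        have hJT : ∀ j ∈ J, j < T ∧ ‖pt (r j) - y‖ ≤ 2 * σ := fun j hj => by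
          simpa [hJ] using hj
        split_ifs with hn
        -- The index `T` belongs to no slot and stands for the new point.
        · have hT : T ∉ J := fun h => lt_irrefl _ (hJT T h).1
          rw [← Finset.card_insert_of_notMem hT]
          refine card_le_of_separated_of_near (f := fun j => if j = T then pt n else pt (r j))
            (y := y) hσ ?_ ?_
          · intro j hj
            rcases Finset.mem_insert.mp hj with rfl | hj
            · simp only [if_true]; linarith
            · simp only [if_neg (hJT j hj).1.ne]; exact (hJT j hj).2
          · intro i hi j hj hne
            rcases Finset.mem_insert.mp hi with rfl | hi <;>
              rcases Finset.mem_insert.mp hj with rfl | hj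
            · exact absurd rfl hne
            · simp only [if_true, if_neg (hJT j hj).1.ne]
              exact hno j (hJT j hj).1 (hall j (hJT j hj).1).1
            · simp only [if_true, if_neg (hJT i hi).1.ne]
              rw [norm_sub_rev]
              exact hno i (hJT i hi).1 (hall i (hJT i hi).1).1
            · simp only [if_neg (hJT i hi).1.ne, if_neg (hJT j hj).1.ne]
              exact hsep i (hJT i hi).1 j (hJT j hj).1 hne (hall i (hJT i hi).1).1
                (hall j (hJT j hj).1).1
        · exact card_le_of_separated_of_near (f := fun j => pt (r j)) (y := y) hσ
            (fun j hj => (hJT j hj).2) fun i hi j hj hne => hsep i (hJT i hi).1 j (hJT j hj).1 hne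
              (hall i (hJT i hi).1).1 (hall j (hJT j hj).1).1
      refine ⟨a + 1, ?_, ?_, ?_⟩
      · intro i hi j hj hne hi0 hj0
        rw [(hall i hi).2.2, (hall j hj).2.2]
        exact hsep i hi j hj hne (hall i hi).1 (hall j hj).1
      · intro y
        have h1 := hnear y
        have h2 := hpack y
        rw [hsum fun z => ‖z - y‖ ≤ 2 * σ] at h1
        rw [hcard, mul_add, mul_one]
        omega
      · rw [hsum fun z => ∀ k, 2 * σ < ‖z - μ k‖] at hfar
        -- At most `5 ^ D` representatives lie near each mean (`D` being the dimension), so all but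
        -- `K * 5 ^ D` of the decremented counters are far from all means.
        have hcov : T ≤ ((Finset.range T).filter fun j => ∀ k, 2 * σ < ‖pt (r j) - μ k‖).card +
            K * 5 ^ Module.finrank ℝ E := by
          have h1 : Finset.range T ⊆
              ((Finset.range T).filter fun j => ∀ k, 2 * σ < ‖pt (r j) - μ k‖) ∪
              Finset.univ.biUnion fun k : Fin K =>
                (Finset.range T).filter fun j => ‖pt (r j) - μ k‖ ≤ 2 * σ := by
            intro j hj
            by_cases h : ∀ k, 2 * σ < ‖pt (r j) - μ k‖
            · exact Finset.mem_union_left _ (Finset.mem_filter.mpr ⟨hj, h⟩)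
            · push Not at h
              obtain ⟨k, hk⟩ := h
              exact Finset.mem_union_right _ (Finset.mem_biUnion.mpr
                ⟨k, Finset.mem_univ _, Finset.mem_filter.mpr ⟨hj, hk⟩⟩)
          have h2 := (Finset.card_le_card h1).trans (Finset.card_union_le _ _)
          have h3 : (Finset.univ.biUnion fun k : Fin K => (Finset.range T).filter fun j =>
              ‖pt (r j) - μ k‖ ≤ 2 * σ).card ≤ K * 5 ^ Module.finrank ℝ E := by
            refine Finset.card_biUnion_le.trans ((Finset.sum_le_card_nsmul _ _ _ fun k _ =>
              (Nat.le_add_right _ _).trans (hpack (μ k))).trans ?_)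
            simp
          rw [Finset.card_range] at h2
          omega
        rw [hcard, add_mul, add_mul, one_mul, one_mul]
        omega

open Classical in
/-- A ball with many points has a representative nearby. -/
theorem Heavy.exists_near {pt : ℕ → E} {dd : ℕ → ℕ → ℝ}
    (hdd : ∀ n p, dd n p = ‖pt n - pt p‖ ^ 2) {σ : ℝ} (hσ : 0 < σ) {T n : ℕ} {c r : ℕ → ℕ}
    (h : Heavy dd (σ * σ) T n c r) {K : ℕ} (μ : Fin K → E) (y : E)
    (hy : 5 ^ Module.finrank ℝ E * ((Finset.range n).filter fun i => ∀ k, σ < ‖pt i - μ k‖).card <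
      ((Finset.range n).filter fun i => ‖pt i - y‖ ≤ σ).card *
        (T - K * 5 ^ Module.finrank ℝ E)) :
    ∃ j < T, ‖pt (r j) - y‖ ≤ 2 * σ := by
  obtain ⟨a, -, hnear, hfar⟩ := h.exists_decrements hdd hσ μ
  by_contra! hno
  -- Without a representative near `y`, all points of the ball were cancelled by decrements; `h2`
  -- bounds the number of decrements by the points far from all means.
  have h1 := hnear y
  rw [Finset.sum_eq_zero fun j hj => if_neg (not_le.mpr (hno j (Finset.mem_range.mp hj))),
    add_zero] at h1
  have h2 : a * (T - K * 5 ^ Module.finrank ℝ E) ≤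
      ((Finset.range n).filter fun i => ∀ k, σ < ‖pt i - μ k‖).card := by
    rw [Nat.mul_sub]; omega
  have h3 := Nat.mul_le_mul_right (T - K * 5 ^ Module.finrank ℝ E) h1
  have h4 := Nat.mul_le_mul_left (5 ^ Module.finrank ℝ E) h2
  rw [mul_assoc] at h3
  omega

end Invariant

end RealRAM

namespace FuzzyKMeans

/-! ### Estimates for the fuzzy cost. -/

variable {D N K m : ℕ} {X : Fin N → EuclideanSpace ℝ (Fin D)}
  {μ : Fin K → EuclideanSpace ℝ (Fin D)} {r : Fin N → Fin K → ℝ}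

theorem IsMembership.nonneg (hr : IsMembership r) (n : Fin N) (k : Fin K) : 0 ≤ r n k := (hr.1 n k).1

theorem IsMembership.term_nonneg (hr : IsMembership r) (n : Fin N) (k : Fin K) :
    0 ≤ r n k ^ m * ‖X n - μ k‖ ^ 2 :=
  mul_nonneg (pow_nonneg (hr.nonneg n k) m) (sq_nonneg _)

theorem cost_nonneg (hr : IsMembership r) : 0 ≤ cost X m μ r :=
  Finset.sum_nonneg fun n _ => Finset.sum_nonneg fun k _ => hr.term_nonneg n k

theorem inducedCost_le (hr : IsMembership r) : inducedCost X m μ ≤ cost X m μ r :=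
  csInf_le ⟨0, by rintro _ ⟨r', hr', rfl⟩; exact cost_nonneg hr'⟩ ⟨r, hr, rfl⟩

theorem optCost_le (hr : IsMembership r) : optCost X K m ≤ cost X m μ r :=
  csInf_le ⟨0, by rintro _ ⟨μ', r', hr', rfl⟩; exact cost_nonneg hr'⟩ ⟨μ, r, hr, rfl⟩

theorem optCost_nonneg : 0 ≤ optCost X K m :=
  Real.sInf_nonneg (by rintro _ ⟨μ', r', hr', rfl⟩; exact cost_nonneg hr')

theorem sum_le_cost (hr : IsMembership r) (J : Finset (Fin N)) :
    ∑ n ∈ J, ∑ k, r n k ^ m * ‖X n - μ k‖ ^ 2 ≤ cost X m μ r :=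
  Finset.sum_le_sum_of_subset_of_nonneg (Finset.subset_univ _) fun n _ _ =>
    Finset.sum_nonneg fun k _ => hr.term_nonneg n k

theorem IsMembership.exists_one_le (hr : IsMembership r) (n : Fin N) : ∃ k, 1 ≤ K * r n k := by
  by_contra! h
  have hK : (Finset.univ : Finset (Fin K)).Nonempty := by
    rw [Finset.nonempty_iff_ne_empty]
    intro h0
    have := hr.2 n
    rw [h0] at this
    simp at this
  have h1 : ∑ k, K * r n k < ∑ _k : Fin K, (1 : ℝ) := Finset.sum_lt_sum_of_nonempty hK fun k _ => h k
  rw [← Finset.mul_sum, hr.2 n] at h1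
  simp at h1

theorem IsMembership.exists_one_le_pow (hr : IsMembership r) (n : Fin N) (m : ℕ) :
    ∃ k, 1 ≤ (K : ℝ) ^ m * r n k ^ m := by
  obtain ⟨k, hk⟩ := hr.exists_one_le n
  exact ⟨k, by rw [← mul_pow]; exact one_le_pow₀ hk⟩

/-- At each point some membership is at least `1/K`, so a point at distance at least `σ` from all
means contributes at least `σ² / K^m`. -/
theorem card_far_mul_le (hr : IsMembership r) {σ : ℝ} (hσ : 0 ≤ σ) {J : Finset (Fin N)}
    (hJ : ∀ n ∈ J, ∀ k, σ ≤ ‖X n - μ k‖) : J.card * σ ^ 2 ≤ (K : ℝ) ^ m * cost X m μ r := by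
  calc (J.card : ℝ) * σ ^ 2 = ∑ n ∈ J, σ ^ 2 := by simp
    _ ≤ ∑ n ∈ J, (K : ℝ) ^ m * ∑ k, r n k ^ m * ‖X n - μ k‖ ^ 2 := by
      refine Finset.sum_le_sum fun n hn => ?_
      obtain ⟨k, hk⟩ := hr.exists_one_le_pow n m
      calc σ ^ 2 ≤ ‖X n - μ k‖ ^ 2 := by gcongr; exact hJ n hn k
        _ ≤ (K : ℝ) ^ m * r n k ^ m * ‖X n - μ k‖ ^ 2 := le_mul_of_one_le_left (sq_nonneg _) hk
        _ = (K : ℝ) ^ m * (r n k ^ m * ‖X n - μ k‖ ^ 2) := by ring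
        _ ≤ _ := by
          gcongr
          exact Finset.single_le_sum (f := fun k => r n k ^ m * ‖X n - μ k‖ ^ 2)
            (fun k _ => hr.term_nonneg n k) (Finset.mem_univ k)
    _ = (K : ℝ) ^ m * ∑ n ∈ J, ∑ k, r n k ^ m * ‖X n - μ k‖ ^ 2 := by rw [Finset.mul_sum]
    _ ≤ _ := by gcongr; exact sum_le_cost hr J

/-- `K + 1` points at mutual squared distance at least `R` force a large cost. -/
theorem le_cost_of_separated (hr : IsMembership r) {R : ℝ} (f : Fin (K + 1) → Fin N)
    (hf : ∀ i j, i ≠ j → R ≤ ‖X (f i) - X (f j)‖ ^ 2) :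
    R ≤ 2 * (K : ℝ) ^ m * cost X m μ r := by
  by_cases hR : R ≤ 0
  · exact hR.trans (mul_nonneg (by positivity) (cost_nonneg hr))
  choose κ hκ using fun n => hr.exists_one_le_pow n m
  -- Pigeonhole: among `K + 1` points two have the same mean as a mean of membership at least `1/K`.
  -- One of these two is far from it, since their mutual distance is large.
  obtain ⟨i, j, hij, e⟩ := Fintype.exists_ne_map_eq_of_card_lt (fun i => κ (f i)) (by simp)
  have hne : f i ≠ f j := by
    intro h
    have := hf i j hij
    rw [h, sub_self, norm_zero] at this
    exact hR (by simpa using this)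
  have hterm : ∀ n, ‖X n - μ (κ n)‖ ^ 2 ≤
      (K : ℝ) ^ m * ∑ k, r n k ^ m * ‖X n - μ k‖ ^ 2 := by
    intro n
    calc ‖X n - μ (κ n)‖ ^ 2 ≤ (K : ℝ) ^ m * r n (κ n) ^ m * ‖X n - μ (κ n)‖ ^ 2 :=
          le_mul_of_one_le_left (sq_nonneg _) (hκ n)
      _ = (K : ℝ) ^ m * (r n (κ n) ^ m * ‖X n - μ (κ n)‖ ^ 2) := by ring
      _ ≤ _ := by
        gcongr
        exact Finset.single_le_sum (f := fun k => r n k ^ m * ‖X n - μ k‖ ^ 2)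
          (fun k _ => hr.term_nonneg n k) (Finset.mem_univ (κ n))
  have h1 := hterm (f i)
  have h2 := hterm (f j)
  rw [← e] at h2
  have h3 := sum_le_cost (X := X) (m := m) (μ := μ) hr {f i, f j}
  rw [Finset.sum_pair hne] at h3
  have h4 := norm_sub_le_norm_sub_add_norm_sub (X (f i)) (μ (κ (f i))) (X (f j))
  rw [norm_sub_rev (μ (κ (f i)))] at h4
  have h5 : R ≤ 2 * (‖X (f i) - μ (κ (f i))‖ ^ 2 + ‖X (f j) - μ (κ (f i))‖ ^ 2) := by
    refine (hf i j hij).trans ?_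
    nlinarith [norm_nonneg (X (f i) - X (f j)),
      sq_nonneg (‖X (f i) - μ (κ (f i))‖ - ‖X (f j) - μ (κ (f i))‖)]
  have h6 := mul_le_mul_of_nonneg_left h3 (by positivity : (0 : ℝ) ≤ (K : ℝ) ^ m)
  linarith

theorem le_optCost_of_separated (hK : 1 ≤ K) {R : ℝ} (f : Fin (K + 1) → Fin N)
    (hf : ∀ i j, i ≠ j → R ≤ ‖X (f i) - X (f j)‖ ^ 2) :
    R ≤ 2 * (K : ℝ) ^ m * optCost X K m := by
  have hK' : (0 : ℝ) < K := by exact_mod_cast hK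
  have hpos : (0 : ℝ) < 2 * (K : ℝ) ^ m := by positivity
  rw [← div_le_iff₀' hpos, optCost]
  refine le_csInf ?_ ?_
  · refine ⟨_, 0, fun _ k => if k = ⟨0, hK⟩ then 1 else 0, ⟨fun n k => ?_, fun n => ?_⟩, rfl⟩
    · dsimp only; split_ifs <;> simp
    · simp
  · rintro _ ⟨μ, r, hr, rfl⟩
    rw [div_le_iff₀' hpos]
    exact le_cost_of_separated hr f hf

/-- Means close to all points yield a small cost. -/
theorem exists_membership_of_near (hm : m ≠ 0) {R : ℝ} (h : ∀ n, ∃ k, ‖X n - μ k‖ ^ 2 ≤ R) :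
    ∃ r : Fin N → Fin K → ℝ, IsMembership r ∧ cost X m μ r ≤ N * R := by
  choose κ hκ using h
  refine ⟨fun n k => if k = κ n then 1 else 0, ⟨fun n k => ?_, fun n => by simp⟩, ?_⟩
  · dsimp only; split_ifs <;> simp
  · calc cost X m μ (fun n k => if k = κ n then 1 else 0) = ∑ n, ‖X n - μ (κ n)‖ ^ 2 := by
          simp [cost, ite_pow, zero_pow hm]
      _ ≤ ∑ _n : Fin N, R := Finset.sum_le_sum fun n _ => hκ n
      _ = N * R := by simp

/-- Restricting the memberships to a set of means that carries almost all of the mass. -/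
theorem exists_restrict (hr : IsMembership r) (S : Finset (Fin K)) {θ : ℝ} (hm : 1 ≤ m)
    (hθ1 : θ < 1) (hS : ∀ n, 1 - θ / m ≤ ∑ k ∈ S, r n k) :
    ∃ r' : Fin N → Fin K → ℝ, IsMembership r' ∧ ∀ μ : Fin K → EuclideanSpace ℝ (Fin D),
      (1 - θ) * cost X m μ r' ≤ ∑ n, ∑ k ∈ S, r n k ^ m * ‖X n - μ k‖ ^ 2 := by
  have hm0 : (0 : ℝ) < m := by exact_mod_cast hm
  have hm1 : (1 : ℝ) ≤ m := by exact_mod_cast hm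
  have hθm : θ / m < 1 := by
    rw [div_lt_one hm0]; linarith
  have hpos : ∀ n, 0 < ∑ k ∈ S, r n k := fun n => by linarith [hS n]
  refine ⟨fun n k => if k ∈ S then r n k / ∑ k ∈ S, r n k else 0, ⟨fun n k => ?_, fun n => ?_⟩,
    fun μ => ?_⟩
  · dsimp only
    split_ifs with hk
    · refine ⟨div_nonneg (hr.nonneg n k) (hpos n).le, ?_⟩
      rw [div_le_one (hpos n)]
      exact Finset.single_le_sum (fun k _ => hr.nonneg n k) hk
    · simp
  · rw [← Finset.sum_filter, Finset.filter_mem_eq_inter, Finset.univ_inter, ← Finset.sum_div,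
      div_self (hpos n).ne']
  · rw [cost, Finset.mul_sum]
    refine Finset.sum_le_sum fun n _ => ?_
    -- Bernoulli's inequality bounds the `m`-th power of the remaining mass from below. This is why
    -- a loss of only `θ / m` per point is allowed.
    have hB : 1 - θ ≤ (∑ k ∈ S, r n k) ^ m := by
      have h1 := one_add_mul_le_pow (a := -(θ / m)) (by linarith) m
      have h2 : (1 + -(θ / m)) ^ m ≤ (∑ k ∈ S, r n k) ^ m := by
        gcongr
        · linarith
        · linarith [hS n]
      have h3 : (m : ℝ) * -(θ / m) = -θ := by field_simp
      linarith
    have e : ∑ k, (if k ∈ S then r n k / ∑ k ∈ S, r n k else 0) ^ m * ‖X n - μ k‖ ^ 2 =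
        (∑ k ∈ S, r n k ^ m * ‖X n - μ k‖ ^ 2) / (∑ k ∈ S, r n k) ^ m := by
      rw [Finset.sum_div, ← Finset.sum_subset (Finset.subset_univ S)]
      · refine Finset.sum_congr rfl fun k hk => ?_
        rw [if_pos hk, div_pow]; ring
      · intro k _ hk
        rw [if_neg hk, zero_pow (by omega), zero_mul]
    rw [e, mul_div_assoc', div_le_iff₀ (pow_pos (hpos n) m), mul_comm]
    exact mul_le_mul_of_nonneg_left hB (Finset.sum_nonneg fun k _ => hr.term_nonneg n k)

/-- Effect of moving the means. -/
theorem sum_perturb_le (hr : IsMembership r) (S : Finset (Fin K)) {β : ℝ} (hβ : 0 < β)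
    (g : Fin K → EuclideanSpace ℝ (Fin D)) :
    ∑ n, ∑ k ∈ S, r n k ^ m * ‖X n - g k‖ ^ 2 ≤ (1 + β) * cost X m μ r +
      (1 + β⁻¹) * ∑ k ∈ S, (∑ n, r n k ^ m) * ‖g k - μ k‖ ^ 2 := by
  -- Weighted arithmetic–geometric mean inequality: `2ab ≤ β a² + β⁻¹ b²`.
  have key : ∀ n k, ‖X n - g k‖ ^ 2 ≤ (1 + β) * ‖X n - μ k‖ ^ 2 + (1 + β⁻¹) * ‖g k - μ k‖ ^ 2 := by
    intro n k
    have h := norm_sub_le_norm_sub_add_norm_sub (X n) (μ k) (g k)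
    rw [norm_sub_rev (μ k)] at h
    set a := ‖X n - μ k‖
    set b := ‖g k - μ k‖
    have h1 : ‖X n - g k‖ ^ 2 ≤ (a + b) ^ 2 := by gcongr
    have h2 : 0 ≤ β⁻¹ * (β * a - b) ^ 2 := by positivity
    have h3 : β⁻¹ * (β * a - b) ^ 2 = β * a ^ 2 - 2 * a * b + β⁻¹ * b ^ 2 := by
      field_simp; ring
    nlinarith
  calc ∑ n, ∑ k ∈ S, r n k ^ m * ‖X n - g k‖ ^ 2
      ≤ ∑ n, ∑ k ∈ S, ((1 + β) * (r n k ^ m * ‖X n - μ k‖ ^ 2) +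
        (1 + β⁻¹) * (r n k ^ m * ‖g k - μ k‖ ^ 2)) := by
        refine Finset.sum_le_sum fun n _ => Finset.sum_le_sum fun k _ => ?_
        have := mul_le_mul_of_nonneg_left (key n k) (pow_nonneg (hr.nonneg n k) m)
        linarith
    _ = (1 + β) * ∑ n, ∑ k ∈ S, r n k ^ m * ‖X n - μ k‖ ^ 2 +
        (1 + β⁻¹) * ∑ n, ∑ k ∈ S, r n k ^ m * ‖g k - μ k‖ ^ 2 := by
        simp only [Finset.sum_add_distrib, ← Finset.mul_sum]
    _ ≤ _ := by
        have h1 : ∑ n, ∑ k ∈ S, r n k ^ m * ‖X n - μ k‖ ^ 2 ≤ cost X m μ r :=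
          Finset.sum_le_sum fun n _ => Finset.sum_le_sum_of_subset_of_nonneg
            (Finset.subset_univ _) fun k _ _ => hr.term_nonneg n k
        have h2 : ∑ n, ∑ k ∈ S, r n k ^ m * ‖g k - μ k‖ ^ 2 =
            ∑ k ∈ S, (∑ n, r n k ^ m) * ‖g k - μ k‖ ^ 2 := by
          rw [Finset.sum_comm]
          exact Finset.sum_congr rfl fun k _ => by rw [Finset.sum_mul]
        rw [h2]
        gcongr

open Classical in
/-- The ball around a mean contains at least half of its mass. -/
theorem mass_le_two_mul_card (hr : IsMembership r) (k : Fin K) {σ : ℝ} (hσ : 0 < σ)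
    (h : 2 * cost X m μ r ≤ (∑ n, r n k ^ m) * σ ^ 2) :
    ∑ n, r n k ^ m ≤ 2 * ((Finset.univ.filter fun n => ‖X n - μ k‖ ≤ σ).card : ℝ) := by
  -- Markov's inequality: inside the ball `r^m ≤ 1`, outside it `σ²` is below the squared distance.
  -- By hypothesis the cost accounts for at most half of the total mass times `σ²`.
  have h1 : ∑ n, r n k ^ m * σ ^ 2 ≤
      ∑ n, ((if ‖X n - μ k‖ ≤ σ then σ ^ 2 else 0) + r n k ^ m * ‖X n - μ k‖ ^ 2) := by
    refine Finset.sum_le_sum fun n _ => ?_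
    have h0 := pow_nonneg (hr.nonneg n k) m
    have h1 : r n k ^ m ≤ 1 := pow_le_one₀ (hr.nonneg n k) (hr.1 n k).2
    split_ifs with hn
    · have := hr.term_nonneg (X := X) (μ := μ) (m := m) n k
      nlinarith [sq_nonneg σ]
    · rw [zero_add]
      gcongr
      exact (not_le.mp hn).le
  have h2 : ∑ n, r n k ^ m * ‖X n - μ k‖ ^ 2 ≤ cost X m μ r :=
    Finset.sum_le_sum fun n _ => Finset.single_le_sum
      (f := fun k => r n k ^ m * ‖X n - μ k‖ ^ 2) (fun k _ => hr.term_nonneg n k)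
      (Finset.mem_univ k)
  rw [Finset.sum_add_distrib, ← Finset.sum_filter, Finset.sum_const, nsmul_eq_mul,
    ← Finset.sum_mul] at h1
  have h3 : (∑ n, r n k ^ m) * σ ^ 2 ≤
      2 * ((Finset.univ.filter fun n => ‖X n - μ k‖ ≤ σ).card : ℝ) * σ ^ 2 := by linarith
  exact le_of_mul_le_mul_right h3 (by positivity)

/-! ### The right scale and the approximation guarantee. -/

/-- Take the least `i` with `t ≤ 2^i σ`; minimality gives the upper bound. The spare factor `2` in
`2 * t ≤ τ` makes the index strictly smaller than `L`. -/
theorem exists_scale {σ t τ : ℝ} (h1 : σ ≤ t) (h2 : 2 * t ≤ τ) (ht : 0 < t) {L : ℕ}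
    (hL : ¬ 2 ^ L * σ < τ) : ∃ i < L, t ≤ 2 ^ i * σ ∧ 2 ^ i * σ ≤ 2 * t := by
  have hex : ∃ i : ℕ, t ≤ 2 ^ i * σ := ⟨L, by linarith [not_lt.mp hL]⟩
  classical
  have hspec := Nat.find_spec hex
  set i := Nat.find hex with hi
  have hle : 2 ^ i * σ ≤ 2 * t := by
    rcases Nat.eq_zero_or_pos i with h0 | h0
    · rw [h0]; simp; linarith
    · have := Nat.find_min hex (m := i - 1) (by omega)
      obtain ⟨j, hj⟩ : ∃ j, i = j + 1 := ⟨i - 1, by omega⟩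
      rw [hj] at this ⊢
      simp only [Nat.add_sub_cancel, not_le] at this
      rw [pow_succ]; linarith
  have hiL : i ≤ L := Nat.find_min' hex (by linarith [not_lt.mp hL])
  rcases hiL.lt_or_eq with h | h
  · exact ⟨i, h, hspec, hle⟩
  · obtain _ | L' := L
    · exfalso
      simp at hL
      linarith
    · have h3 := Nat.find_min hex (m := L') (by omega)
      rw [not_le] at h3
      rw [pow_succ] at hL
      linarith [not_lt.mp hL]

open RealRAM (minScale maxScale slotNum)

/-- Near-optimal solutions suffice for the approximation argument, so the infimum need not be shown
to be attained. -/
theorem exists_near_optimal (hK : 1 ≤ K) {c : ℝ} (hc : optCost X K m < c) :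
    ∃ (μ : Fin K → EuclideanSpace ℝ (Fin D)) (r : Fin N → Fin K → ℝ),
      IsMembership r ∧ cost X m μ r < c := by
  have hne : {c : ℝ | ∃ (μ : Fin K → EuclideanSpace ℝ (Fin D)) (r : Fin N → Fin K → ℝ),
      IsMembership r ∧ c = cost X m μ r}.Nonempty := by
    refine ⟨_, 0, fun _ k => if k = ⟨0, hK⟩ then 1 else 0, ⟨fun n k => ?_, fun n => ?_⟩, rfl⟩
    · dsimp only; split_ifs <;> simp
    · simp
  obtain ⟨_, ⟨μ, r, hr, rfl⟩, h⟩ := exists_lt_of_csInf_lt hne hc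
  exact ⟨μ, r, hr, h⟩

open Classical in
/-- At the right scale, the ball around a mean has enough points for the heavy-hitters algorithm. -/
theorem heavy_ball (hK : 1 ≤ K) (hm : 1 ≤ m) (hr : IsMembership r) (k : Fin K) {σ : ℝ}
    (hσ : 0 < σ) (hw : 0 < ∑ n, r n k ^ m)
    (h : 2 * cost X m μ r ≤ (∑ n, r n k ^ m) * σ ^ 2) :
    5 ^ D * (Finset.univ.filter fun n => ∀ k, σ < ‖X n - μ k‖).card <
      (Finset.univ.filter fun n => ‖X n - μ k‖ ≤ σ).card * (slotNum D K m - K * 5 ^ D) := by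
  set A := (Finset.univ.filter fun n => ∀ k, σ < ‖X n - μ k‖).card
  set B := (Finset.univ.filter fun n => ‖X n - μ k‖ ≤ σ).card with hB
  have h1 : ∑ n, r n k ^ m ≤ 2 * (B : ℝ) := mass_le_two_mul_card hr k hσ h
  have h2 : (A : ℝ) * σ ^ 2 ≤ (K : ℝ) ^ m * cost X m μ r :=
    card_far_mul_le hr hσ.le fun n hn k => ((Finset.mem_filter.mp hn).2 k).le
  have hBpos : 0 < B := by
    have : (0 : ℝ) < B := by linarith
    exact_mod_cast this
  -- The hypothesis and `h1` give `cost ≤ B σ²`, which is inserted into the bound for the far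
  -- points.
  have h3 : (A : ℝ) ≤ (K : ℝ) ^ m * B := by
    have : (A : ℝ) * σ ^ 2 ≤ (K : ℝ) ^ m * B * σ ^ 2 := by
      have hc : cost X m μ r ≤ B * σ ^ 2 := by nlinarith [sq_nonneg σ]
      calc (A : ℝ) * σ ^ 2 ≤ (K : ℝ) ^ m * cost X m μ r := h2
        _ ≤ (K : ℝ) ^ m * (B * σ ^ 2) := by gcongr
        _ = _ := by ring
    exact le_of_mul_le_mul_right this (by positivity)
  have h4 : A ≤ K ^ m * B := by exact_mod_cast h3
  have hKm : K ≤ K ^ m := Nat.le_self_pow (by omega) K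
  -- Origin of the `3` in `slotNum`: one of the three parts absorbs `K * 5 ^ D`, as `K ≤ K ^ m`. The
  -- remaining two exceed the one part needed, which makes the final inequality strict.
  have h5 : 2 * (5 ^ D * K ^ m) ≤ slotNum D K m - K * 5 ^ D := by
    have : K * 5 ^ D ≤ K ^ m * 5 ^ D := Nat.mul_le_mul_right _ hKm
    rw [slotNum]
    have e : 3 * 5 ^ D * K ^ m = 2 * (5 ^ D * K ^ m) + K ^ m * 5 ^ D := by ring
    omega
  have hP : 0 < 5 ^ D * K ^ m := by positivity
  calc 5 ^ D * A ≤ 5 ^ D * (K ^ m * B) := Nat.mul_le_mul_left _ h4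
    _ = B * (5 ^ D * K ^ m) := by ring
    _ < B * (2 * (5 ^ D * K ^ m)) := Nat.mul_lt_mul_of_pos_left (by omega) hBpos
    _ ≤ _ := Nat.mul_le_mul_left _ h5

open Classical in
/-- A set that contains a point near the center of every heavy ball contains good means. -/
theorem exists_good_means (hK : 1 ≤ K) (hm : 1 ≤ m) (hN : 1 ≤ N) {ε : ℝ} (hε : 0 < ε)
    (hε1 : ε ≤ 1) {R : ℝ} (hR : 0 < R) (hlow : R ≤ 2 * (K : ℝ) ^ m * optCost X K m)
    (hup : optCost X K m ≤ N * R) {L : ℕ} (hL : ¬ 2 ^ L * minScale N K m R < maxScale N K m ε R)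
    {G : Set (EuclideanSpace ℝ (Fin D))} (hne : G.Nonempty)
    (hG : ∀ i < L, ∀ (μ : Fin K → EuclideanSpace ℝ (Fin D)) (y : EuclideanSpace ℝ (Fin D)),
      5 ^ D * (Finset.univ.filter fun n => ∀ k, 2 ^ i * minScale N K m R < ‖X n - μ k‖).card <
      (Finset.univ.filter fun n => ‖X n - y‖ ≤ 2 ^ i * minScale N K m R).card *
        (slotNum D K m - K * 5 ^ D) →
      ∃ g ∈ G, ‖g - y‖ ≤ ε * (2 ^ i * minScale N K m R) / (32 * K)) :
    ∃ μ : Fin K → EuclideanSpace ℝ (Fin D), (∀ k, μ k ∈ G) ∧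
      inducedCost X m μ ≤ (1 + ε) * optCost X K m := by
  have hK0 : (0 : ℝ) < K := by exact_mod_cast hK
  have hK1 : (1 : ℝ) ≤ K := by exact_mod_cast hK
  have hm0 : (0 : ℝ) < m := by exact_mod_cast hm
  have hm1 : (1 : ℝ) ≤ m := by exact_mod_cast hm
  have hN0 : (0 : ℝ) < N := by exact_mod_cast hN
  have hN1 : (1 : ℝ) ≤ N := by exact_mod_cast hN
  set O := optCost X K m with hO
  have hOpos : 0 < O := by
    by_contra h
    have : 2 * (K : ℝ) ^ m * O ≤ 0 := mul_nonpos_of_nonneg_of_nonpos (by positivity) (not_lt.mp h)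
    linarith
  obtain ⟨μ, r, hr, hc⟩ := exists_near_optimal (X := X) (m := m) hK
    (c := (1 + ε / 10) * O) (by nlinarith)
  have hOc : O ≤ cost X m μ r := optCost_le hr
  set c := cost X m μ r with hcdef
  set δ := ε / (8 * m * K : ℕ) with hδ
  have hδ' : δ = ε / (8 * m * K) := by rw [hδ]; push_cast; ring
  have hδpos : 0 < δ := by rw [hδ']; positivity
  have hδ1 : δ ≤ 1 := by
    rw [hδ', div_le_one (by positivity)]
    nlinarith [mul_le_mul hm1 hK1 zero_le_one hm0.le]
  -- The means that have a membership above `δ` at some point. The others carry at most `K δ = ε /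
  -- (8m)` at each point, which is what `exists_restrict` can tolerate.
  set S : Finset (Fin K) := Finset.univ.filter fun k => ∃ n, δ < r n k with hS
  have hSmass : ∀ n, 1 - (ε / 8) / m ≤ ∑ k ∈ S, r n k := by
    intro n
    have h1 := Finset.sum_filter_add_sum_filter_not Finset.univ (fun k => ∃ n, δ < r n k)
      (fun k => r n k)
    rw [hr.2 n] at h1
    have h2 : ∑ k ∈ Finset.univ.filter (fun k => ¬ ∃ n, δ < r n k), r n k ≤
        ∑ _k : Fin K, δ := by
      refine (Finset.sum_le_sum fun k hk => ?_).trans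
        (Finset.sum_le_sum_of_subset_of_nonneg (Finset.filter_subset _ _) fun _ _ _ => hδpos.le)
      have := (Finset.mem_filter.mp hk).2
      push Not at this
      exact this n
    have h3 : ∑ _k : Fin K, δ = (ε / 8) / m := by
      simp [hδ']; field_simp
    rw [h3] at h2
    linarith
  have hgood : ∀ k ∈ S, ∃ g ∈ G,
      (∑ n, r n k ^ m) * ‖g - μ k‖ ^ 2 ≤ ε ^ 2 / (128 * K ^ 2) * c := by
    intro k hk
    obtain ⟨n₀, hn₀⟩ := (Finset.mem_filter.mp hk).2
    set w := ∑ n, r n k ^ m with hw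
    have hwlow : δ ^ m ≤ w :=
      (pow_le_pow_left₀ hδpos.le hn₀.le m).trans
        (Finset.single_le_sum (f := fun n => r n k ^ m)
          (fun n _ => pow_nonneg (hr.nonneg n k) m) (Finset.mem_univ n₀))
    have hwup : w ≤ N := by
      calc w ≤ ∑ _n : Fin N, (1 : ℝ) :=
            Finset.sum_le_sum fun n _ => pow_le_one₀ (hr.nonneg n k) (hr.1 n k).2
        _ = N := by simp
    have hδm : 0 < δ ^ m := pow_pos hδpos m
    have hwpos : 0 < w := hδm.trans_le hwlow
    have hcpos : 0 < c := hOpos.trans_le hOc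
    -- The ideal scale `√(2c/w)` is the smallest `σ` for which `2c ≤ w σ²`, the requirement of
    -- `heavy_ball`.
    have ht : 0 < √(2 * c / w) := Real.sqrt_pos.mpr (by positivity)
    have hsq : √(2 * c / w) ^ 2 = 2 * c / w := Real.sq_sqrt (by positivity)
    have hRs : √R ^ 2 = R := Real.sq_sqrt hR.le
    -- The smallest scale is small enough because `w ≤ N` and `R ≤ 2 K^m c`.
    have h1 : minScale N K m R ≤ √(2 * c / w) := by
      refine Real.le_sqrt_of_sq_le ?_
      rw [minScale, div_pow, hRs, div_le_div_iff₀ (by positivity) hwpos]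
      push_cast
      have hKm : (1 : ℝ) ≤ (K : ℝ) ^ m := one_le_pow₀ hK1
      calc R * w ≤ (2 * (K : ℝ) ^ m * c) * N := by
            gcongr
            exact hlow.trans (by gcongr)
        _ = 2 * c * (N * (K : ℝ) ^ m) * 1 := by ring
        _ ≤ 2 * c * (N * (K : ℝ) ^ m) * (N * (K : ℝ) ^ m) := by
            gcongr
            exact one_le_mul_of_one_le_of_one_le hN1 hKm
        _ = 2 * c * (N * (K : ℝ) ^ m) ^ 2 := by ring
    -- The largest scale is large enough because `w ≥ δ^m` and `c ≤ 2 N R`.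
    have h2 : 2 * √(2 * c / w) ≤ maxScale N K m ε R := by
      have hmax : 0 ≤ maxScale N K m ε R := by rw [maxScale]; positivity
      rw [← sq_le_sq₀ (by positivity) hmax, maxScale, ← hδ, mul_pow, hsq, div_pow, mul_pow, hRs]
      have hc2 : c ≤ 2 * (N * R) := by
        have : ε / 10 * O ≤ 1 * O := by gcongr; linarith
        linarith
      have hδm1 : δ ^ m ≤ 1 := pow_le_one₀ hδpos.le hδ1
      push_cast
      calc 2 ^ 2 * (2 * c / w) ≤ 2 ^ 2 * (2 * (2 * (N * R)) / δ ^ m) := by gcongr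
        _ = 16 * (N * R) * 1 / δ ^ m := by ring
        _ ≤ 16 * (N * R) * (N / δ ^ m) / δ ^ m := by
            gcongr
            rw [one_le_div hδm]; linarith
        _ = (4 * N) ^ 2 * R / (δ ^ m) ^ 2 := by field_simp; ring
    obtain ⟨i, hi, hti, hit⟩ := exists_scale h1 h2 ht hL
    set σ := 2 ^ i * minScale N K m R with hσ
    have hσpos : 0 < σ := ht.trans_le hti
    have hσ2 : 2 * c / w ≤ σ ^ 2 := by rw [← hsq]; gcongr
    have hσ3 : σ ^ 2 ≤ 8 * c / w := by
      calc σ ^ 2 ≤ (2 * √(2 * c / w)) ^ 2 := by gcongr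
        _ = 4 * (2 * c / w) := by rw [mul_pow, hsq]; norm_num
        _ = 8 * c / w := by ring
    obtain ⟨g, hg, hgy⟩ := hG i hi μ (μ k) (heavy_ball hK hm hr k hσpos hwpos (by
      rw [div_le_iff₀ hwpos] at hσ2; linarith))
    refine ⟨g, hg, ?_⟩
    calc w * ‖g - μ k‖ ^ 2 ≤ w * (ε * σ / (32 * K)) ^ 2 := by gcongr
      _ = w * (ε ^ 2 / (1024 * K ^ 2)) * σ ^ 2 := by ring
      _ ≤ w * (ε ^ 2 / (1024 * K ^ 2)) * (8 * c / w) := by gcongr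
      _ = ε ^ 2 / (128 * K ^ 2) * c := by field_simp; norm_num
  obtain ⟨g₀, hg₀⟩ := hne
  -- Means outside `S` receive memberships zero, so any point of `G` may represent them.
  have hgood' : ∀ k, ∃ g ∈ G, k ∈ S →
      (∑ n, r n k ^ m) * ‖g - μ k‖ ^ 2 ≤ ε ^ 2 / (128 * K ^ 2) * c := by
    intro k
    by_cases hk : k ∈ S
    · obtain ⟨g, hg, h⟩ := hgood k hk
      exact ⟨g, hg, fun _ => h⟩
    · exact ⟨g₀, hg₀, fun h => absurd h hk⟩
  choose g hgG hg using hgood'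
  refine ⟨g, hgG, ?_⟩
  obtain ⟨r', hr', hcost⟩ := exists_restrict (X := X) hr S (θ := ε / 8) hm (by linarith) hSmass
  -- With `β = ε/10`, moving the means adds at most `ε/10 * c` from the factor `1 + β` and, by `h1`,
  -- at most `ε/10 * c` from the displacements.
  have hmove := sum_perturb_le (X := X) (m := m) (μ := μ) hr S (β := ε / 10) (by positivity) g
  have hsum : ∑ k ∈ S, (∑ n, r n k ^ m) * ‖g k - μ k‖ ^ 2 ≤ ε ^ 2 / 128 * c := by
    calc ∑ k ∈ S, (∑ n, r n k ^ m) * ‖g k - μ k‖ ^ 2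
        ≤ ∑ k ∈ S, ε ^ 2 / (128 * K ^ 2) * c := Finset.sum_le_sum fun k hk => hg k hk
      _ = S.card * (ε ^ 2 / (128 * K ^ 2) * c) := by simp
      _ ≤ K * (ε ^ 2 / (128 * K ^ 2) * c) := by
        gcongr
        · exact mul_nonneg (by positivity) (hOpos.le.trans hOc)
        · simpa using Finset.card_le_univ S
      _ = ε ^ 2 / 128 * c / K := by field_simp
      _ ≤ ε ^ 2 / 128 * c := div_le_self (mul_nonneg (by positivity) (hOpos.le.trans hOc)) hK1
  have h1 : (1 + (ε / 10)⁻¹) * ∑ k ∈ S, (∑ n, r n k ^ m) * ‖g k - μ k‖ ^ 2 ≤ ε / 10 * c := by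
    calc (1 + (ε / 10)⁻¹) * ∑ k ∈ S, (∑ n, r n k ^ m) * ‖g k - μ k‖ ^ 2
        ≤ (1 + (ε / 10)⁻¹) * (ε ^ 2 / 128 * c) := by gcongr
      _ = (ε + 10) * ε / 128 * c := by field_simp
      _ ≤ ε / 10 * c := by
        have := hOpos.le.trans hOc
        gcongr ?_ * _
        nlinarith
  have h2 := hcost g
  have h3 : (1 - ε / 8) * cost X m g r' ≤ (1 + ε / 5) * ((1 + ε / 10) * O) := by
    calc (1 - ε / 8) * cost X m g r' ≤ (1 + ε / 5) * c := by linarith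
      _ ≤ _ := by gcongr
  refine (inducedCost_le hr').trans ?_
  -- The total budget: displacement `1 + ε/5`, near-optimality `1 + ε/10` and renormalization `1/(1
  -- - ε/8)` together stay below `1 + ε`.
  have h4 : (1 + ε / 5) * ((1 + ε / 10) * O) ≤ (1 - ε / 8) * ((1 + ε) * O) := by
    have : (1 + ε / 5) * (1 + ε / 10) ≤ (1 - ε / 8) * (1 + ε) := by nlinarith
    nlinarith
  exact le_of_mul_le_mul_left (h3.trans h4) (by linarith)

end FuzzyKMeans

namespace RealRAM

/-! ### Bounds for the running time and for the size. -/

/-- Every monomial of the running time is a product of factors bounded by `N`, `K`, `D` and the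
number `W` of diagonal points. The last bound applies to `m`, the mesh parameter and all multiples
of `L`. The sum of the coefficients is below `300`. -/
theorem candidateTime_le {N D K m L : ℕ} {ε : ℝ} (hN : 1 ≤ N) (hD : 1 ≤ D) (hK : 1 ≤ K) :
    candidateTime N D K m ε L ≤ 300 * (N * K * D * padSize D K m ε L) := by
  set q := meshNum D K ε with hq
  set T := slotNum D K m with hT
  set M := (q + 1) ^ D with hM
  have hT1 : 1 ≤ T := by
    have : 0 < T := by rw [hT, slotNum]; positivity
    exact this
  have hM1 : 1 ≤ M := Nat.one_le_pow _ _ (by omega)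
  set W := padSize D K m ε L with hW
  have hWe : W = K + L * (T * M) + m + q := by rw [hW, padSize, coreSize]
  have hWT : L * (T * M) ≤ W := by omega
  have hWT' : L * T ≤ W := (Nat.mul_le_mul_left L (Nat.le_mul_of_pos_right T hM1)).trans hWT
  have hWL : L ≤ W := (Nat.le_mul_of_pos_right L hT1).trans hWT'
  have hWm : m ≤ W := by omega
  have hWq : q ≤ W := by omega
  have hW1 : 1 ≤ W := by omega
  set U := N * K * D * W with hU
  have key : ∀ a b c d : ℕ, a ≤ N → b ≤ K → c ≤ D → d ≤ W → a * b * c * d ≤ U := by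
    intro a b c d ha hb hc hd
    exact Nat.mul_le_mul (Nat.mul_le_mul (Nat.mul_le_mul ha hb) hc) hd
  have e1 := key N 1 D 1 le_rfl hK le_rfl hW1
  have e2 := key N K D 1 le_rfl le_rfl le_rfl hW1
  have e3 := key N K 1 1 le_rfl le_rfl hD hW1
  have e4 := key 1 K D 1 hN le_rfl le_rfl hW1
  have e5 := key 1 K 1 1 hN le_rfl hD hW1
  have e6 := key 1 1 1 q hN hK hD hWq
  have e7 := key 1 1 D 1 hN hK le_rfl hW1
  have e8 := key 1 1 1 m hN hK hD hWm
  have e9 := key 1 1 1 1 hN hK hD hW1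
  have e10 := key N 1 D (L * T) le_rfl hK le_rfl hWT'
  have e11 := key N 1 1 (L * T) le_rfl hK hD hWT'
  have e12 := key N 1 1 L le_rfl hK hD hWL
  have e13 := key 1 1 1 (L * T) hN hK hD hWT'
  have e14 := key 1 1 D (L * (T * M)) hN hK le_rfl hWT
  have e15 := key 1 1 D (L * T) hN hK le_rfl hWT'
  have e16 := key 1 1 1 L hN hK hD hWL
  have e17 := key 1 1 D W hN hK le_rfl le_rfl
  have e18 := key 1 1 1 W hN hK hD le_rfl
  have e : candidateTime N D K m ε L = 5 * (N * 1 * D * 1) + 9 * (N * K * D * 1) +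
      16 * (N * K * 1 * 1) + 6 * (1 * K * D * 1) + 13 * (1 * K * 1 * 1) + 3 * (1 * 1 * 1 * q) +
      4 * (1 * 1 * D * 1) + 4 * (1 * 1 * 1 * m) + 58 * (1 * 1 * 1 * 1) +
      9 * (N * 1 * D * (L * T)) + 20 * (N * 1 * 1 * (L * T)) + 16 * (N * 1 * 1 * L) +
      20 * (1 * 1 * 1 * (L * T)) + 13 * (1 * 1 * D * (L * (T * M))) + 11 * (1 * 1 * D * (L * T)) +
      14 * (1 * 1 * 1 * L) + 4 * (1 * 1 * D * W) + 7 * (1 * 1 * 1 * W) := by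
    rw [candidateTime, levelTime, ← hq, ← hT, ← hM, ← hW]
    ring
  omega

/-- For `R = 0` both scales vanish and the loop is never entered; otherwise doubling a positive
number eventually exceeds the bound. -/
theorem exists_levels {N K m : ℕ} {ε R : ℝ} (hN : 1 ≤ N) (hK : 1 ≤ K) (hR : 0 ≤ R) :
    ∃ L : ℕ, (∀ i < L, 2 ^ i * minScale N K m R < maxScale N K m ε R) ∧
      ¬ 2 ^ L * minScale N K m R < maxScale N K m ε R := by
  classical
  have hex : ∃ L : ℕ, ¬ 2 ^ L * minScale N K m R < maxScale N K m ε R := by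
    rcases hR.eq_or_lt with h | h
    · exact ⟨0, by simp [minScale, maxScale, ← h]⟩
    · have hs : 0 < minScale N K m R := by
        rw [minScale]
        have : 0 < N * K ^ m := by positivity
        have : (0 : ℝ) < (N * K ^ m : ℕ) := by exact_mod_cast this
        positivity
      obtain ⟨L, hL⟩ := pow_unbounded_of_one_lt (maxScale N K m ε R / minScale N K m R)
        (one_lt_two)
      rw [div_lt_iff₀ hs] at hL
      exact ⟨L, hL.not_gt⟩
  exact ⟨Nat.find hex, fun i hi => not_not.mp (Nat.find_min hex hi), Nat.find_spec hex⟩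

theorem log_two_gt_half : (1 / 2 : ℝ) < Real.log 2 := by
  have := Real.log_two_gt_d9
  linarith

/-- The quotient of the largest and the smallest scale is `4 N² (8 m K² / ε)^m`, bounded by `N^4
(mK/ε)^(5m)`. Its logarithm is a sum, which becomes the product in the claim because both logarithms
are at least `log 2`. -/
theorem levels_le {N K m L : ℕ} {ε R : ℝ} (hN : 2 ≤ N) (hK : 1 ≤ K) (hm : 2 ≤ m) (hε : 0 < ε)
    (hε1 : ε ≤ 1) (hR : 0 ≤ R)
    (hL : ∀ i < L, 2 ^ i * minScale N K m R < maxScale N K m ε R) :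
    (L : ℝ) ≤ 30 * (m * Real.log (m * K / ε) * Real.log N) := by
  have hN2 : (2 : ℝ) ≤ N := by exact_mod_cast hN
  have hK1 : (1 : ℝ) ≤ K := by exact_mod_cast hK
  have hm2 : (2 : ℝ) ≤ m := by exact_mod_cast hm
  have h2 := log_two_gt_half
  have hy : 2 ≤ m * K / ε := by
    rw [le_div_iff₀ hε]; nlinarith
  have hℓ : Real.log 2 ≤ Real.log (m * K / ε) := Real.log_le_log (by norm_num) hy
  have hlg : Real.log 2 ≤ Real.log N := Real.log_le_log (by norm_num) hN2
  set ℓ := Real.log (m * K / ε) with hℓdef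
  set lam := Real.log N with hlam
  have hmℓ : 1 ≤ m * ℓ := by nlinarith
  have hΛ : 1 / 2 ≤ m * ℓ * lam := by nlinarith
  rcases Nat.eq_zero_or_pos L with h0 | hpos
  · rw [h0]; push_cast; linarith
  obtain ⟨L', rfl⟩ : ∃ L', L = L' + 1 := ⟨L - 1, by omega⟩
  have h := hL L' (by omega)
  have hRpos : 0 < √R := by
    rw [Real.sqrt_pos]
    rcases hR.eq_or_lt with h' | h'
    · rw [minScale, maxScale, ← h'] at h; simp at h
    · exact h'
  have hδe : ((8 * m * K : ℕ) : ℝ) = 8 * m * K := by push_cast; ring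
  have hpow : (2 : ℝ) ^ L' ≤ (N : ℝ) ^ 4 * ((m * K / ε) ^ 5) ^ m := by
    have hδ : 0 < ε / (8 * m * K) := by positivity
    rw [minScale, maxScale, hδe] at h
    push_cast at h
    have h1 : (2 : ℝ) ^ L' < 4 * N * √R / (ε / (8 * m * K)) ^ m * (N * K ^ m / √R) := by
      rw [← mul_div_assoc, div_lt_iff₀ (by positivity)] at h
      calc (2 : ℝ) ^ L' = 2 ^ L' * √R / √R := by field_simp
        _ < 4 * N * √R / (ε / (8 * m * K)) ^ m * (N * K ^ m) / √R := by gcongr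
        _ = _ := by ring
    have h2 : 4 * N * √R / (ε / (8 * m * K)) ^ m * (N * K ^ m / √R) =
        4 * N ^ 2 * (8 * (m * K / ε * K)) ^ m := by
      simp only [mul_pow, div_pow]
      field_simp
    rw [h2] at h1
    refine h1.le.trans ?_
    have h4 : (4 : ℝ) * N ^ 2 ≤ N ^ 4 := by
      have h6 : (4 : ℝ) ≤ N ^ 2 := by nlinarith
      calc (4 : ℝ) * N ^ 2 ≤ N ^ 2 * N ^ 2 := by gcongr
        _ = (N : ℝ) ^ 4 := by ring
    -- With `y = mK/ε`, both `2 ≤ y` and `K ≤ y`, so the `8` is absorbed by `y ^ 3`.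
    have h5 : 8 * (m * K / ε * K) ≤ (m * K / ε) ^ 5 := by
      set y := m * K / ε with hydef
      have hKy : (K : ℝ) ≤ y := by
        rw [hydef, le_div_iff₀ hε]; nlinarith
      calc 8 * (y * K) ≤ 2 ^ 3 * (y * y) := by
            have : y * K ≤ y * y := by gcongr
            linarith
        _ ≤ y ^ 3 * (y * y) := by gcongr
        _ = y ^ 5 := by ring
    gcongr
  have hlog := Real.log_le_log (by positivity) hpow
  rw [Real.log_mul (by positivity) (by positivity), Real.log_pow, Real.log_pow, Real.log_pow,
    Real.log_pow, ← hℓdef, ← hlam] at hlog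
  push_cast at hlog ⊢
  have hL'0 : (0 : ℝ) ≤ L' := Nat.cast_nonneg _
  have hlam1 : lam ≤ m * ℓ * lam := le_mul_of_one_le_left (by linarith) hmℓ
  have hℓ2 : m * ℓ ≤ 2 * (m * ℓ * lam) := by nlinarith
  nlinarith

set_option maxHeartbeats 400000 in
-- The main term is `L * T * (q + 1)^D`, with `K`-dependence `K^(m + D)`; the remaining terms are
-- absorbed using the lower bounds for the logarithms.
theorem size_le {N D K m L : ℕ} {ε R : ℝ} (hN : 2 ≤ N) (hD : 1 ≤ D) (hK : 1 ≤ K) (hm : 2 ≤ m)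
    (hε : 0 < ε) (hε1 : ε ≤ 1) (hR : 0 ≤ R)
    (hL : ∀ i < L, 2 ^ i * minScale N K m R < maxScale N K m ε R) :
    ((coreSize D K m ε L + padSize D K m ε L : ℕ) : ℝ) ≤ 500 * (650 * D) ^ D *
      ((K : ℝ) ^ (m * D + 1) * (ε⁻¹) ^ D * (m : ℝ) *
        Real.log ((m : ℝ) * (K : ℝ) / ε) * Real.log (N : ℝ)) := by
  have hLle := levels_le hN hK hm hε hε1 hR hL
  have hN2 : (2 : ℝ) ≤ N := by exact_mod_cast hN
  have hK1 : (1 : ℝ) ≤ K := by exact_mod_cast hK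
  have hD1 : (1 : ℝ) ≤ D := by exact_mod_cast hD
  have hm2 : (2 : ℝ) ≤ m := by exact_mod_cast hm
  have h2 := log_two_gt_half
  have hy : 2 ≤ m * K / ε := by
    rw [le_div_iff₀ hε]; nlinarith
  have hℓ : Real.log 2 ≤ Real.log (m * K / ε) := Real.log_le_log (by norm_num) hy
  have hlg : Real.log 2 ≤ Real.log N := Real.log_le_log (by norm_num) hN2
  set ℓ := Real.log (m * K / ε) with hℓdef
  set lam := Real.log N with hlam
  set Λ := m * ℓ * lam with hΛdef
  have hmℓ : 1 ≤ m * ℓ := by nlinarith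
  have hΛ : 1 / 2 ≤ Λ := by nlinarith
  have hmΛ : (m : ℝ) ≤ 4 * Λ := by
    have : 1 ≤ 4 * (ℓ * lam) := by nlinarith
    rw [hΛdef]; nlinarith
  have hεi : 1 ≤ ε⁻¹ := (one_le_inv₀ hε).mpr hε1
  set B := (K : ℝ) ^ (m * D + 1) * (ε⁻¹) ^ D with hB
  have hKB : (K : ℝ) ≤ (K : ℝ) ^ (m * D + 1) := le_self_pow₀ hK1 (by omega)
  have hεB : ε⁻¹ ≤ (ε⁻¹) ^ D := le_self_pow₀ hεi (by omega)
  have hKεB : K * ε⁻¹ ≤ B := by rw [hB]; gcongr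
  have hB1 : 1 ≤ B := by nlinarith
  have hKB' : (K : ℝ) ≤ B := by nlinarith
  set C : ℝ := (650 * D) ^ D with hC
  have hC1 : 650 * (D : ℝ) ≤ C := le_self_pow₀ (by linarith) (by omega)
  set q := meshNum D K ε with hq
  have hqle : (q : ℝ) + 1 ≤ 130 * D * (K * ε⁻¹) := by
    have h1 : (q : ℝ) < (128 * D * K : ℕ) / ε + 1 := Nat.ceil_lt_add_one (by positivity)
    push_cast at h1
    have h3 : 1 ≤ D * (K * ε⁻¹) := one_le_mul_of_one_le_of_one_le hD1
      (one_le_mul_of_one_le_of_one_le hK1 hεi)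
    have h4 : 128 * D * K / ε = 128 * (D * (K * ε⁻¹)) := by rw [div_eq_mul_inv]; ring
    rw [h4] at h1
    nlinarith
  have hTQ : ((slotNum D K m * (q + 1) ^ D : ℕ) : ℝ) ≤ 3 * C * B := by
    rw [slotNum]
    push_cast
    calc (3 * 5 ^ D * (K : ℝ) ^ m) * ((q : ℝ) + 1) ^ D
        ≤ (3 * 5 ^ D * (K : ℝ) ^ m) * (130 * D * (K * ε⁻¹)) ^ D := by gcongr
      _ = 3 * (650 * D) ^ D * ((K : ℝ) ^ (m + D) * (ε⁻¹) ^ D) := by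
        rw [pow_add, show (650 * D : ℝ) = 5 * (130 * D) by ring, mul_pow 5, mul_pow (130 * (D : ℝ)),
          mul_pow (K : ℝ)]
        ring
      _ ≤ 3 * (650 * D) ^ D * ((K : ℝ) ^ (m * D + 1) * (ε⁻¹) ^ D) := by
        -- This is `(m - 1)(D - 1) ≥ 0`.
        have : m + D ≤ m * D + 1 := by nlinarith
        gcongr
  have hcore : ((L * (slotNum D K m * (q + 1) ^ D) : ℕ) : ℝ) ≤ 90 * C * (B * Λ) := by
    rw [Nat.cast_mul]
    calc (L : ℝ) * ((slotNum D K m * (q + 1) ^ D : ℕ) : ℝ) ≤ (30 * Λ) * (3 * C * B) := by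
          gcongr
      _ = _ := by ring
  have hF : B ≤ 2 * (B * Λ) := by nlinarith
  have hmF : (m : ℝ) ≤ 4 * (B * Λ) := by nlinarith
  have hqF : (q : ℝ) ≤ 130 * D * (2 * (B * Λ)) := by
    calc (q : ℝ) ≤ 130 * D * (K * ε⁻¹) := by linarith
      _ ≤ 130 * D * (2 * (B * Λ)) := by
        exact mul_le_mul_of_nonneg_left (hKεB.trans hF) (by positivity)
  have hF0 : 0 ≤ B * Λ := by positivity
  have hDF : D * (B * Λ) ≤ C * (B * Λ) := by
    gcongr; linarith
  have hCF : 650 * (B * Λ) ≤ C * (B * Λ) := by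
    gcongr; nlinarith
  have eF : (K : ℝ) ^ (m * D + 1) * (ε⁻¹) ^ D * (m : ℝ) * ℓ * lam = B * Λ := by
    rw [hB, hΛdef]; ring
  have hsum : ((coreSize D K m ε L + padSize D K m ε L : ℕ) : ℝ) =
      2 * K + 2 * ((L * (slotNum D K m * (q + 1) ^ D) : ℕ) : ℝ) + m + q := by
    rw [padSize, coreSize, ← hq]
    push_cast
    ring
  have hKF : (K : ℝ) ≤ 2 * (B * Λ) := hKB'.trans hF
  rw [eF, hsum]
  linarith

end RealRAM

namespace FuzzyKMeans

open RealRAM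

/-! ### From memory contents to Euclidean space. -/

/-- The point with coordinates `v 0, …, v (D - 1)`. -/
def point (D : ℕ) (v : ℕ → ℝ) : EuclideanSpace ℝ (Fin D) := WithLp.toLp 2 fun i : Fin D => v i

/-- Coordinate `i` of data point `n`. -/
def coords {D N : ℕ} (X : Fin N → EuclideanSpace ℝ (Fin D)) (n i : ℕ) : ℝ :=
  if h : n < N ∧ i < D then X ⟨n, h.1⟩ ⟨i, h.2⟩ else 0

theorem point_coords {D N : ℕ} (X : Fin N → EuclideanSpace ℝ (Fin D)) (n : Fin N) :
    point D (coords X n) = X n := by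
  ext i
  simp [point, coords]

theorem sqDist_eq (D : ℕ) (x : ℕ → ℕ → ℝ) (n p : ℕ) :
    sqDist D x n p = ‖point D (x n) - point D (x p)‖ ^ 2 := by
  rw [EuclideanSpace.norm_sq_eq, sqDist, Finset.sum_range]
  simp [point]

theorem sqDist_coords {D N : ℕ} (X : Fin N → EuclideanSpace ℝ (Fin D)) (n p : Fin N) :
    sqDist D (coords X) n p = ‖X n - X p‖ ^ 2 := by
  rw [sqDist_eq, point_coords, point_coords]

/-- The points listed in the memory. -/
def listed (D : ℕ) (s : State) (o l : ℕ) : Set (EuclideanSpace ℝ (Fin D)) :=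
  Set.range fun g : Fin l => point D fun i => s.real (o + g * D + i)

theorem point_mem_listed {D o l : ℕ} {s : State} {v : ℕ → ℝ} (h : Lists D o s l v) :
    point D v ∈ listed D s o l := by
  obtain ⟨g, hg, H⟩ := h
  refine ⟨⟨g, hg⟩, ?_⟩
  ext i
  exact H i i.2

/-- The factor `D` instead of `√D` avoids a root in the mesh parameter and only affects the constant
depending on `D`. -/
theorem norm_le_of_coord_le {D : ℕ} {z : EuclideanSpace ℝ (Fin D)} {h : ℝ} (hh : 0 ≤ h)
    (hz : ∀ i, |z i| ≤ h) : ‖z‖ ≤ D * h := by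
  rw [EuclideanSpace.norm_eq]
  refine Real.sqrt_le_iff.mpr ⟨by positivity, ?_⟩
  calc ∑ i, ‖z i‖ ^ 2 ≤ ∑ _i : Fin D, h ^ 2 := Finset.sum_le_sum fun i _ => by
        rw [Real.norm_eq_abs]
        exact pow_le_pow_left₀ (abs_nonneg _) (hz i) 2
    _ = D * h ^ 2 := by simp
    _ ≤ (D * D : ℝ) * h ^ 2 := by
        gcongr
        exact_mod_cast Nat.le_mul_self D
    _ = (D * h) ^ 2 := by ring

/-- Round each coordinate of `y` down to the grid. The target lies in the cube of side `4σ = q h`,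
so the index is at most `q`, and the error per coordinate is at most one mesh width `h`. -/
theorem exists_gridPoint_near {D q : ℕ} (hq : 0 < q) {σ : ℝ} (hσ : 0 < σ) {p : ℕ → ℝ}
    {y : EuclideanSpace ℝ (Fin D)} (hy : ‖point D p - y‖ ≤ 2 * σ) :
    ∃ v : ℕ → ℕ, (∀ l < D, v l < q + 1) ∧
      ‖point D (gridPoint p (σ + σ) ((σ + σ + (σ + σ)) / q) v) - y‖ ≤ D * (4 * σ / q) := by
  have hq0 : (0 : ℝ) < q := by exact_mod_cast hq
  have he : (σ + σ + (σ + σ)) / q = 4 * σ / q := by ring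
  rw [he]
  set h := 4 * σ / q with hh
  have hpos : 0 < h := by positivity
  have hqh : q * h = 4 * σ := by rw [hh]; field_simp
  have hz : ∀ i : Fin D, |p i - y i| ≤ 2 * σ := fun i =>
    (PiLp.norm_apply_le (point D p - y) i).trans hy
  refine ⟨fun l => if hl : l < D then ⌊(y ⟨l, hl⟩ - p l + 2 * σ) / h⌋₊ else 0, fun l hl => ?_, ?_⟩
  · have h1 := abs_le.mp (hz ⟨l, hl⟩)
    simp only [hl, dite_true]
    refine Nat.lt_succ_of_le (Nat.floor_le_of_le ?_)
    rw [div_le_iff₀ hpos, hqh]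
    dsimp only at h1
    linarith [h1.1]
  · refine norm_le_of_coord_le hpos.le fun i => ?_
    have h1 := abs_le.mp (hz i)
    set w := (y i - p i + 2 * σ) / h with hw
    have hwh : w * h = y i - p i + 2 * σ := by rw [hw]; field_simp
    have hw0 : 0 ≤ w := div_nonneg (by linarith [h1.2]) hpos.le
    have hf := Nat.floor_le hw0
    have hf' := Nat.lt_floor_add_one w
    have e : (point D (gridPoint p (σ + σ) h fun l =>
        if hl : l < D then ⌊(y ⟨l, hl⟩ - p l + 2 * σ) / h⌋₊ else 0) - y) i =
        ((⌊w⌋₊ : ℝ) - w) * h := by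
      simp only [point, gridPoint, PiLp.sub_apply, i.2, dite_true, Fin.eta, ← hw, sub_mul, hwh]
      ring
    rw [e, abs_mul, abs_of_pos hpos]
    refine mul_le_of_le_one_left hpos.le (abs_le.mpr ⟨by linarith, by linarith⟩)

theorem meshNum_pos {D K : ℕ} {ε : ℝ} (hD : 1 ≤ D) (hK : 1 ≤ K) (hε : 0 < ε) :
    0 < meshNum D K ε := by
  have : 0 < 128 * D * K := by positivity
  have : (0 : ℝ) < (128 * D * K : ℕ) := by exact_mod_cast this
  exact Nat.ceil_pos.mpr (by positivity)

/-- The `128` in `meshNum` is `4 * 32`: the side `4σ` of the cube against the accuracy `ε σ / (32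
K)` required by `exists_good_means`. -/
theorem mesh_le {D K : ℕ} {ε σ : ℝ} (hD : 1 ≤ D) (hK : 1 ≤ K) (hε : 0 < ε) (hσ : 0 ≤ σ) :
    D * (4 * σ / meshNum D K ε) ≤ ε * σ / (32 * K) := by
  have hq : (0 : ℝ) < meshNum D K ε := by exact_mod_cast meshNum_pos hD hK hε
  have hK0 : (0 : ℝ) < K := by exact_mod_cast hK
  have h : (128 * D * K : ℕ) / ε ≤ meshNum D K ε := Nat.le_ceil _
  push_cast at h
  rw [div_le_iff₀ hε] at h
  rw [mul_div_assoc', div_le_div_iff₀ hq (by positivity)]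
  calc D * (4 * σ) * (32 * K) = (128 * D * K) * σ := by ring
    _ ≤ meshNum D K ε * ε * σ := by gcongr
    _ = ε * σ * meshNum D K ε := by ring

theorem card_filter_range {N : ℕ} (p : ℕ → Prop) [DecidablePred p] :
    ((Finset.range N).filter p).card = (Finset.univ.filter fun n : Fin N => p n).card := by
  rw [Finset.card_filter, Finset.card_filter, Finset.sum_range]

open Classical in
-- Joins the two halves: the heavy hitters provide a representative within `2σ` of `y`, and its grid
-- provides a point at the required accuracy.
theorem _root_.RealRAM.CoversScale.exists_near {D N K m o l : ℕ} {ε σ : ℝ} {X : Fin N → EuclideanSpace ℝ (Fin D)}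
    {s : State} (hD : 1 ≤ D) (hK : 1 ≤ K) (hε : 0 < ε) (hσ : 0 < σ)
    (h : CoversScale N D (slotNum D K m) (meshNum D K ε) o (coords X) s l σ)
    (μ : Fin K → EuclideanSpace ℝ (Fin D)) (y : EuclideanSpace ℝ (Fin D))
    (hy : 5 ^ D * (Finset.univ.filter fun n => ∀ k, σ < ‖X n - μ k‖).card <
      (Finset.univ.filter fun n => ‖X n - y‖ ≤ σ).card * (slotNum D K m - K * 5 ^ D)) :
    ∃ g ∈ listed D s o l, ‖g - y‖ ≤ ε * σ / (32 * K) := by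
  obtain ⟨c, r, hH, hG⟩ := h
  obtain ⟨j, hj, hjy⟩ := hH.exists_near (pt := fun n => point D (coords X n))
    (fun n p => sqDist_eq D (coords X) n p) hσ μ y (by
      rw [finrank_euclideanSpace_fin, card_filter_range, card_filter_range]
      simpa only [point_coords] using hy)
  obtain ⟨v, hv, hvy⟩ := exists_gridPoint_near (meshNum_pos hD hK hε) hσ hjy
  exact ⟨_, point_mem_listed (hG j hj v hv), hvy.trans (mesh_le hD hK hε hσ.le)⟩

/-- Turns the length of the diagonal into a lower bound for the size of the set, which is what the
running time is compared with. -/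
theorem card_ge_of_diagonal {D : ℕ} (hD : 1 ≤ D) {W : ℕ} {G : Finset (EuclideanSpace ℝ (Fin D))}
    (h : ∀ w < W, point D (fun _ => (w : ℝ)) ∈ G) : W ≤ G.card := by
  classical
  have hinj : Set.InjOn (fun w : ℕ => point D fun _ => (w : ℝ)) (Finset.range W : Set ℕ) := by
    intro a _ b _ hab
    have := congrArg (fun z : EuclideanSpace ℝ (Fin D) => z ⟨0, hD⟩) hab
    simpa [point] using this
  calc W = ((Finset.range W).image fun w : ℕ => point D fun _ => (w : ℝ)).card := by
        rw [Finset.card_image_of_injOn hinj, Finset.card_range]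
    _ ≤ G.card := Finset.card_le_card fun z hz => by
        obtain ⟨w, hw, rfl⟩ := Finset.mem_image.mp hz
        exact h w (Finset.mem_range.mp hw)

theorem input_real {D N : ℕ} (X : Fin N → EuclideanSpace ℝ (Fin D)) (K m : ℕ) (ε : ℝ) {n i : ℕ}
    (hi : i < D) : (input X K m ε).real (1 + (n * D + i)) = coords X n i := by
  have hD : 0 < D := by omega
  have h1 : (n * D + i) / D = n := by
    rw [mul_comm, Nat.mul_add_div hD, Nat.div_eq_of_lt hi, add_zero]
  have h2 : (n * D + i) % D = i := by
    rw [mul_comm, Nat.mul_add_mod, Nat.mod_eq_of_lt hi]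
  have h3 : 1 + (n * D + i) ≠ 0 := by omega
  simp only [input, coords, h3, if_false, Nat.add_sub_cancel_left, h1, h2]

/-- The `K` centers and the farthest point form `K + 1` points with mutual squared distances at
least `R`. -/
theorem _root_.RealRAM.Farthest.le_optCost {D N K m p : ℕ} (hK : 1 ≤ K) {X : Fin N → EuclideanSpace ℝ (Fin D)}
    {c : ℕ → ℕ} {d : ℕ → ℝ} {R : ℝ} (h : Farthest N (sqDist D (coords X)) K c d R p) :
    R ≤ 2 * (K : ℝ) ^ m * optCost X K m := by
  obtain ⟨-, hR, -⟩ := h.hM hK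
  let e : Fin (K + 1) → Fin N := fun i =>
    if hi : (i : ℕ) < K then ⟨c i, h.hc i hi⟩ else ⟨p, h.hp⟩
  have key : ∀ i j : Fin (K + 1), j < i → R ≤ ‖X (e i) - X (e j)‖ ^ 2 := by
    intro i j hij
    have hij' : (j : ℕ) < i := hij
    have hjK : (j : ℕ) < K := by omega
    rw [norm_sub_rev, ← sqDist_coords]
    have ej : ((e j : Fin N) : ℕ) = c j := by simp [e, hjK]
    rw [ej]
    by_cases hi : (i : ℕ) < K
    · have ei : ((e i : Fin N) : ℕ) = c i := by simp [e, hi]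
      rw [ei]
      exact hR.trans (h.sep i hi j hij' p h.hp)
    · have ei : ((e i : Fin N) : ℕ) = p := by simp [e, hi]
      rw [ei]
      exact hR.trans (h.le p h.hp j hjK)
  refine le_optCost_of_separated hK e fun i j hij => ?_
  rcases lt_or_gt_of_ne hij with h' | h'
  · rw [norm_sub_rev]; exact key j i h'
  · exact key i j h'

theorem _root_.RealRAM.Farthest.exists_membership {D N K m p : ℕ} (hK : 1 ≤ K) (hm : m ≠ 0)
    {X : Fin N → EuclideanSpace ℝ (Fin D)} {c : ℕ → ℕ} {d : ℕ → ℝ} {R : ℝ}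
    (h : Farthest N (sqDist D (coords X)) K c d R p) :
    ∃ r : Fin N → Fin K → ℝ, IsMembership r ∧
      cost X m (fun k : Fin K => point D (coords X (c k))) r ≤ N * R := by
  refine exists_membership_of_near hm fun n => ?_
  obtain ⟨i, hi, hd⟩ := h.near hK n n.2
  refine ⟨⟨i, hi⟩, ?_⟩
  rw [norm_sub_rev, ← point_coords X n, ← sqDist_eq, ← hd]
  exact (h.hM hK).2.2 n n.2

/-- `candidateProg` outputs a candidate set. -/
theorem candidateProg_correct {D K m N : ℕ} (hD : 1 ≤ D) (hK : 1 ≤ K) (hm : 2 ≤ m) (hN : 2 ≤ N)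
    {ε : ℝ} (hε : 0 < ε) (hε1 : ε ≤ 1) (X : Fin N → EuclideanSpace ℝ (Fin D)) :
    ∃ G : Finset (EuclideanSpace ℝ (Fin D)),
      (G.card : ℝ) ≤ 500 * (650 * D) ^ D * ((K : ℝ) ^ (m * D + 1) * (ε⁻¹) ^ D * (m : ℝ) *
          Real.log ((m : ℝ) * (K : ℝ) / ε) * Real.log (N : ℝ)) ∧
      (∃ μ : Fin K → EuclideanSpace ℝ (Fin D), (∀ k, μ k ∈ G) ∧
        inducedCost X m μ ≤ (1 + ε) * optCost X K m) ∧
      ∃ (s : State) (t : ℕ), Exec candidateProg (input X K m ε) s t ∧ Outputs s G ∧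
        t ≤ 300 * (N * K * D * G.card) := by
  classical
  obtain ⟨c, d, R, p, hF, hrun⟩ := candidateProg_spec (s := input X K m ε) (N := N) (D := D)
    (K := K) (m := m) (ε := ε) (x := coords X) (by simp [input]) (by simp [input])
    (by simp [input]) (by simp [input]) (by simp [input]) (by simp [input]) (by simp [input])
    (fun n _ i hi => input_real X K m ε hi) (by omega)
  have hR : 0 ≤ R := (hF.hM hK).1
  obtain ⟨L, hL, hL'⟩ := exists_levels (N := N) (K := K) (m := m) (ε := ε) (R := R)
    (by omega) hK hR
  obtain ⟨o, s, t, hex, ht, h0, h1, hcent, hcov, hdiag⟩ := hrun L hL hL'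
  set l := coreSize D K m ε L + padSize D K m ε L with hl
  have hfin : (listed D s o l).Finite := Set.finite_range _
  have hmem : ∀ z, z ∈ hfin.toFinset ↔ z ∈ listed D s o l := fun z => hfin.mem_toFinset
  have hcard : hfin.toFinset.card ≤ l := by
    rw [← Set.ncard_eq_toFinset_card _ hfin, listed, ← Set.image_univ]
    refine (Set.ncard_image_le Set.finite_univ).trans ?_
    rw [Set.ncard_univ, Nat.card_eq_fintype_card, Fintype.card_fin]
  have hcard' : padSize D K m ε L ≤ hfin.toFinset.card :=
    card_ge_of_diagonal hD fun w hw => (hmem _).mpr (point_mem_listed (hdiag w hw))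
  refine ⟨hfin.toFinset, ?_, ?_, s, t, hex, ?_, ?_⟩
  · exact (Nat.cast_le.mpr hcard).trans (size_le hN hD hK hm hε hε1 hR hL)
  · have hcent' : ∀ k : Fin K, point D (coords X (c k)) ∈ listed D s o l := fun k =>
      point_mem_listed (hcent k k.2)
    obtain ⟨r, hr, hcost⟩ := hF.exists_membership hK (by omega : m ≠ 0)
    -- If `R = 0`, every point coincides with a center and the centers have cost zero. The scales
    -- are needed, and positive, only for `R > 0`.
    rcases hR.eq_or_lt with hR0 | hRpos
    · refine ⟨_, fun k => (hmem _).mpr (hcent' k), (inducedCost_le hr).trans ?_⟩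
      have : (0 : ℝ) ≤ (1 + ε) * optCost X K m := mul_nonneg (by linarith) optCost_nonneg
      rw [← hR0, mul_zero] at hcost
      exact hcost.trans this
    · have hσ : 0 < minScale N K m R := by
        have : 0 < N * K ^ m := by positivity
        have : (0 : ℝ) < (N * K ^ m : ℕ) := by exact_mod_cast this
        exact div_pos (Real.sqrt_pos.mpr hRpos) this
      obtain ⟨μ, hμ, hle⟩ := exists_good_means hK (by omega) (by omega) hε hε1 hRpos
        (hF.le_optCost hK) ((optCost_le hr).trans hcost) hL'
        ⟨_, hcent' ⟨0, hK⟩⟩ fun i hi μ y hy =>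
          (hcov i hi).exists_near hD hK hε (mul_pos (by positivity) hσ) μ y (by
            convert hy)
      exact ⟨μ, fun k => (hmem _).mpr (hμ k), hle⟩
  · rw [Outputs, h0, h1, hfin.coe_toFinset]
    rfl
  · exact ht.trans ((candidateTime_le (by omega) hD hK).trans (by gcongr))

end FuzzyKMeans

theorem theorem7 :
    ∃ (P : RealRAM.Prog) (C₁ : ℕ → ℝ) (C₂ : ℕ → ℕ → ℝ),
      ∀ (D K m N : ℕ), 1 ≤ D → 1 ≤ K → 2 ≤ m → 2 ≤ N →
      ∀ (ε : ℝ), 0 < ε → ε ≤ 1 →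
      ∀ (X : Fin N → EuclideanSpace ℝ (Fin D)),
      ∃ G : Finset (EuclideanSpace ℝ (Fin D)),
        (G.card : ℝ) ≤ C₁ D * ((K : ℝ) ^ (m * D + 1) * (ε⁻¹) ^ D * (m : ℝ) *
            Real.log ((m : ℝ) * (K : ℝ) / ε) * Real.log (N : ℝ)) ∧
        (∃ μ : Fin K → EuclideanSpace ℝ (Fin D), (∀ k, μ k ∈ G) ∧
          FuzzyKMeans.inducedCost X m μ ≤ (1 + ε) * FuzzyKMeans.optCost X K m) ∧
        ∃ (s : RealRAM.State) (t : ℕ),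
          RealRAM.Exec P (FuzzyKMeans.input X K m ε) s t ∧
          FuzzyKMeans.Outputs s G ∧
          (t : ℝ) ≤ C₂ K D * ((N : ℝ) * Real.log (N : ℝ) ^ K * (ε⁻¹) ^ (2 * K ^ 2 * D) +
            (N : ℝ) * (K : ℝ) * (D : ℝ) * (G.card : ℝ)) := by
  refine ⟨RealRAM.candidateProg, fun D => 500 * (650 * D) ^ D, fun _ _ => 300, ?_⟩
  intro D K m N hD hK hm hN ε hε hε1 X
  obtain ⟨G, hG, hμ, s, t, hex, hout, ht⟩ :=
    FuzzyKMeans.candidateProg_correct hD hK hm hN hε hε1 X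
  refine ⟨G, hG, hμ, s, t, hex, hout, ?_⟩
  have h3 : (t : ℝ) ≤ 300 * ((N : ℝ) * K * D * G.card) := by exact_mod_cast ht
  -- The second summand alone bounds the running time, so of the first only nonnegativity is needed.
  have h4 : 0 ≤ (N : ℝ) * Real.log (N : ℝ) ^ K * (ε⁻¹) ^ (2 * K ^ 2 * D) := by
    have := Real.log_natCast_nonneg N
    positivity
  linarith
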